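/- Notation. For $k\ge 0$ put $[k]=\{1,\dots,k\}$; for $1\le l\le k+1$ let $\iota_l:[k]\to[k+1]$ be the increasing injection omitting $l$. For a complex vector space $U$, $A\in\mathrm{End}(U)$, $f\in U^*$, $u\in U$ let $A^{(i)}:U^{\otimes k}\to U^{\otimes k}$ apply $A$ to the $i$-th factor, let $f^{(l)}:U^{\otimes k+1}\to U^{\otimes k}$ contract the $l$-th factor with $f$, and let $u^{(l)}:U^{\otimes k}\to U^{\otimes k+1}$ insert $u$ as the $l$-th factor. The group $S_k$ permutes the factors of $U^{\otimes k}$; $e_{S_k}=\frac1{k!}\sum_{\sigma\in S_k}\sigma$ is the projection onto $S_k$-invariants. Let $V$ be a finite-dimensional complex vector space, $\mathbf 1\in V$ a nonzero vector and $U\subset V$ a complement of the line $\mathbb C\mathbf 1$. Then $\mathfrak{gl}(V)=\mathbb C\,\mathrm{id}_V\oplus U\oplus U^*\oplus\mathfrak{gl}(U)$, where $u\in U$ corresponds to the endomorphism $\mathbf 1\mapsto u$, $U\mapsto 0$; $f\in U^*$ corresponds to $\mathbf 1\mapsto 0$, $u\mapsto f(u)\mathbf 1$ $(u\in U)$; and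 $A\in\mathfrak{gl}(U)$ is extended by $A\mathbf 1=0$. For $\nu\in\mathbb C$ let $\underline{Rep}(S_\nu)$ be the Deligne category: the Karoubi envelope of the additive envelope of the $\mathbb C$-linear category with objects $\mathfrak h^{\otimes r}$ $(r\ge0)$, with $\mathrm{Hom}(\mathfrak h^{\otimes r},\mathfrak h^{\otimes s})$ having as basis the set partitions of $\{1,\dots,r,1',\dots,s'\}$, and with composition $\rho\circ\pi=\nu^{n(\rho,\pi)}\,\rho\star\pi$, where $\rho\star\pi$ is obtained by gluing the diagrams along the middle row and $n(\rho,\pi)$ is the number of components lying entirely in the middle row. Let $\Delta_k$ be the image of the idempotent $x_k=\prod_{i\ne j}(1-c_{ij})$ of $\mathfrak h^{\otimes k}$, where $c_{ij}$ is the identity diagram with the strands $i$ and $j$ joined. The object $\Delta_k$ carries the action of $S_k$ by permutation diagrams, and there are morphisms $res_l:\Delta_{k+1}\to\Delta_k$ and $res_l^*:\Delta_k\to\Delta_{k+1}$ $(1\le l\le k+1)$ induced by the diagrams in which the $l$-th vertex of the row with $k+1$ vertices is solitary and the remaining vertices of the two rows are joined in increasing order. The complex tensor power is the Ind-object $$V^{\underline\otimes\nu}=\bigoplus_{k\ge0}(U^{\otimes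 k}\otimes\Delta_k)^{S_k}$$ of $\underline{Rep}(S_\nu)$. Its $\mathfrak{gl}(V)$-action is given by the following operators: $\mathrm{id}_V$ acts by $\nu$; $u\in U$ acts by $F_u=\frac1{k+1}\sum_{l=1}^{k+1}u^{(l)}\otimes res_l^*$ from degree $k$ to degree $k+1$; $f\in U^*$ acts by $E_f=\sum_{l=1}^{k}f^{(l)}\otimes res_l$ from degree $k\ge1$ to degree $k-1$ and by zero in degree $0$; $A\in\mathfrak{gl}(U)$ acts by $\sum_{i=1}^kA^{(i)}\otimes\mathrm{id}_{\Delta_k}$ in degree $k$. Now let $n\ge0$ be an integer. Let $\mathcal S_n:\underline{Rep}(S_{\nu=n})\to Rep(S_n)$ be the additive functor with $\mathfrak h^{\otimes r}\mapsto(\mathbb C^n)^{\otimes r}=\mathbb C\,\mathrm{Fun}([r],[n])$ that sends a partition $\pi$ of $\{1,\dots,r,1',\dots,s'\}$ to the map $f\mapsto\sum g$, the sum over all $g:[s]\to[n]$ such that $(f,g)$ is constant on the parts of $\pi$. Let $\hat{\mathcal S}_n$ be its extension to Ind-objects commuting with filtered colimits, with values in $\mathbb C[S_n]$-modules. Let $\mathbb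 C\,Inj([k],[n])$ be the space with basis the injections $[k]\to[n]$. On it $S_n$ acts by $g\cdot f=g\circ f$ and $S_k$ by $\sigma\cdot f=f\circ\sigma^{-1}$, and we put $\mathtt{res}_l(f)=f\circ\iota_l$ and $\mathtt{res}_l^*(f)=\sum_{g\circ\iota_l=f}g$. Finally $\mathfrak{gl}(V)$ acts on $V^{\otimes n}$ by $A\mapsto\sum_{i=1}^nA^{(i)}$, and $S_n$ acts on $V^{\otimes n}$ by permuting the factors. **Proposition.** 1. The operators $n$, $F_u=\frac1{k+1}\sum_lu^{(l)}\otimes\mathtt{res}_l^*$, $E_f=\sum_lf^{(l)}\otimes\mathtt{res}_l$ (zero in degree $0$) and $\sum_iA^{(i)}\otimes\mathrm{id}$, for $\mathrm{id}_V$, $u\in U$, $f\in U^*$ and $A\in\mathfrak{gl}(U)$ respectively, define an action of $\mathcal U(\mathfrak{gl}(V))$ on $\bigoplus_{k=0}^n(U^{\otimes k}\otimes\mathbb C\,Inj([k],[n]))^{S_k}$, and there is an isomorphism of $\mathbb C[S_n]\otimes\mathcal U(\mathfrak{gl}(V))$-modules $$\Phi:V^{\otimes n}\xrightarrow{\ \sim\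 }\bigoplus_{k=0}^n(U^{\otimes k}\otimes\mathbb C\,Inj([k],[n]))^{S_k}$$ with $\Phi(\mathbf 1\otimes\dots\otimes\mathbf 1)=1$ in degree $0$. Explicitly, if $j_1<\dots<j_k$, $v_{j_s}=w_s\in U$ for $1\le s\le k$, and $v_i=\mathbf 1$ for all other $i$, then $\Phi(v_1\otimes\dots\otimes v_n)=e_{S_k}(w_1\otimes\dots\otimes w_k\otimes f)$, where $f(s)=j_s$. 2. The operators defining the action of $\mathfrak{gl}(V)$ on $V^{\underline\otimes n}$ define an algebra homomorphism $\mathcal U(\mathfrak{gl}(V))\to\mathrm{End}(V^{\underline\otimes n})$, and there is an isomorphism $\hat{\mathcal S}_n(V^{\underline\otimes n})\cong V^{\otimes n}$ of $\mathbb C[S_n]\otimes\mathcal U(\mathfrak{gl}(V))$-modules, where $\mathcal U(\mathfrak{gl}(V))$ acts on the left-hand side by functoriality and $V^{\otimes n}$ is the usual tensor power. -/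

import Mathlib

/-! ### Partition diagrams -/

/-- Partitions of the set `{1, …, r, 1', …, s'}`, given as equivalence relations. -/
abbrev PartDiag (r s : ℕ) : Type := Setoid (Fin r ⊕ Fin s)

namespace PartDiag

/-- The gluing of the diagrams `π` (on top) and `ρ` (at the bottom): the partition of
`{1, …, r} ⊔ {1', …, s'} ⊔ {1'', …, t''}` into connected components. -/
def glue {r s t : ℕ} (π : PartDiag r s) (ρ : PartDiag s t) : Setoid (Fin r ⊕ Fin s ⊕ Fin t) :=
  Relation.EqvGen.setoid fun a b =>
    (∃ x y, π x y ∧ a = Sum.map id Sum.inl x ∧ b = Sum.map id Sum.inl y) ∨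
      (∃ x y, ρ x y ∧ a = Sum.inr x ∧ b = Sum.inr y)

/-- The partition `ρ ⋆ π` induced by the gluing on the top and the bottom row. -/
@[reducible] def star {r s t : ℕ} (π : PartDiag r s) (ρ : PartDiag s t) : PartDiag r t :=
  Setoid.comap (Sum.map id Sum.inr) (glue π ρ)

/-- The connected components of the gluing that lie entirely in the middle row. -/
abbrev Middle {r s t : ℕ} (π : PartDiag r s) (ρ : PartDiag s t) : Type :=
  {c : Quotient (glue π ρ) // ∀ x, Quotient.mk (glue π ρ) x = c → ∃ j, x = Sum.inr (Sum.inl j)}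

/-- The number `n(ρ, π)` of connected components lying entirely in the middle row. -/
noncomputable def loops {r s t : ℕ} (π : PartDiag r s) (ρ : PartDiag s t) : ℕ := Nat.card (Middle π ρ)

/-- The partition of `{1, …, r, 1', …, s'}` into the nonempty fibres of `φ ⊔ ψ`. -/
@[reducible] def fib {r s : ℕ} {T : Type} (φ : Fin r → T) (ψ : Fin s → T) : PartDiag r s :=
  Setoid.ker (Sum.elim φ ψ)

/-- The labelling `(x, y)` of the vertices is constant on the parts of `π`. -/
def Compat {r s : ℕ} {α : Type} (π : PartDiag r s) (x : Fin r → α) (y : Fin s → α) : Prop :=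
  ∀ a b, π a b → Sum.elim x y a = Sum.elim x y b

theorem compat_fib_right {r s : ℕ} {α : Type} (φ : Fin r → Fin s) (x : Fin r → α)
    (y : Fin s → α) : Compat (fib φ id) x y ↔ x = y ∘ φ := by
  constructor
  · intro h
    funext i
    exact h (Sum.inl i) (Sum.inr (φ i)) rfl
  · rintro rfl a b h
    have h' : Sum.elim φ id a = Sum.elim φ id b := h
    have key : ∀ c, Sum.elim (y ∘ φ) y c = y (Sum.elim φ id c) := by rintro (c | c) <;> rfl
    rw [key, key, h']

theorem compat_fib_left {r s : ℕ} {α : Type} (ψ : Fin s → Fin r) (x : Fin r → α)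
    (y : Fin s → α) : Compat (fib id ψ) x y ↔ y = x ∘ ψ := by
  constructor
  · intro h
    funext i
    exact (h (Sum.inl (ψ i)) (Sum.inr i) rfl).symm
  · rintro rfl a b h
    have h' : Sum.elim id ψ a = Sum.elim id ψ b := h
    have key : ∀ c, Sum.elim x (x ∘ ψ) c = x (Sum.elim id ψ c) := by rintro (c | c) <;> rfl
    rw [key, key, h']

section count

variable {r s t : ℕ} (π : PartDiag r s) (ρ : PartDiag s t) {α : Type}

theorem glue_compat (x : Fin r → α) (y : Fin s → α) (z : Fin t → α) :
    (Compat π x y ∧ Compat ρ y z) ↔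
      ∀ a b, glue π ρ a b → Sum.elim x (Sum.elim y z) a = Sum.elim x (Sum.elim y z) b := by
  have key : ∀ c, Sum.elim x (Sum.elim y z) (Sum.map id Sum.inl c) = Sum.elim x y c := by
    rintro (c | c) <;> rfl
  constructor
  · rintro ⟨h1, h2⟩ a b h
    induction h with
    | rel a b h =>
      rcases h with ⟨u, v, h, rfl, rfl⟩ | ⟨u, v, h, rfl, rfl⟩
      · rw [key, key]; exact h1 _ _ h
      · exact h2 _ _ h
    | refl a => rfl
    | symm a b _ ih => exact ih.symm
    | trans a b c _ _ ih1 ih2 => exact ih1.trans ih2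
  · intro h
    refine ⟨fun a b hab => ?_, fun a b hab => ?_⟩
    · rw [← key, ← key]
      exact h _ _ (Relation.EqvGen.rel _ _ (Or.inl ⟨a, b, hab, rfl, rfl⟩))
    · exact h _ _ (Relation.EqvGen.rel _ _ (Or.inr ⟨a, b, hab, rfl, rfl⟩))

theorem star_of_glue {x : Fin r → α} {y : Fin s → α} {z : Fin t → α}
    (h : Compat π x y ∧ Compat ρ y z) : Compat (star π ρ) x z := by
  intro a b hab
  have := (glue_compat π ρ x y z).1 h _ _ hab
  have key : ∀ c, Sum.elim x (Sum.elim y z) (Sum.map id Sum.inr c) = Sum.elim x z c := by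
    rintro (c | c) <;> rfl
  rwa [key, key] at this

open scoped Classical in
/-- Extending a labelling of the outer rows by labels of the middle components. -/
noncomputable def extend {x : Fin r → α} {z : Fin t → α} (m : Middle π ρ → α)
    (c : Quotient (glue π ρ)) : α :=
  if h : ∀ u, Quotient.mk (glue π ρ) u = c → ∃ j, u = Sum.inr (Sum.inl j) then m ⟨c, h⟩
  else
    have h' : ∃ u : Fin r ⊕ Fin t, Quotient.mk (glue π ρ) (Sum.map id Sum.inr u) = c := by
      push Not at h
      obtain ⟨u, hu, hj⟩ := h
      rcases u with u | u | u
      · exact ⟨Sum.inl u, hu⟩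
      · exact absurd rfl (hj u)
      · exact ⟨Sum.inr u, hu⟩
    Sum.elim x z h'.choose

theorem extend_outer {x : Fin r → α} {z : Fin t → α} (hxz : Compat (star π ρ) x z)
    (m : Middle π ρ → α) (u : Fin r ⊕ Fin t) :
    extend π ρ (x := x) (z := z) m (Quotient.mk _ (Sum.map id Sum.inr u)) = Sum.elim x z u := by
  unfold extend
  have hn : ¬ ∀ w, Quotient.mk (glue π ρ) w = Quotient.mk (glue π ρ) (Sum.map id Sum.inr u) →
      ∃ j, w = Sum.inr (Sum.inl j) := by
    intro h
    obtain ⟨j, hj⟩ := h _ rfl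
    rcases u with u | u <;> simp at hj
  rw [dif_neg hn]
  apply hxz
  generalize_proofs h
  exact Quotient.exact (s := glue π ρ) h.choose_spec

/-- The labellings of the middle row compatible with given labels of the outer rows are the
labellings of the middle components. -/
noncomputable def middleEquiv {x : Fin r → α} {z : Fin t → α} (hxz : Compat (star π ρ) x z) :
    {y : Fin s → α // Compat π x y ∧ Compat ρ y z} ≃ (Middle π ρ → α) where
  toFun y c := Quotient.lift (Sum.elim x (Sum.elim y.1 z)) ((glue_compat π ρ x y.1 z).1 y.2) c.1
  invFun m := ⟨fun j => extend π ρ (x := x) (z := z) m (Quotient.mk _ (Sum.inr (Sum.inl j))), by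
    rw [glue_compat]
    have key : ∀ c, Sum.elim x (Sum.elim (fun j => extend π ρ (x := x) (z := z) m
        (Quotient.mk _ (Sum.inr (Sum.inl j)))) z) c =
        extend π ρ (x := x) (z := z) m (Quotient.mk _ c) := by
      rintro (c | c | c)
      · exact (extend_outer π ρ hxz m (Sum.inl c)).symm
      · rfl
      · exact (extend_outer π ρ hxz m (Sum.inr c)).symm
    intro a b h
    rw [key, key, Quotient.sound h]⟩
  left_inv y := by
    apply Subtype.ext
    funext j
    have key : ∀ c, extend π ρ (x := x) (z := z) (fun c =>
        Quotient.lift (Sum.elim x (Sum.elim y.1 z)) ((glue_compat π ρ x y.1 z).1 y.2) c.1)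
          c = Quotient.lift (Sum.elim x (Sum.elim y.1 z))
            ((glue_compat π ρ x y.1 z).1 y.2) c := by
      intro c
      by_cases h : ∀ u, Quotient.mk (glue π ρ) u = c → ∃ j, u = Sum.inr (Sum.inl j)
      · unfold extend
        rw [dif_pos h]
      · have h' := h
        push Not at h'
        obtain ⟨u, hu, hj⟩ := h'
        rcases u with u | u | u
        · rw [← hu]
          exact extend_outer π ρ hxz _ (Sum.inl u)
        · exact absurd rfl (hj u)
        · rw [← hu]
          exact extend_outer π ρ hxz _ (Sum.inr u)
    exact key _
  right_inv m := by
    funext ⟨c, hc⟩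
    induction c using Quotient.inductionOn with
    | h u =>
      obtain ⟨j, rfl⟩ := hc u rfl
      change extend π ρ (x := x) (z := z) m (Quotient.mk _ (Sum.inr (Sum.inl j))) = _
      unfold extend
      rw [dif_pos hc]

instance : Finite (Middle π ρ) := by
  have : Finite (Quotient (glue π ρ)) := Quotient.finite _
  infer_instance

open scoped Classical in
theorem count [Fintype α] (x : Fin r → α) (z : Fin t → α) :
    Nat.card {y : Fin s → α // Compat π x y ∧ Compat ρ y z} =
      if Compat (star π ρ) x z then Fintype.card α ^ loops π ρ else 0 := by
  split_ifs with h
  · rw [Nat.card_congr (middleEquiv π ρ h), Nat.card_fun, Nat.card_eq_fintype_card, loops]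
  · rw [Nat.card_eq_zero]
    left
    exact ⟨fun y => h (star_of_glue π ρ y.2)⟩

end count

open scoped Classical in
theorem eq_of_weights {r s : ℕ} {π π' : PartDiag r s} {a b : ℕ}
    (h : ∀ (x : Fin r → Bool) (y : Fin s → Bool),
      (if Compat π x y then 2 ^ a else 0) = (if Compat π' x y then 2 ^ b else 0)) :
    π = π' ∧ a = b := by
  have hc : ∀ (τ : PartDiag r s), Compat τ (fun _ => true) (fun _ => true) := by
    rintro τ (u | u) (v | v) _ <;> rfl
  have hab : a = b := by
    have := h (fun _ => true) (fun _ => true)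
    rw [if_pos (hc _), if_pos (hc _)] at this
    exact Nat.pow_right_injective le_rfl this
  subst hab
  have hiff : ∀ x y, Compat (α := Bool) π x y ↔ Compat π' x y := by
    intro x y
    have := h x y
    have h0 : (2 : ℕ) ^ a ≠ 0 := by positivity
    by_cases h1 : Compat π x y <;> by_cases h2 : Compat π' x y <;> simp_all
  have key : ∀ (τ τ' : PartDiag r s), (∀ x y, Compat (α := Bool) τ x y → Compat τ' x y) →
      ∀ u v, τ' u v → τ u v := by
    intro τ τ' hh u v huv
    let f : Fin r ⊕ Fin s → Bool := fun w => decide (τ u w)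
    have hf : Sum.elim (f ∘ Sum.inl) (f ∘ Sum.inr) = f := by
      funext w; rcases w with w | w <;> rfl
    have h1 : Compat τ (f ∘ Sum.inl) (f ∘ Sum.inr) := by
      intro p q hpq
      rw [hf]
      simp only [f, decide_eq_decide]
      exact ⟨fun h => τ.trans h hpq, fun h => τ.trans h (τ.symm hpq)⟩
    have h2 := hh _ _ h1 u v huv
    rw [hf] at h2
    simp only [f, decide_eq_decide] at h2
    exact h2.1 (τ.refl u)
  exact ⟨Setoid.ext fun u v =>
    ⟨key π' π (fun x y => (hiff x y).2) u v, key π π' (fun x y => (hiff x y).1) u v⟩, rfl⟩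

/-- Two composites of diagrams agree as soon as they have the same number of compatible
labellings of the middle row. -/
theorem star_eq_of_count {r s s' t : ℕ} {π : PartDiag r s} {ρ : PartDiag s t} {π' : PartDiag r s'}
    {ρ' : PartDiag s' t}
    (h : ∀ (x : Fin r → Bool) (z : Fin t → Bool),
      Nat.card {y : Fin s → Bool // Compat π x y ∧ Compat ρ y z} =
        Nat.card {y : Fin s' → Bool // Compat π' x y ∧ Compat ρ' y z}) :
    star π ρ = star π' ρ' ∧ loops π ρ = loops π' ρ' := by
  classical
  apply eq_of_weights
  intro x z
  have := h x z
  rw [count, count] at this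
  simpa using this

/-- Associativity of the gluing, with the numbers of removed components. -/
theorem star_assoc {r s t q : ℕ} (π : PartDiag r s) (ρ : PartDiag s t) (σ : PartDiag t q) :
    star (star π ρ) σ = star π (star ρ σ) ∧
      loops π ρ + loops (star π ρ) σ = loops ρ σ + loops π (star ρ σ) := by
  classical
  apply eq_of_weights
  intro x w
  have h1 : Nat.card {p : (Fin s → Bool) × (Fin t → Bool) //
      Compat π x p.1 ∧ Compat ρ p.1 p.2 ∧ Compat σ p.2 w} =
      if Compat (star (star π ρ) σ) x w then 2 ^ (loops π ρ + loops (star π ρ) σ) else 0 := by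
    let e : {p : (Fin s → Bool) × (Fin t → Bool) //
        Compat π x p.1 ∧ Compat ρ p.1 p.2 ∧ Compat σ p.2 w} ≃
        Σ z : {z : Fin t → Bool // Compat (star π ρ) x z ∧ Compat σ z w},
          {y : Fin s → Bool // Compat π x y ∧ Compat ρ y z.1} :=
      { toFun := fun p => ⟨⟨p.1.2, star_of_glue π ρ ⟨p.2.1, p.2.2.1⟩, p.2.2.2⟩,
          ⟨p.1.1, p.2.1, p.2.2.1⟩⟩
        invFun := fun q => ⟨(q.2.1, q.1.1), q.2.2.1, q.2.2.2, q.1.2.2⟩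
        left_inv := fun _ => rfl
        right_inv := fun _ => rfl }
    rw [Nat.card_congr e, Nat.card_sigma]
    have : ∀ z : {z : Fin t → Bool // Compat (star π ρ) x z ∧ Compat σ z w},
        Nat.card {y : Fin s → Bool // Compat π x y ∧ Compat ρ y z.1} = 2 ^ loops π ρ := by
      intro z
      rw [count, if_pos z.2.1]; simp
    simp only [this, Finset.sum_const, Finset.card_univ, smul_eq_mul]
    rw [← Nat.card_eq_fintype_card, count]
    split_ifs
    · rw [Fintype.card_bool, pow_add, mul_comm]
    · simp
  have h2 : Nat.card {p : (Fin s → Bool) × (Fin t → Bool) //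
      Compat π x p.1 ∧ Compat ρ p.1 p.2 ∧ Compat σ p.2 w} =
      if Compat (star π (star ρ σ)) x w then 2 ^ (loops ρ σ + loops π (star ρ σ)) else 0 := by
    let e : {p : (Fin s → Bool) × (Fin t → Bool) //
        Compat π x p.1 ∧ Compat ρ p.1 p.2 ∧ Compat σ p.2 w} ≃
        Σ y : {y : Fin s → Bool // Compat π x y ∧ Compat (star ρ σ) y w},
          {z : Fin t → Bool // Compat ρ y.1 z ∧ Compat σ z w} :=
      { toFun := fun p => ⟨⟨p.1.1, p.2.1, star_of_glue ρ σ ⟨p.2.2.1, p.2.2.2⟩⟩,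
          ⟨p.1.2, p.2.2.1, p.2.2.2⟩⟩
        invFun := fun q => ⟨(q.1.1, q.2.1), q.1.2.1, q.2.2.1, q.2.2.2⟩
        left_inv := fun _ => rfl
        right_inv := fun _ => rfl }
    rw [Nat.card_congr e, Nat.card_sigma]
    have : ∀ y : {y : Fin s → Bool // Compat π x y ∧ Compat (star ρ σ) y w},
        Nat.card {z : Fin t → Bool // Compat ρ y.1 z ∧ Compat σ z w} = 2 ^ loops ρ σ := by
      intro y
      rw [count, if_pos y.2.2]; simp
    simp only [this, Finset.sum_const, Finset.card_univ, smul_eq_mul]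
    rw [← Nat.card_eq_fintype_card, count]
    split_ifs
    · rw [Fintype.card_bool, pow_add, mul_comm]
    · simp
  rw [← h1, ← h2]

theorem one_star {r s : ℕ} (π : PartDiag r s) :
    star (fib id id) π = π ∧ loops (fib id id) π = 0 := by
  classical
  apply eq_of_weights
  intro x z
  have := count (fib id id) π x z
  rw [Fintype.card_bool] at this
  rw [← this]
  simp only [compat_fib_left, Function.comp_id, pow_zero]
  split_ifs with h
  · rw [Nat.card_eq_one_iff_unique]
    exact ⟨⟨fun a b => Subtype.ext (a.2.1.trans b.2.1.symm)⟩, ⟨⟨x, rfl, h⟩⟩⟩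
  · rw [Nat.card_eq_zero]
    left
    refine ⟨fun y => h ?_⟩
    have := y.2.2
    rwa [y.2.1] at this

theorem star_one {r s : ℕ} (π : PartDiag r s) :
    star π (fib id id) = π ∧ loops π (fib id id) = 0 := by
  classical
  apply eq_of_weights
  intro x z
  have := count π (fib id id) x z
  rw [Fintype.card_bool] at this
  rw [← this]
  simp only [compat_fib_left, Function.comp_id, pow_zero]
  split_ifs with h
  · rw [Nat.card_eq_one_iff_unique]
    exact ⟨⟨fun a b => Subtype.ext (a.2.2.symm.trans b.2.2)⟩, ⟨⟨z, h, rfl⟩⟩⟩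
  · rw [Nat.card_eq_zero]
    left
    refine ⟨fun y => h ?_⟩
    have := y.2.1
    rwa [← y.2.2] at this

end PartDiag

/-! ### The Deligne category -/

open CategoryTheory CategoryTheory.Limits CategoryTheory.Idempotents
open scoped TensorProduct DirectSum

/-- The objects `𝔥^{⊗ r}`, `r = 0, 1, 2, …`, of the category with parameter `ν`.
(The universe is chosen to match the one of additive envelopes in Mathlib.) -/
structure TensorPowers (ν : ℂ) : Type 1 where
  /-- the exponent `r` of `𝔥^{⊗ r}` -/
  deg : ℕ

namespace TensorPowers

variable {ν : ℂ}

/-- The space `ℂ P_{r,s}` with basis the partitions of `{1, …, r, 1', …, s'}`. -/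
abbrev HomSpace (r s : ℕ) : Type := PartDiag r s →₀ ℂ

/-- The bilinear composition with `ρ ∘ π = ν ^ n(ρ, π) • (ρ ⋆ π)` on partitions. -/
noncomputable def comp (ν : ℂ) (r s t : ℕ) :
    HomSpace r s →ₗ[ℂ] HomSpace s t →ₗ[ℂ] HomSpace r t :=
  Finsupp.lsum ℂ fun π => LinearMap.toSpanSingleton ℂ _ (Finsupp.lsum ℂ fun ρ =>
    LinearMap.toSpanSingleton ℂ _
      (Finsupp.single (PartDiag.star π ρ) (ν ^ PartDiag.loops π ρ)))

theorem comp_single (r s t : ℕ) (π : PartDiag r s) (ρ : PartDiag s t) (a b : ℂ) :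
    comp ν r s t (Finsupp.single π a) (Finsupp.single ρ b) =
      Finsupp.single (PartDiag.star π ρ) (a * (b * ν ^ PartDiag.loops π ρ)) := by
  simp only [comp, Finsupp.lsum_single, LinearMap.toSpanSingleton_apply, LinearMap.smul_apply,
    Finsupp.smul_single, smul_eq_mul]

theorem comp_assoc (r s t q : ℕ) (f : HomSpace r s) (g : HomSpace s t) (h : HomSpace t q) :
    comp ν r t q (comp ν r s t f g) h = comp ν r s q f (comp ν s t q g h) := by
  induction f using Finsupp.induction_linear with
  | zero => simp
  | add f f' hf hf' => simp only [map_add, LinearMap.add_apply, hf, hf']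
  | single π a =>
    induction g using Finsupp.induction_linear with
    | zero => simp
    | add g g' hg hg' => simp only [map_add, LinearMap.add_apply, hg, hg']
    | single ρ b =>
      induction h using Finsupp.induction_linear with
      | zero => simp
      | add h h' hh hh' => simp only [map_add, hh, hh']
      | single σ c =>
        simp only [comp_single]
        obtain ⟨h1, h2⟩ := PartDiag.star_assoc π ρ σ
        rw [h1]
        congr 1
        have h3 : ν ^ PartDiag.loops π ρ * ν ^ PartDiag.loops (PartDiag.star π ρ) σ =
            ν ^ PartDiag.loops ρ σ * ν ^ PartDiag.loops π (PartDiag.star ρ σ) := by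
          rw [← pow_add, ← pow_add, h2]
        linear_combination a * b * c * h3

/-- The category with objects `𝔥^{⊗ r}` and morphism spaces `ℂ P_{r,s}`. -/
noncomputable instance : Category (TensorPowers ν) where
  Hom X Y := HomSpace X.deg Y.deg
  id X := Finsupp.single (PartDiag.fib id id) 1
  comp {X Y Z} f g := comp ν X.deg Y.deg Z.deg f g
  id_comp {X Y} f := by
    induction f using Finsupp.induction_linear with
    | zero => simp
    | add f f' hf hf' => simp only [map_add, hf, hf']
    | single π a =>
      rw [comp_single, (PartDiag.one_star π).1, (PartDiag.one_star π).2]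
      simp
  comp_id {X Y} f := by
    induction f using Finsupp.induction_linear with
    | zero => simp
    | add f f' hf hf' => simp only [map_add, LinearMap.add_apply, hf, hf']
    | single π a =>
      rw [comp_single, (PartDiag.star_one π).1, (PartDiag.star_one π).2]
      simp
  assoc f g h := comp_assoc _ _ _ _ f g h

noncomputable instance : Preadditive (TensorPowers ν) where
  homGroup X Y := inferInstanceAs (AddCommGroup (HomSpace X.deg Y.deg))
  add_comp X Y Z f f' g := (comp ν X.deg Y.deg Z.deg).map_add₂ f f' g
  comp_add X Y Z f g g' := (comp ν X.deg Y.deg Z.deg f).map_add g g'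

noncomputable instance : Linear ℂ (TensorPowers ν) where
  homModule X Y := inferInstanceAs (Module ℂ (HomSpace X.deg Y.deg))
  smul_comp X Y Z c f g := (comp ν X.deg Y.deg Z.deg).map_smul₂ c f g
  comp_smul X Y Z f c g := (comp ν X.deg Y.deg Z.deg f).map_smul c g

/-- The morphism `𝔥^{⊗ r} ⟶ 𝔥^{⊗ s}` given by a diagram. -/
noncomputable def diag {r s : ℕ} (π : PartDiag r s) :
    (⟨r⟩ : TensorPowers ν) ⟶ ⟨s⟩ := (Finsupp.single π 1 : HomSpace r s)

theorem id_eq_diag (r : ℕ) : 𝟙 (⟨r⟩ : TensorPowers ν) = diag (PartDiag.fib id id) := rfl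

theorem diag_comp_eq {r s s' t : ℕ} {π : PartDiag r s} {ρ : PartDiag s t} {π' : PartDiag r s'}
    {ρ' : PartDiag s' t}
    (h : ∀ (x : Fin r → Bool) (z : Fin t → Bool),
      Nat.card {y : Fin s → Bool // PartDiag.Compat π x y ∧ PartDiag.Compat ρ y z} =
        Nat.card {y : Fin s' → Bool // PartDiag.Compat π' x y ∧ PartDiag.Compat ρ' y z}) :
    (diag π ≫ diag ρ : (⟨r⟩ : TensorPowers ν) ⟶ ⟨t⟩) = diag π' ≫ diag ρ' := by
  change comp ν _ _ _ (Finsupp.single π 1) (Finsupp.single ρ 1) =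
    comp ν _ _ _ (Finsupp.single π' 1) (Finsupp.single ρ' 1)
  obtain ⟨h1, h2⟩ := PartDiag.star_eq_of_count h
  rw [comp_single, comp_single, h1, h2]

end TensorPowers

section LinearStructures

variable {R : Type} [CommRing R] {C : Type 1} [Category.{0} C] [Preadditive C] [Linear R C]

instance : Linear R (Mat_ C) where
  homModule M N := inferInstanceAs (Module R (∀ i : M.ι, ∀ j : N.ι, M.X i ⟶ N.X j))
  smul_comp X Y Z c f g := by
    ext i k
    simp only [Mat_.comp_apply]
    change ∑ j, (c • f i j) ≫ g j k = c • ∑ j, f i j ≫ g j k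
    simp [Finset.smul_sum]
  comp_smul X Y Z f c g := by
    ext i k
    simp only [Mat_.comp_apply]
    change ∑ j, f i j ≫ (c • g j k) = c • ∑ j, f i j ≫ g j k
    simp [Finset.smul_sum]

noncomputable instance (X Y : Karoubi C) : Module R (X ⟶ Y) where
  smul c f := ⟨c • f.f, by rw [Linear.smul_comp, Linear.comp_smul, f.comm]⟩
  one_smul f := by ext; exact one_smul R f.f
  mul_smul a b f := by ext; exact mul_smul a b f.f
  smul_zero a := by ext; exact smul_zero a
  smul_add a f g := by ext; exact smul_add a f.f g.f
  add_smul a b f := by ext; exact add_smul a b f.f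
  zero_smul f := by ext; exact zero_smul R f.f

noncomputable instance : Linear R (Karoubi C) where
  smul_comp X Y Z c f g := by ext; exact Linear.smul_comp _ _ _ c f.f g.f
  comp_smul X Y Z f c g := by ext; exact Linear.comp_smul _ _ _ f.f c g.f

end LinearStructures

/-- The Deligne category `Rep(S_ν)`: the Karoubi envelope of the additive envelope of the
category of the tensor powers `𝔥^{⊗ r}`. -/
abbrev Deligne (ν : ℂ) : Type 1 := Karoubi (Mat_ (TensorPowers ν))


/-! ### The objects `Δ_k` -/

namespace PartDiag

/-- The identity diagram of `𝔥^{⊗ k}` in which moreover the strands `i` and `j` are joined. -/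
@[reducible] def join {k : ℕ} (i j : Fin k) : PartDiag k k :=
  Setoid.comap (Sum.elim id id) (Relation.EqvGen.setoid fun a b => a = i ∧ b = j)

theorem compat_join {k : ℕ} {α : Type} (i j : Fin k) (x y : Fin k → α) :
    Compat (join i j) x y ↔ y = x ∧ x i = x j := by
  constructor
  · intro h
    have h1 : y = x := by
      funext a
      exact (h (Sum.inl a) (Sum.inr a) (Relation.EqvGen.refl a)).symm
    exact ⟨h1, h (Sum.inl i) (Sum.inl j) (Relation.EqvGen.rel _ _ ⟨rfl, rfl⟩)⟩
  · rintro ⟨rfl, h⟩ a b hab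
    have hab' : Relation.EqvGen (fun a b => a = i ∧ b = j) (Sum.elim id id a) (Sum.elim id id b) :=
      hab
    have key : ∀ c : Fin k ⊕ Fin k, Sum.elim y y c = y (Sum.elim id id c) := by
      rintro (c | c) <;> rfl
    rw [key, key]
    revert hab'
    generalize (Sum.elim id id a : Fin k) = a'
    generalize (Sum.elim id id b : Fin k) = b'
    intro hab'
    induction hab' with
    | rel a b h' => rcases h' with ⟨rfl, rfl⟩; exact h
    | refl a => rfl
    | symm a b _ ih => exact ih.symm
    | trans a b c _ _ ih1 ih2 => exact ih1.trans ih2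

end PartDiag

theorem natCard_eq_of_subsingleton {α β : Type} (hα : ∀ a b : α, a = b) (hβ : ∀ a b : β, a = b)
    (f : α → β) (g : β → α) : Nat.card α = Nat.card β :=
  Nat.card_congr ⟨f, g, fun _ => hα _ _, fun _ => hβ _ _⟩

theorem noncommProd_intertwine {M ι : Type} [Monoid M] [DecidableEq ι] (s : M) (A : Finset ι)
    (f g : ι → M) (hf : (A : Set ι).Pairwise (Function.onFun Commute f))
    (hg : (A : Set ι).Pairwise (Function.onFun Commute g)) (h : ∀ i ∈ A, s * f i = g i * s) :
    s * A.noncommProd f hf = A.noncommProd g hg * s := by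
  induction A using Finset.induction_on with
  | empty => simp
  | insert a A ha ih =>
    rw [Finset.noncommProd_insert_of_notMem _ _ _ _ ha,
      Finset.noncommProd_insert_of_notMem _ _ _ _ ha, ← mul_assoc,
      h a (Finset.mem_insert_self a A), mul_assoc,
      ih _ _ (fun i hi => h i (Finset.mem_insert_of_mem hi)), mul_assoc]

theorem noncommProd_idem {M ι : Type} [Monoid M] [DecidableEq ι] (A : Finset ι)
    (f : ι → M) (hf : (A : Set ι).Pairwise (Function.onFun Commute f))
    (h : ∀ i ∈ A, f i * f i = f i) :
    A.noncommProd f hf * A.noncommProd f hf = A.noncommProd f hf := by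
  rw [← Finset.noncommProd_mul_distrib f f hf hf (fun i hi j hj hij => hf hi hj hij)]
  exact Finset.noncommProd_congr rfl h _

theorem noncommProd_offDiag_perm {M ι : Type} [Monoid M] [DecidableEq ι] [Fintype ι]
    (σ : Equiv.Perm ι) (f : ι × ι → M) (hf : Pairwise (Function.onFun Commute f)) :
    (Finset.univ : Finset ι).offDiag.noncommProd (fun p => f (σ p.1, σ p.2))
      (fun _ _ _ _ h => hf fun h' => h (by simpa [Prod.ext_iff] using h')) =
    (Finset.univ : Finset ι).offDiag.noncommProd f (fun _ _ _ _ h => hf h) := by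
  unfold Finset.noncommProd
  congr 1
  have hm : (Finset.univ : Finset ι).offDiag.val.map (fun p => (σ p.1, σ p.2)) =
      (Finset.univ : Finset ι).offDiag.val := by
    have hi : Function.Injective fun p : ι × ι => (σ p.1, σ p.2) := by
      rintro ⟨a, b⟩ ⟨c, d⟩ h
      simpa using h
    have h3 : (Finset.univ : Finset ι).offDiag.map ⟨_, hi⟩ =
        (Finset.univ : Finset ι).offDiag := by
      apply Finset.eq_of_subset_of_card_le
      · intro p hp
        simp only [Finset.mem_map, Finset.mem_offDiag, Finset.mem_univ, true_and,
          Function.Embedding.coeFn_mk] at hp ⊢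
        obtain ⟨q, hq, rfl⟩ := hp
        exact fun h => hq (σ.injective h)
      · rw [Finset.card_map]
    exact congrArg Finset.val h3
  conv_rhs => rw [← hm, Multiset.map_map]
  rfl

theorem sandwich_comp_right {C : Type 1} [Category.{0} C] {X Y : C} {p : X ⟶ X} {q : Y ⟶ Y}
    (hq : q ≫ q = q) (f : X ⟶ Y) {s : Y ⟶ Y} (h : q ≫ s = s ≫ q) :
    (p ≫ f ≫ q) ≫ q ≫ s ≫ q = p ≫ (f ≫ s) ≫ q := by
  have h1 : q ≫ q ≫ s ≫ q = s ≫ q := by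
    rw [← Category.assoc, hq, ← Category.assoc, h, Category.assoc, hq]
  simp only [Category.assoc, h1]

theorem sandwich_comp_left {C : Type 1} [Category.{0} C] {X Y : C} {p : X ⟶ X} {q : Y ⟶ Y}
    (hp : p ≫ p = p) (f : X ⟶ Y) {s : X ⟶ X} (h : p ≫ s = s ≫ p) :
    (p ≫ s ≫ p) ≫ p ≫ f ≫ q = p ≫ (s ≫ f) ≫ q := by
  have h1 : p ≫ s ≫ p = p ≫ s := by
    rw [← h, ← Category.assoc, hp]
  have h2 : p ≫ s ≫ p ≫ f ≫ q = p ≫ s ≫ f ≫ q := by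
    rw [← Category.assoc s p, ← Category.assoc p (s ≫ p), h1, Category.assoc]
  simp only [Category.assoc]
  rw [← Category.assoc p p, hp, h2]

namespace TensorPowers

variable {ν : ℂ}

theorem join_commute {k : ℕ} (i j i' j' : Fin k) :
    (diag (PartDiag.join i j) ≫ diag (PartDiag.join i' j') : (⟨k⟩ : TensorPowers ν) ⟶ ⟨k⟩) =
      diag (PartDiag.join i' j') ≫ diag (PartDiag.join i j) := by
  apply diag_comp_eq
  intro x z
  simp only [PartDiag.compat_join]
  refine natCard_eq_of_subsingleton
    (fun a b => Subtype.ext (a.2.1.1.trans b.2.1.1.symm))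
    (fun a b => Subtype.ext (a.2.1.1.trans b.2.1.1.symm))
    (fun y => ⟨x, ?_⟩) (fun y => ⟨x, ?_⟩)
  · obtain ⟨y, ⟨rfl, h1⟩, rfl, h2⟩ := y
    exact ⟨⟨rfl, h2⟩, rfl, h1⟩
  · obtain ⟨y, ⟨rfl, h1⟩, rfl, h2⟩ := y
    exact ⟨⟨rfl, h2⟩, rfl, h1⟩

theorem join_idem {k : ℕ} (i j : Fin k) :
    (diag (PartDiag.join i j) ≫ diag (PartDiag.join i j) : (⟨k⟩ : TensorPowers ν) ⟶ ⟨k⟩) =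
      diag (PartDiag.join i j) := by
  have : (diag (PartDiag.join i j) ≫ diag (PartDiag.join i j) :
      (⟨k⟩ : TensorPowers ν) ⟶ ⟨k⟩) =
      diag (PartDiag.fib id id) ≫ diag (PartDiag.join i j) := by
    apply diag_comp_eq
    intro x z
    simp only [PartDiag.compat_join, PartDiag.compat_fib_left, Function.comp_id]
    refine natCard_eq_of_subsingleton
      (fun a b => Subtype.ext (a.2.1.1.trans b.2.1.1.symm))
      (fun a b => Subtype.ext (a.2.1.trans b.2.1.symm))
      (fun y => ⟨x, ?_⟩) (fun y => ⟨x, ?_⟩)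
    · obtain ⟨y, ⟨rfl, h1⟩, rfl, h2⟩ := y
      exact ⟨rfl, rfl, h1⟩
    · obtain ⟨y, rfl, rfl, h2⟩ := y
      exact ⟨⟨rfl, h2⟩, rfl, h2⟩
  rw [this, ← id_eq_diag, Category.id_comp]

/-- The idempotent `c_{i j}` of `𝔥^{⊗ k}` given by the identity diagram with the strands `i`, `j`
joined. -/
noncomputable def joinEnd (ν : ℂ) {k : ℕ} (i j : Fin k) : End (⟨k⟩ : TensorPowers ν) :=
  diag (PartDiag.join i j)

theorem joinEnd_commute {k : ℕ} :
    Pairwise (Function.onFun Commute fun p : Fin k × Fin k => 1 - joinEnd ν p.1 p.2) := by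
  intro p q _
  have h : Commute (joinEnd ν p.1 p.2) (joinEnd ν q.1 q.2) := join_commute _ _ _ _
  exact ((Commute.one_left _).sub_left ((Commute.one_right _).sub_right h))

/-- The idempotent `x_k = ∏_{i ≠ j} (1 - c_{i j})` of `End(𝔥^{⊗ k})` cutting out `Δ_k`, where
`c_{i j}` is the idempotent given by the identity diagram with the strands `i`, `j` joined.  It
interpolates the projection of `ℂ Fun([k], [n])` onto `ℂ Inj([k], [n])` that annihilates the
non-injective functions. -/
noncomputable def injProj (ν : ℂ) (k : ℕ) : End (⟨k⟩ : TensorPowers ν) :=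
  (Finset.univ : Finset (Fin k)).offDiag.noncommProd
    (fun p => 1 - joinEnd ν p.1 p.2) (fun _ _ _ _ h => joinEnd_commute h)

theorem injProj_idem (ν : ℂ) (k : ℕ) : injProj ν k ≫ injProj ν k = injProj ν k := by
  refine noncommProd_idem (M := End (⟨k⟩ : TensorPowers ν)) _ _ _ fun p _ => ?_
  have h : joinEnd ν p.1 p.2 * joinEnd ν p.1 p.2 = joinEnd ν p.1 p.2 := join_idem _ _
  simp only [sub_mul, mul_sub, one_mul, mul_one, h, sub_self, sub_zero]

/-- The diagram of a permutation: `i` is joined to `σ(i)'`. -/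
noncomputable def permDiag (ν : ℂ) {k : ℕ} (σ : Equiv.Perm (Fin k)) :
    (⟨k⟩ : TensorPowers ν) ⟶ ⟨k⟩ := diag (PartDiag.fib σ id)

theorem permDiag_join {k : ℕ} (σ : Equiv.Perm (Fin k)) (i j : Fin k) :
    (diag (PartDiag.join i j) ≫ permDiag ν σ) =
      permDiag ν σ ≫ diag (PartDiag.join (σ i) (σ j)) := by
  apply diag_comp_eq
  intro x z
  simp only [PartDiag.compat_join, PartDiag.compat_fib_right]
  refine natCard_eq_of_subsingleton
    (fun a b => Subtype.ext (a.2.1.1.trans b.2.1.1.symm))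
    (fun a b => Subtype.ext (a.2.2.1.symm.trans b.2.2.1))
    (fun y => ⟨z, ?_⟩) (fun y => ⟨x, ?_⟩)
  · obtain ⟨y, ⟨rfl, h1⟩, rfl⟩ := y
    exact ⟨rfl, rfl, h1⟩
  · obtain ⟨y, rfl, rfl, h2⟩ := y
    exact ⟨⟨rfl, h2⟩, rfl⟩

theorem injProj_eq (ν : ℂ) (k : ℕ) : injProj ν k =
    (Finset.univ : Finset (Fin k)).offDiag.noncommProd
      (fun p => 1 - joinEnd ν p.1 p.2) (fun _ _ _ _ h => joinEnd_commute h) := rfl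

attribute [irreducible] injProj

theorem perm_mul_injProj (ν : ℂ) {k : ℕ} (σ : Equiv.Perm (Fin k))
    (s : End (⟨k⟩ : TensorPowers ν))
    (hs : ∀ i j, s * joinEnd ν i j = joinEnd ν (σ i) (σ j) * s) :
    s * injProj ν k = injProj ν k * s := by
  conv_rhs => rw [injProj_eq, ← noncommProd_offDiag_perm σ
    (fun p => 1 - joinEnd ν p.1 p.2) joinEnd_commute]
  rw [injProj_eq]
  apply noncommProd_intertwine
  intro p _
  rw [mul_sub, sub_mul, hs, one_mul, mul_one]

theorem injProj_permDiag (ν : ℂ) {k : ℕ} (σ : Equiv.Perm (Fin k)) :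
    injProj ν k ≫ permDiag ν σ = permDiag ν σ ≫ injProj ν k :=
  perm_mul_injProj ν σ (permDiag ν σ) (permDiag_join σ)

/-- The diagram of `res_l`: the top vertex `l` is solitary, and the other top vertices are joined
with the bottom vertices in increasing order. -/
noncomputable def resDiag (ν : ℂ) {k : ℕ} (l : Fin (k + 1)) :
    (⟨k + 1⟩ : TensorPowers ν) ⟶ ⟨k⟩ := diag (PartDiag.fib id l.succAbove)

/-- The diagram of `res_l^*`: the bottom vertex `l` is solitary, and the other bottom vertices are
joined with the top vertices in increasing order. -/
noncomputable def resStarDiag (ν : ℂ) {k : ℕ} (l : Fin (k + 1)) :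
    (⟨k⟩ : TensorPowers ν) ⟶ ⟨k + 1⟩ := diag (PartDiag.fib l.succAbove id)

theorem permDiag_mul {k : ℕ} (σ τ : Equiv.Perm (Fin k)) :
    permDiag ν (σ * τ) = permDiag ν τ ≫ permDiag ν σ := by
  rw [← Category.id_comp (permDiag ν (σ * τ)), id_eq_diag]
  apply diag_comp_eq
  intro x z
  simp only [PartDiag.compat_fib_right]
  refine natCard_eq_of_subsingleton
    (fun a b => Subtype.ext (a.2.2.trans b.2.2.symm))
    (fun a b => Subtype.ext (a.2.2.trans b.2.2.symm))
    (fun y => ⟨z ∘ σ, ?_⟩) (fun y => ⟨x, ?_⟩)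
  · obtain ⟨y, rfl, rfl⟩ := y
    exact ⟨rfl, rfl⟩
  · obtain ⟨y, rfl, rfl⟩ := y
    exact ⟨rfl, rfl⟩

theorem resDiag_permDiag {k : ℕ} (l : Fin (k + 1)) (σ : Equiv.Perm (Fin (k + 1)))
    (τ : Equiv.Perm (Fin k)) (h : ∀ j, σ (l.succAbove j) = (σ l).succAbove (τ j)) :
    resDiag ν l ≫ permDiag ν τ = permDiag ν σ ≫ resDiag ν (σ l) := by
  apply diag_comp_eq
  intro x z
  simp only [PartDiag.compat_fib_right, PartDiag.compat_fib_left]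
  refine natCard_eq_of_subsingleton
    (fun a b => Subtype.ext (a.2.2.trans b.2.2.symm))
    (fun a b => Subtype.ext (σ.surjective.injective_comp_right (a.2.1.symm.trans b.2.1)))
    (fun y => ⟨x ∘ σ.symm, ?_⟩) (fun y => ⟨z ∘ τ, ?_⟩)
  · obtain ⟨y, h1, h2⟩ := y
    refine ⟨by funext i; simp, ?_⟩
    funext j
    have h3 := congrFun (h1.symm.trans h2) (τ.symm j)
    have h4 := h (τ.symm j)
    simp only [Function.comp_apply, Equiv.apply_symm_apply] at h3 h4 ⊢
    rw [← h3, ← h4, Equiv.symm_apply_apply]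
  · obtain ⟨y, rfl, rfl⟩ := y
    refine ⟨?_, rfl⟩
    funext j
    simp [h]

theorem resStarDiag_permDiag {k : ℕ} (l : Fin (k + 1)) (σ : Equiv.Perm (Fin (k + 1)))
    (τ : Equiv.Perm (Fin k)) (h : ∀ j, σ (l.succAbove j) = (σ l).succAbove (τ j)) :
    resStarDiag ν l ≫ permDiag ν σ = permDiag ν τ ≫ resStarDiag ν (σ l) := by
  apply diag_comp_eq
  intro x z
  simp only [PartDiag.compat_fib_right]
  refine natCard_eq_of_subsingleton
    (fun a b => Subtype.ext (a.2.2.trans b.2.2.symm))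
    (fun a b => Subtype.ext (a.2.2.trans b.2.2.symm))
    (fun y => ⟨z ∘ (σ l).succAbove, ?_⟩) (fun y => ⟨z ∘ σ, ?_⟩)
  · obtain ⟨y, rfl, rfl⟩ := y
    exact ⟨by funext j; simp [h], rfl⟩
  · obtain ⟨y, rfl, rfl⟩ := y
    exact ⟨by funext j; simp [h], rfl⟩

end TensorPowers

namespace Deligne

open TensorPowers

/-- The object `Δ_k` of `Rep(S_ν)`: the image of the idempotent `x_k` of `𝔥^{⊗ k}`. -/
noncomputable def Delta (ν : ℂ) (k : ℕ) : Deligne ν where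
  X := (Mat_.embedding _).obj ⟨k⟩
  p := (Mat_.embedding _).map (injProj ν k)
  idem := by rw [← Functor.map_comp, injProj_idem]

/-- The morphism `Δ_r ⟶ 𝔥^{⊗ r} ⟶ 𝔥^{⊗ s} ⟶ Δ_s` induced by a morphism `𝔥^{⊗ r} ⟶ 𝔥^{⊗ s}`. -/
noncomputable def deltaMap {ν : ℂ} {r s : ℕ} (f : (⟨r⟩ : TensorPowers ν) ⟶ ⟨s⟩) :
    Delta ν r ⟶ Delta ν s :=
  ⟨(Mat_.embedding _).map (injProj ν r ≫ f ≫ injProj ν s), by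
    have h : injProj ν r ≫ (injProj ν r ≫ f ≫ injProj ν s) ≫ injProj ν s =
        injProj ν r ≫ f ≫ injProj ν s := by
      simp only [Category.assoc, injProj_idem]
      rw [← Category.assoc, injProj_idem]
    exact ((congrArg _ ((Mat_.embedding _).map_comp _ _).symm).trans
      ((Mat_.embedding _).map_comp _ _).symm).trans (congrArg (Mat_.embedding _).map h)⟩

theorem deltaMap_id (ν : ℂ) (r : ℕ) : deltaMap (𝟙 (⟨r⟩ : TensorPowers ν)) = 𝟙 (Delta ν r) := by
  have h : injProj ν r ≫ 𝟙 _ ≫ injProj ν r = injProj ν r := by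
    rw [Category.id_comp, injProj_idem]
  exact Karoubi.hom_ext_iff.2 (congrArg (Mat_.embedding _).map h)

theorem deltaMap_comp_permDiag {ν : ℂ} {r s : ℕ} (f : (⟨r⟩ : TensorPowers ν) ⟶ ⟨s⟩)
    (σ : Equiv.Perm (Fin s)) :
    deltaMap f ≫ deltaMap (permDiag ν σ) = deltaMap (f ≫ permDiag ν σ) :=
  Karoubi.hom_ext_iff.2 (((Mat_.embedding _).map_comp _ _).symm.trans (congrArg _
    (sandwich_comp_right (injProj_idem ν s) f (injProj_permDiag ν σ))))

theorem permDiag_comp_deltaMap {ν : ℂ} {r s : ℕ} (σ : Equiv.Perm (Fin r))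
    (f : (⟨r⟩ : TensorPowers ν) ⟶ ⟨s⟩) :
    deltaMap (permDiag ν σ) ≫ deltaMap f = deltaMap (permDiag ν σ ≫ f) :=
  Karoubi.hom_ext_iff.2 (((Mat_.embedding _).map_comp _ _).symm.trans (congrArg _
    (sandwich_comp_left (injProj_idem ν r) f (injProj_permDiag ν σ))))

end Deligne

/-! ### Operators on tensor powers of a vector space -/

namespace TensorPow

variable {U : Type} [AddCommGroup U] [Module ℂ U]

theorem hom_ext {k : ℕ} {M : Type} [AddCommGroup M] [Module ℂ M]
    {f g : (⨂[ℂ] _ : Fin k, U) →ₗ[ℂ] M}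
    (h : ∀ w : Fin k → U, f (PiTensorProduct.tprod ℂ w) = g (PiTensorProduct.tprod ℂ w)) :
    f = g := PiTensorProduct.ext (MultilinearMap.ext h)

/-- The operator `u^{(l)}`, inserting `u` at the place `l`. -/
noncomputable def ins {k : ℕ} (l : Fin (k + 1)) (u : U) :
    (⨂[ℂ] _ : Fin k, U) →ₗ[ℂ] ⨂[ℂ] _ : Fin (k + 1), U :=
  PiTensorProduct.lift
    (MultilinearMap.curryMid (M := fun _ => U) l (PiTensorProduct.tprod ℂ) u)

theorem ins_tprod {k : ℕ} (l : Fin (k + 1)) (u : U) (w : Fin k → U) :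
    ins l u (PiTensorProduct.tprod ℂ w) = PiTensorProduct.tprod ℂ (l.insertNth u w) := by
  rw [ins, PiTensorProduct.lift.tprod]
  rfl

/-- The operator `f^{(l)}`, contracting the place `l` with `f`. -/
noncomputable def contr {k : ℕ} (l : Fin (k + 1)) (f : Module.Dual ℂ U) :
    (⨂[ℂ] _ : Fin (k + 1), U) →ₗ[ℂ] ⨂[ℂ] _ : Fin k, U :=
  PiTensorProduct.lift (LinearMap.uncurryMid l (f.smulRight (PiTensorProduct.tprod ℂ)))

theorem contr_tprod {k : ℕ} (l : Fin (k + 1)) (f : Module.Dual ℂ U) (w : Fin (k + 1) → U) :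
    contr l f (PiTensorProduct.tprod ℂ w) =
      f (w l) • PiTensorProduct.tprod ℂ (fun i => w (l.succAbove i)) := by
  rw [contr, PiTensorProduct.lift.tprod]
  rfl

/-- The operator `A^{(i)}`, applying `A` at the place `i`. -/
noncomputable def app {k : ℕ} (A : Module.End ℂ U) (i : Fin k) :
    (⨂[ℂ] _ : Fin k, U) →ₗ[ℂ] ⨂[ℂ] _ : Fin k, U :=
  PiTensorProduct.map (Function.update (fun _ => LinearMap.id) i A)

theorem app_tprod {k : ℕ} (A : Module.End ℂ U) (i : Fin k) (w : Fin k → U) :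
    app A i (PiTensorProduct.tprod ℂ w) =
      PiTensorProduct.tprod ℂ (Function.update w i (A (w i))) := by
  rw [app, PiTensorProduct.map_tprod]
  congr 1
  funext j
  rcases eq_or_ne j i with rfl | h
  · simp
  · simp [h]

/-- The diagonal action of `A` on the tensor power. -/
noncomputable def diagAct (k : ℕ) (A : Module.End ℂ U) :
    (⨂[ℂ] _ : Fin k, U) →ₗ[ℂ] ⨂[ℂ] _ : Fin k, U := ∑ i, app A i

/-- The action of a permutation on the tensor power, with
`σ • (w_1 ⊗ ⋯ ⊗ w_k) = w_{σ⁻¹(1)} ⊗ ⋯ ⊗ w_{σ⁻¹(k)}`. -/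
noncomputable def perm {k : ℕ} (σ : Equiv.Perm (Fin k)) :
    (⨂[ℂ] _ : Fin k, U) →ₗ[ℂ] ⨂[ℂ] _ : Fin k, U :=
  (PiTensorProduct.reindex ℂ (fun _ : Fin k => U) σ).toLinearMap

theorem perm_tprod {k : ℕ} (σ : Equiv.Perm (Fin k)) (w : Fin k → U) :
    perm σ (PiTensorProduct.tprod ℂ w) = PiTensorProduct.tprod ℂ (fun i => w (σ.symm i)) :=
  PiTensorProduct.reindex_tprod σ w

theorem perm_one (k : ℕ) : perm (1 : Equiv.Perm (Fin k)) =
    (LinearMap.id (R := ℂ) (M := ⨂[ℂ] _ : Fin k, U)) := by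
  refine hom_ext fun w => ?_
  rw [perm_tprod]
  rfl

theorem perm_mul {k : ℕ} (σ τ : Equiv.Perm (Fin k)) :
    perm (U := U) (σ * τ) = perm σ ∘ₗ perm τ := by
  refine hom_ext fun w => ?_
  simp only [LinearMap.comp_apply, perm_tprod]
  rfl

theorem perm_ins {k : ℕ} (l : Fin (k + 1)) (σ : Equiv.Perm (Fin (k + 1)))
    (τ : Equiv.Perm (Fin k)) (h : ∀ j, σ (l.succAbove j) = (σ l).succAbove (τ j)) (u : U) :
    perm σ ∘ₗ ins l u = ins (σ l) u ∘ₗ perm τ := by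
  refine hom_ext fun w => ?_
  simp only [LinearMap.comp_apply, perm_tprod, ins_tprod]
  congr 1
  funext i
  obtain ⟨j, rfl⟩ := σ.surjective i
  rw [Equiv.symm_apply_apply]
  rcases Fin.eq_self_or_eq_succAbove l j with rfl | ⟨m, rfl⟩
  · simp
  · rw [h]
    simp

theorem perm_contr {k : ℕ} (l : Fin (k + 1)) (σ : Equiv.Perm (Fin (k + 1)))
    (τ : Equiv.Perm (Fin k)) (h : ∀ j, σ (l.succAbove j) = (σ l).succAbove (τ j))
    (f : Module.Dual ℂ U) : perm τ ∘ₗ contr l f = contr (σ l) f ∘ₗ perm σ := by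
  refine hom_ext fun w => ?_
  simp only [LinearMap.comp_apply, perm_tprod, contr_tprod,
    map_smul]
  rw [Equiv.symm_apply_apply]
  congr 2
  funext i
  congr 1
  obtain ⟨j, rfl⟩ := τ.surjective i
  rw [← h]
  simp

theorem perm_app {k : ℕ} (A : Module.End ℂ U) (i : Fin k) (σ : Equiv.Perm (Fin k)) :
    perm σ ∘ₗ app A i = app A (σ i) ∘ₗ perm σ := by
  refine hom_ext fun w => ?_
  simp only [LinearMap.comp_apply, perm_tprod, app_tprod]
  congr 1
  funext j
  obtain ⟨j, rfl⟩ := σ.surjective j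
  rw [Equiv.symm_apply_apply]
  rcases eq_or_ne j i with rfl | h
  · simp
  · simp [h]

theorem perm_diagAct (k : ℕ) (A : Module.End ℂ U) (σ : Equiv.Perm (Fin k)) :
    perm σ ∘ₗ diagAct k A = diagAct k A ∘ₗ perm σ := by
  refine LinearMap.ext fun x => ?_
  simp only [diagAct, LinearMap.comp_apply, LinearMap.sum_apply, map_sum]
  refine Eq.trans ?_ (Equiv.sum_comp σ (fun i => app A i (perm σ x)))
  exact Finset.sum_congr rfl fun i _ => LinearMap.congr_fun (perm_app A i σ) x

theorem exists_extend {k : ℕ} (τ : Equiv.Perm (Fin k)) (l : Fin (k + 1)) :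
    ∃ σ : Equiv.Perm (Fin (k + 1)), σ l = l ∧ ∀ j, σ (l.succAbove j) = l.succAbove (τ j) := by
  let F : Equiv.Perm (Fin k) → Fin (k + 1) → Fin (k + 1) := fun τ =>
    l.insertNth (α := fun _ => Fin (k + 1)) l (fun j => l.succAbove (τ j))
  have hF : ∀ τ τ' : Equiv.Perm (Fin k), (∀ j, τ' (τ j) = j) → ∀ i, F τ' (F τ i) = i := by
    intro τ τ' h i
    rcases Fin.eq_self_or_eq_succAbove l i with rfl | ⟨m, rfl⟩
    · simp [F]
    · simp [F, h]
  exact ⟨⟨F τ, F τ.symm, hF _ _ (by simp), hF _ _ (by simp)⟩, by simp [F], by simp [F]⟩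

theorem exists_restrict {k : ℕ} (σ : Equiv.Perm (Fin (k + 1))) (l : Fin (k + 1)) :
    ∃ τ : Equiv.Perm (Fin k), ∀ j, σ (l.succAbove j) = (σ l).succAbove (τ j) := by
  have h : ∀ j, ∃ i, (σ l).succAbove i = σ (l.succAbove j) := fun j =>
    Fin.exists_succAbove_eq fun h => Fin.succAbove_ne l j (σ.injective h)
  choose f hf using h
  have hinj : Function.Injective f := fun a b hab => by
    have := (hf a).symm.trans ((congrArg _ hab).trans (hf b))
    exact Fin.succAbove_right_injective (σ.injective this)
  exact ⟨Equiv.ofBijective f (Finite.injective_iff_bijective.1 hinj), fun j => (hf j).symm⟩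

end TensorPow

/-! ### The sums `⨁ (U^{⊗ k} ⊗ D_k)^{S_k}` -/

/-- A sequence of complex vector spaces `D_k`, each with an action of `S_k`, together with
compatible linear maps `res_l : D_{k+1} → D_k` and `res_l^* : D_k → D_{k+1}`. -/
structure ResSystem where
  /-- the spaces -/
  D : ℕ → Type
  [acg : ∀ k, AddCommGroup (D k)]
  [mod : ∀ k, Module ℂ (D k)]
  /-- the action of the symmetric groups -/
  perm : ∀ {k : ℕ}, Equiv.Perm (Fin k) → D k →ₗ[ℂ] D k
  /-- the maps `res_l` -/
  res : ∀ {k : ℕ}, Fin (k + 1) → D (k + 1) →ₗ[ℂ] D k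
  /-- the maps `res_l^*` -/
  resStar : ∀ {k : ℕ}, Fin (k + 1) → D k →ₗ[ℂ] D (k + 1)
  perm_one : ∀ k, perm (1 : Equiv.Perm (Fin k)) = LinearMap.id
  perm_mul : ∀ {k : ℕ} (σ τ : Equiv.Perm (Fin k)), perm (σ * τ) = perm σ ∘ₗ perm τ
  perm_res : ∀ {k : ℕ} (l : Fin (k + 1)) (σ : Equiv.Perm (Fin (k + 1))) (τ : Equiv.Perm (Fin k)),
    (∀ j, σ (l.succAbove j) = (σ l).succAbove (τ j)) → perm τ ∘ₗ res l = res (σ l) ∘ₗ perm σ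
  perm_resStar : ∀ {k : ℕ} (l : Fin (k + 1)) (σ : Equiv.Perm (Fin (k + 1)))
    (τ : Equiv.Perm (Fin k)), (∀ j, σ (l.succAbove j) = (σ l).succAbove (τ j)) →
    perm σ ∘ₗ resStar l = resStar (σ l) ∘ₗ perm τ

attribute [instance] ResSystem.acg ResSystem.mod

namespace ResSystem

variable (U : Type) [AddCommGroup U] [Module ℂ U] (S : ResSystem)

/-- The space `U^{⊗ k} ⊗ D_k`. -/
abbrev Tens (k : ℕ) : Type := (⨂[ℂ] _ : Fin k, U) ⊗[ℂ] S.D k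

/-- The diagonal action of `S_k` on `U^{⊗ k} ⊗ D_k`. -/
noncomputable def act {k : ℕ} (σ : Equiv.Perm (Fin k)) : S.Tens U k →ₗ[ℂ] S.Tens U k :=
  TensorProduct.map (TensorPow.perm σ) (S.perm σ)

theorem act_mul {k : ℕ} (σ τ : Equiv.Perm (Fin k)) :
    S.act U (σ * τ) = S.act U σ ∘ₗ S.act U τ := by
  rw [act, TensorPow.perm_mul, S.perm_mul, TensorProduct.map_comp]
  rfl

theorem act_one (k : ℕ) : S.act U (1 : Equiv.Perm (Fin k)) = LinearMap.id := by
  rw [act, TensorPow.perm_one, S.perm_one, TensorProduct.map_id]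

/-- The space of invariants `(U^{⊗ k} ⊗ D_k)^{S_k}`. -/
def inv (k : ℕ) : Submodule ℂ (S.Tens U k) where
  carrier := {x | ∀ σ : Equiv.Perm (Fin k), S.act U σ x = x}
  zero_mem' σ := map_zero _
  add_mem' hx hy σ := by rw [map_add, hx σ, hy σ]
  smul_mem' c x hx σ := by rw [map_smul, hx σ]

/-- The sum `⨁ (U^{⊗ k} ⊗ D_k)^{S_k}` over all `k ≥ 0`. -/
abbrev Total : Type := ⨁ k, S.inv U k

noncomputable instance : AddCommGroup (S.Total U) :=
  @DirectSum.instAddCommGroup ℕ (fun k => S.inv U k) fun _ => inferInstance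

/-- The projection `x ↦ (1 / k!) ∑ σ • x` of `U^{⊗ k} ⊗ D_k` onto the invariants. -/
noncomputable def avg (k : ℕ) : S.Tens U k →ₗ[ℂ] S.inv U k :=
  LinearMap.codRestrict _ ((k.factorial : ℂ)⁻¹ • ∑ σ : Equiv.Perm (Fin k), S.act U σ) (by
    intro x σ
    simp only [LinearMap.smul_apply, LinearMap.sum_apply, map_smul, map_sum]
    congr 1
    rw [← Equiv.sum_comp (Equiv.mulLeft σ) (fun τ => S.act U τ x)]
    refine Finset.sum_congr rfl fun τ _ => ?_
    rw [Equiv.coe_mulLeft, act_mul]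
    rfl)

theorem avg_inv {k : ℕ} (x : S.inv U k) : S.avg U k x = x := by
  apply Subtype.ext
  change ((k.factorial : ℂ)⁻¹ • ∑ σ : Equiv.Perm (Fin k), S.act U σ) (x : S.Tens U k) = x
  simp only [LinearMap.smul_apply, LinearMap.sum_apply]
  rw [Finset.sum_congr rfl fun σ _ => x.2 σ, Finset.sum_const, Finset.card_univ,
    Fintype.card_perm, Fintype.card_fin, ← Nat.cast_smul_eq_nsmul ℂ, smul_smul,
    inv_mul_cancel₀ (by exact_mod_cast k.factorial_ne_zero), one_smul]

/-- The operator `(1 / (k + 1)) ∑_l u^{(l)} ⊗ res_l^*` on invariants. -/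
noncomputable def createComp (u : U) (k : ℕ) : S.inv U k →ₗ[ℂ] S.inv U (k + 1) :=
  LinearMap.restrict ((1 / ((k : ℂ) + 1)) •
    ∑ l : Fin (k + 1), TensorProduct.map (TensorPow.ins l u) (S.resStar l)) (by
    intro x hx σ
    simp only [LinearMap.smul_apply, LinearMap.sum_apply, map_smul, map_sum]
    congr 1
    rw [← Equiv.sum_comp σ (fun l => TensorProduct.map (TensorPow.ins l u) (S.resStar l) x)]
    refine Finset.sum_congr rfl fun l _ => ?_
    obtain ⟨τ, h⟩ := TensorPow.exists_restrict σ l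
    conv_rhs => rw [← hx τ]
    rw [act, act, ← LinearMap.comp_apply, ← LinearMap.comp_apply, ← TensorProduct.map_comp,
      ← TensorProduct.map_comp, TensorPow.perm_ins l σ τ h, S.perm_resStar l σ τ h])

/-- The operator `∑_l f^{(l)} ⊗ res_l` on invariants. -/
noncomputable def annihComp (f : Module.Dual ℂ U) (k : ℕ) :
    S.inv U (k + 1) →ₗ[ℂ] S.inv U k :=
  LinearMap.restrict
    (∑ l : Fin (k + 1), TensorProduct.map (TensorPow.contr l f) (S.res l)) (by
    intro x hx τ
    simp only [LinearMap.sum_apply, map_sum]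
    refine Finset.sum_congr rfl fun l _ => ?_
    obtain ⟨σ, hl, h⟩ := TensorPow.exists_extend τ l
    have h' : ∀ j, σ (l.succAbove j) = (σ l).succAbove (τ j) := fun j => by rw [h, hl]
    conv_rhs => rw [← hx σ]
    rw [act, act, ← LinearMap.comp_apply, ← LinearMap.comp_apply, ← TensorProduct.map_comp,
      ← TensorProduct.map_comp, TensorPow.perm_contr l σ τ h', S.perm_res l σ τ h', hl])

/-- The operator `∑_i A^{(i)} ⊗ id` on invariants. -/
noncomputable def diagComp (A : Module.End ℂ U) (k : ℕ) : S.inv U k →ₗ[ℂ] S.inv U k :=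
  LinearMap.restrict (TensorProduct.map (TensorPow.diagAct k A) LinearMap.id) (by
    intro x hx σ
    conv_rhs => rw [← hx σ]
    rw [act, ← LinearMap.comp_apply, ← LinearMap.comp_apply, ← TensorProduct.map_comp,
      ← TensorProduct.map_comp, TensorPow.perm_diagAct, LinearMap.comp_id, LinearMap.id_comp])

theorem coe_createComp (u : U) (k : ℕ) (x : S.inv U k) :
    (S.createComp U u k x : S.Tens U (k + 1)) = (1 / ((k : ℂ) + 1)) •
      ∑ l : Fin (k + 1), TensorProduct.map (TensorPow.ins l u) (S.resStar l) x := by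
  change ((1 / ((k : ℂ) + 1)) •
    ∑ l : Fin (k + 1), TensorProduct.map (TensorPow.ins l u) (S.resStar l)) (x : S.Tens U k) = _
  simp only [LinearMap.smul_apply, LinearMap.sum_apply]

theorem coe_annihComp (f : Module.Dual ℂ U) (k : ℕ) (x : S.inv U (k + 1)) :
    (S.annihComp U f k x : S.Tens U k) =
      ∑ l : Fin (k + 1), TensorProduct.map (TensorPow.contr l f) (S.res l) x := by
  change (∑ l : Fin (k + 1), TensorProduct.map (TensorPow.contr l f) (S.res l))
    (x : S.Tens U (k + 1)) = _
  simp only [LinearMap.sum_apply]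

theorem coe_diagComp (A : Module.End ℂ U) (k : ℕ) (x : S.inv U k) :
    (S.diagComp U A k x : S.Tens U k) =
      TensorProduct.map (TensorPow.diagAct k A) LinearMap.id x := rfl

/-- The operator `F_u` of degree `1` on the sum. -/
noncomputable def create (u : U) : S.Total U →ₗ[ℂ] S.Total U :=
  DirectSum.toModule ℂ ℕ _ fun k => DirectSum.lof ℂ ℕ (fun k => S.inv U k) (k + 1) ∘ₗ
    S.createComp U u k

/-- The operator `E_f` of degree `-1` on the sum; it vanishes in degree `0`. -/
noncomputable def annih (f : Module.Dual ℂ U) : S.Total U →ₗ[ℂ] S.Total U :=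
  DirectSum.toModule ℂ ℕ _ fun k =>
    match k with
    | 0 => 0
    | k + 1 => DirectSum.lof ℂ ℕ (fun k => S.inv U k) k ∘ₗ S.annihComp U f k

/-- The diagonal action of `A` on the sum. -/
noncomputable def diagonal (A : Module.End ℂ U) : S.Total U →ₗ[ℂ] S.Total U :=
  DirectSum.toModule ℂ ℕ _ fun k => DirectSum.lof ℂ ℕ (fun k => S.inv U k) k ∘ₗ
    S.diagComp U A k

theorem create_lof (u : U) (k : ℕ) (x : S.inv U k) :
    S.create U u (DirectSum.lof ℂ ℕ (fun k => S.inv U k) k x) =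
      DirectSum.lof ℂ ℕ (fun k => S.inv U k) (k + 1) (S.createComp U u k x) := by
  rw [create, DirectSum.toModule_lof]; rfl

theorem annih_lof_zero (f : Module.Dual ℂ U) (x : S.inv U 0) :
    S.annih U f (DirectSum.lof ℂ ℕ (fun k => S.inv U k) 0 x) = 0 := by
  rw [annih, DirectSum.toModule_lof]; rfl

theorem annih_lof_succ (f : Module.Dual ℂ U) (k : ℕ) (x : S.inv U (k + 1)) :
    S.annih U f (DirectSum.lof ℂ ℕ (fun k => S.inv U k) (k + 1) x) =
      DirectSum.lof ℂ ℕ (fun k => S.inv U k) k (S.annihComp U f k x) := by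
  rw [annih, DirectSum.toModule_lof]; rfl

theorem diagonal_lof (A : Module.End ℂ U) (k : ℕ) (x : S.inv U k) :
    S.diagonal U A (DirectSum.lof ℂ ℕ (fun k => S.inv U k) k x) =
      DirectSum.lof ℂ ℕ (fun k => S.inv U k) k (S.diagComp U A k x) := by
  rw [diagonal, DirectSum.toModule_lof]; rfl

/-- Families of linear maps `D_k → D'_k` compatible with all structure maps. -/
structure Hom (S S' : ResSystem) where
  /-- the components -/
  app : ∀ k, S.D k →ₗ[ℂ] S'.D k
  perm_app : ∀ {k : ℕ} (σ : Equiv.Perm (Fin k)), S'.perm σ ∘ₗ app k = app k ∘ₗ S.perm σ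
  res_app : ∀ {k : ℕ} (l : Fin (k + 1)), S'.res l ∘ₗ app (k + 1) = app k ∘ₗ S.res l
  resStar_app : ∀ {k : ℕ} (l : Fin (k + 1)),
    S'.resStar l ∘ₗ app k = app (k + 1) ∘ₗ S.resStar l

namespace Hom

variable {U S} {S' : ResSystem} (φ : Hom S S')

theorem act_map {k : ℕ} (σ : Equiv.Perm (Fin k)) (x : S.Tens U k) :
    S'.act U σ (TensorProduct.map LinearMap.id (φ.app k) x) =
      TensorProduct.map LinearMap.id (φ.app k) (S.act U σ x) := by
  rw [act, act, ← LinearMap.comp_apply, ← LinearMap.comp_apply, ← TensorProduct.map_comp,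
    ← TensorProduct.map_comp, φ.perm_app, LinearMap.comp_id, LinearMap.id_comp]

variable (U) in
/-- The induced map on invariants. -/
noncomputable def mapInv (k : ℕ) : S.inv U k →ₗ[ℂ] S'.inv U k :=
  LinearMap.restrict (TensorProduct.map LinearMap.id (φ.app k)) (by
    intro x hx σ
    rw [act_map, hx σ])

theorem coe_mapInv (k : ℕ) (x : S.inv U k) : (φ.mapInv U k x : S'.Tens U k) =
    TensorProduct.map LinearMap.id (φ.app k) x := rfl

variable (U) in
/-- The induced map `⨁ (U^{⊗ k} ⊗ D_k)^{S_k} → ⨁ (U^{⊗ k} ⊗ D'_k)^{S_k}`. -/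
noncomputable def map : S.Total U →ₗ[ℂ] S'.Total U := DirectSum.lmap (φ.mapInv U)

theorem map_lof (k : ℕ) (x : S.inv U k) :
    φ.map U (DirectSum.lof ℂ ℕ (fun k => S.inv U k) k x) =
      DirectSum.lof ℂ ℕ (fun k => S'.inv U k) k (φ.mapInv U k x) := DirectSum.lmap_lof _ _ _

theorem map_create (u : U) (x : S.Total U) :
    φ.map U (S.create U u x) = S'.create U u (φ.map U x) := by
  refine LinearMap.congr_fun (f := φ.map U ∘ₗ S.create U u) (g := S'.create U u ∘ₗ φ.map U) ?_ x
  refine DirectSum.linearMap_ext ℂ fun k => LinearMap.ext fun x => ?_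
  simp only [LinearMap.comp_apply, create_lof, map_lof]
  congr 1
  apply Subtype.ext
  simp only [coe_mapInv, coe_createComp, map_smul, map_sum]
  congr 1
  refine Finset.sum_congr rfl fun l _ => ?_
  rw [← LinearMap.comp_apply, ← LinearMap.comp_apply, ← TensorProduct.map_comp,
    ← TensorProduct.map_comp, φ.resStar_app, LinearMap.comp_id, LinearMap.id_comp]

theorem map_annih (f : Module.Dual ℂ U) (x : S.Total U) :
    φ.map U (S.annih U f x) = S'.annih U f (φ.map U x) := by
  refine LinearMap.congr_fun (f := φ.map U ∘ₗ S.annih U f) (g := S'.annih U f ∘ₗ φ.map U) ?_ x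
  refine DirectSum.linearMap_ext ℂ fun k => LinearMap.ext fun x => ?_
  rcases k with _ | k
  · simp only [LinearMap.comp_apply, annih_lof_zero, map_lof, map_zero]
  simp only [LinearMap.comp_apply, annih_lof_succ, map_lof]
  congr 1
  apply Subtype.ext
  simp only [coe_mapInv, coe_annihComp, map_sum]
  refine Finset.sum_congr rfl fun l _ => ?_
  rw [← LinearMap.comp_apply, ← LinearMap.comp_apply, ← TensorProduct.map_comp,
    ← TensorProduct.map_comp, φ.res_app, LinearMap.comp_id, LinearMap.id_comp]

theorem map_diagonal (A : Module.End ℂ U) (x : S.Total U) :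
    φ.map U (S.diagonal U A x) = S'.diagonal U A (φ.map U x) := by
  refine LinearMap.congr_fun (f := φ.map U ∘ₗ S.diagonal U A) (g := S'.diagonal U A ∘ₗ φ.map U) ?_ x
  refine DirectSum.linearMap_ext ℂ fun k => LinearMap.ext fun x => ?_
  simp only [LinearMap.comp_apply, diagonal_lof, map_lof]
  congr 1
  apply Subtype.ext
  simp only [coe_mapInv, coe_diagComp]
  rw [← LinearMap.comp_apply, ← LinearMap.comp_apply, ← TensorProduct.map_comp,
    ← TensorProduct.map_comp, LinearMap.comp_id, LinearMap.id_comp, LinearMap.comp_id,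
    LinearMap.id_comp]

theorem map_eq_id (φ : Hom S S) (h : ∀ k, φ.app k = LinearMap.id) :
    φ.map U = LinearMap.id := by
  refine DirectSum.linearMap_ext ℂ fun k => LinearMap.ext fun x => ?_
  simp only [LinearMap.comp_apply, map_lof, LinearMap.id_apply]
  congr 1
  apply Subtype.ext
  rw [coe_mapInv, h, TensorProduct.map_id, LinearMap.id_apply]

theorem map_eq_comp {S'' : ResSystem} (φ : Hom S S') (ψ : Hom S' S'') (χ : Hom S S'')
    (h : ∀ k, χ.app k = ψ.app k ∘ₗ φ.app k) : χ.map U = ψ.map U ∘ₗ φ.map U := by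
  refine DirectSum.linearMap_ext ℂ fun k => LinearMap.ext fun x => ?_
  simp only [LinearMap.comp_apply, map_lof]
  congr 1
  apply Subtype.ext
  rw [coe_mapInv, coe_mapInv, coe_mapInv, h, ← LinearMap.comp_apply, ← TensorProduct.map_comp,
    LinearMap.comp_id]

theorem map_eq_add (φ ψ χ : Hom S S') (h : ∀ k, χ.app k = φ.app k + ψ.app k) :
    χ.map U = φ.map U + ψ.map U := by
  refine DirectSum.linearMap_ext ℂ fun k => LinearMap.ext fun x => ?_
  simp only [LinearMap.comp_apply, LinearMap.add_apply, map_lof]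
  rw [← map_add]
  congr 1
  apply Subtype.ext
  rw [Submodule.coe_add, coe_mapInv, coe_mapInv, coe_mapInv, h, TensorProduct.map_add_right,
    LinearMap.add_apply]

theorem map_eq_smul (c : ℂ) (φ χ : Hom S S') (h : ∀ k, χ.app k = c • φ.app k) :
    χ.map U = c • φ.map U := by
  refine DirectSum.linearMap_ext ℂ fun k => LinearMap.ext fun x => ?_
  simp only [LinearMap.comp_apply, LinearMap.smul_apply, map_lof]
  rw [← map_smul]
  congr 1
  apply Subtype.ext
  rw [Submodule.coe_smul, coe_mapInv, coe_mapInv, h, TensorProduct.map_smul_right,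
    LinearMap.smul_apply]

end Hom

end ResSystem

/-! ### The complex tensor power as an object of the Ind-category -/

section IndObjects

variable (C : Type 1) [Category.{0} C] [Preadditive C] [Linear ℂ C]

/-- A sequence of objects `Δ_k` of a `ℂ`-linear category, each with an action of `S_k`, together
with compatible morphisms `res_l : Δ_{k+1} ⟶ Δ_k` and `res_l^* : Δ_k ⟶ Δ_{k+1}`. -/
structure ResObject where
  /-- the objects -/
  obj : ℕ → C
  /-- the action of the symmetric groups -/
  perm : ∀ {k : ℕ}, Equiv.Perm (Fin k) → (obj k ⟶ obj k)
  /-- the morphisms `res_l` -/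
  res : ∀ {k : ℕ}, Fin (k + 1) → (obj (k + 1) ⟶ obj k)
  /-- the morphisms `res_l^*` -/
  resStar : ∀ {k : ℕ}, Fin (k + 1) → (obj k ⟶ obj (k + 1))
  perm_one : ∀ k, perm (1 : Equiv.Perm (Fin k)) = 𝟙 (obj k)
  perm_mul : ∀ {k : ℕ} (σ τ : Equiv.Perm (Fin k)), perm (σ * τ) = perm τ ≫ perm σ
  perm_res : ∀ {k : ℕ} (l : Fin (k + 1)) (σ : Equiv.Perm (Fin (k + 1))) (τ : Equiv.Perm (Fin k)),
    (∀ j, σ (l.succAbove j) = (σ l).succAbove (τ j)) → res l ≫ perm τ = perm σ ≫ res (σ l)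
  perm_resStar : ∀ {k : ℕ} (l : Fin (k + 1)) (σ : Equiv.Perm (Fin (k + 1)))
    (τ : Equiv.Perm (Fin k)), (∀ j, σ (l.succAbove j) = (σ l).succAbove (τ j)) →
    resStar l ≫ perm σ = perm τ ≫ resStar (σ l)

namespace ResObject

variable {C} (X : ResObject C)

/-- The morphism spaces `Hom(Y, Δ_k)`. -/
noncomputable def homSystem (Y : C) : ResSystem where
  D k := Y ⟶ X.obj k
  perm σ := Linear.rightComp ℂ Y (X.perm σ)
  res l := Linear.rightComp ℂ Y (X.res l)
  resStar l := Linear.rightComp ℂ Y (X.resStar l)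
  perm_one k := by ext f; simp [X.perm_one]
  perm_mul σ τ := by ext f; simp [X.perm_mul]
  perm_res l σ τ h := by ext f; simp [X.perm_res l σ τ h]
  perm_resStar l σ τ h := by ext f; simp [X.perm_resStar l σ τ h]

/-- Precomposition with a morphism. -/
noncomputable def homMap {Y Z : C} (f : Z ⟶ Y) : ResSystem.Hom (X.homSystem Y) (X.homSystem Z) where
  app k := Linear.leftComp ℂ (X.obj k) f
  perm_app σ := LinearMap.ext fun g => Category.assoc f g (X.perm σ)
  res_app l := LinearMap.ext fun g => Category.assoc f g (X.res l)
  resStar_app l := LinearMap.ext fun g => Category.assoc f g (X.resStar l)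

theorem homMap_app {Y Z : C} (f : Z ⟶ Y) (k : ℕ) (g : Y ⟶ X.obj k) :
    (X.homMap f).app k g = (f ≫ g : Z ⟶ X.obj k) := rfl

variable (U : Type) [AddCommGroup U] [Module ℂ U]

/-- The presheaf `Y ↦ ⨁ (U^{⊗ k} ⊗ Hom(Y, Δ_k))^{S_k}`, which represents
`⨁ (U^{⊗ k} ⊗ Δ_k)^{S_k}`. -/
noncomputable def presheaf : Cᵒᵖ ⥤ ModuleCat.{0} ℂ where
  obj Y := ModuleCat.of ℂ ((X.homSystem Y.unop).Total U)
  map f := ModuleCat.ofHom ((X.homMap f.unop).map U)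
  map_id Y := by
    ext1
    exact ResSystem.Hom.map_eq_id _ fun k => LinearMap.ext fun g => by
      exact Category.id_comp (X := Y.unop) (Y := X.obj k) g
  map_comp f g := by
    ext1
    exact ResSystem.Hom.map_eq_comp _ _ _ fun k => LinearMap.ext fun h => by
      exact Category.assoc (Z := X.obj k) g.unop f.unop h

end ResObject

end IndObjects

/-- A presheaf is an Ind-object if its elements come from those of a sequence `T_0, T_1, …` of
objects. -/
theorem isIndObject_of_sequence {C : Type 1} [Category.{0} C] (P : Cᵒᵖ ⥤ Type) (T : ℕ → C)
    (t : ∀ N, P.obj (Opposite.op (T N)))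
    (h : ∀ (Y : C) (p : P.obj (Opposite.op Y)), ∃ N₀, ∀ N ≥ N₀, ∃ h : Y ⟶ T N,
      P.map h.op (t N) = p ∧ ∀ (Z : C) (f g : Z ⟶ Y), P.map f.op p = P.map g.op p →
        f ≫ h = g ≫ h) : IsIndObject P := by
  let A : ℕ → CostructuredArrow yoneda P := fun N => CostructuredArrow.mk (yonedaEquiv.symm (t N))
  have key : ∀ X : CostructuredArrow yoneda P, ∃ N₀, ∀ N ≥ N₀, ∃ q : X ⟶ A N,
      ∀ (W : CostructuredArrow yoneda P) (f g : W ⟶ X), f ≫ q = g ≫ q := by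
    intro X
    obtain ⟨N₀, hN⟩ := h X.left (yonedaEquiv X.hom)
    refine ⟨N₀, fun N hNN => ?_⟩
    obtain ⟨q, hq, hq'⟩ := hN N hNN
    refine ⟨CostructuredArrow.homMk q ?_, fun W f g => ?_⟩
    · apply yonedaEquiv.injective
      rw [← hq]
      simp [A, yonedaEquiv]
    · ext1
      refine hq' _ f.left g.left ?_
      have e : ∀ f : W ⟶ X, P.map f.left.op (yonedaEquiv X.hom) = yonedaEquiv W.hom := by
        intro f
        rw [← CostructuredArrow.w f, yonedaEquiv_naturality]
      rw [e, e]
  have : IsFiltered (CostructuredArrow yoneda P) :=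
    { cocone_objs := fun X Y => by
        obtain ⟨N, hN⟩ := key X
        obtain ⟨M, hM⟩ := key Y
        obtain ⟨q, -⟩ := hN (max N M) (le_max_left _ _)
        obtain ⟨q', -⟩ := hM (max N M) (le_max_right _ _)
        exact ⟨A (max N M), q, q', trivial⟩
      cocone_maps := fun X Y f g => by
        obtain ⟨N, hN⟩ := key Y
        obtain ⟨q, hq⟩ := hN N le_rfl
        exact ⟨A N, q, hq X f g⟩
      nonempty := ⟨A 0⟩ }
  have : FinallySmall.{0} (CostructuredArrow yoneda P) := by
    refine finallySmall_of_small_weakly_terminal_set (Set.range A) fun X => ?_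
    obtain ⟨N, hN⟩ := key X
    obtain ⟨q, -⟩ := hN N le_rfl
    exact ⟨A N, ⟨N, rfl⟩, ⟨q⟩⟩
  exact isIndObject_of_isFiltered_of_finallySmall P

theorem DirectSum.exists_eq_sum_range {M : ℕ → Type} [∀ k, AddCommMonoid (M k)]
    [∀ k, Module ℂ (M k)] (x : ⨁ k, M k) :
    ∃ N₀, ∀ N ≥ N₀, ∑ k ∈ Finset.range N, DirectSum.lof ℂ ℕ M k (x k) = x := by
  induction x using DirectSum.induction_on with
  | zero => exact ⟨0, fun N _ => by simp⟩
  | of i x =>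
    refine ⟨i + 1, fun N hN => ?_⟩
    rw [Finset.sum_eq_single i]
    · change DirectSum.lof ℂ ℕ M i ((DirectSum.of M i x) i) = _
      rw [DirectSum.of_eq_same]
      rfl
    · intro j _ hj
      rw [DirectSum.of_eq_of_ne _ _ _ hj, map_zero]
    · intro hi
      exact absurd (Finset.mem_range.2 hN) hi
  | add x y hx hy =>
    obtain ⟨N, hN⟩ := hx
    obtain ⟨M, hM⟩ := hy
    refine ⟨max N M, fun K hK => ?_⟩
    conv_rhs => rw [← hN K (le_trans (le_max_left _ _) hK), ← hM K (le_trans (le_max_right _ _) hK)]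
    rw [← Finset.sum_add_distrib]
    refine Finset.sum_congr rfl fun k _ => ?_
    rw [DirectSum.add_apply, map_add]

/-- The coefficients of an element of `W ⊗ D` with respect to a basis of `W`. -/
noncomputable def tensorCoeff (W : Type) [AddCommGroup W] [Module ℂ W] [FiniteDimensional ℂ W]
    {D : Type} [AddCommGroup D] [Module ℂ D] (i : Fin (Module.finrank ℂ W)) : W ⊗[ℂ] D →ₗ[ℂ] D :=
  (TensorProduct.lid ℂ D).toLinearMap ∘ₗ ((Module.finBasis ℂ W).coord i).rTensor D

theorem tensorCoeff_map (W : Type) [AddCommGroup W] [Module ℂ W] [FiniteDimensional ℂ W]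
    {D D' : Type} [AddCommGroup D] [Module ℂ D] [AddCommGroup D'] [Module ℂ D']
    (i : Fin (Module.finrank ℂ W)) (φ : D →ₗ[ℂ] D') (x : W ⊗[ℂ] D) :
    tensorCoeff W i (TensorProduct.map LinearMap.id φ x) = φ (tensorCoeff W i x) := by
  refine LinearMap.congr_fun (f := tensorCoeff W i ∘ₗ TensorProduct.map LinearMap.id φ)
    (g := φ ∘ₗ tensorCoeff W i) (TensorProduct.ext' fun w d => ?_) x
  simp [tensorCoeff]

theorem sum_tensorCoeff (W : Type) [AddCommGroup W] [Module ℂ W] [FiniteDimensional ℂ W]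
    {D : Type} [AddCommGroup D] [Module ℂ D] (x : W ⊗[ℂ] D) :
    ∑ i, Module.finBasis ℂ W i ⊗ₜ[ℂ] tensorCoeff W i x = x := by
  induction x using TensorProduct.induction_on with
  | zero => simp
  | add x y hx hy =>
    conv_rhs => rw [← hx, ← hy]
    simp only [map_add, TensorProduct.tmul_add, Finset.sum_add_distrib]
  | tmul w g =>
    simp only [tensorCoeff, LinearMap.comp_apply, LinearEquiv.coe_coe, LinearMap.rTensor_tmul,
      TensorProduct.lid_tmul, ← TensorProduct.smul_tmul]
    rw [← TensorProduct.sum_tmul]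
    congr 1
    exact (Module.finBasis ℂ W).sum_repr w

namespace ResObject

variable {C : Type 1} [Category.{0} C] [Preadditive C] [Linear ℂ C] (X : ResObject C)
variable (U : Type) [AddCommGroup U] [Module ℂ U]

theorem homMap_mapInv_avg {Y Z : C} (f : Z ⟶ Y) (k : ℕ) (x : (X.homSystem Y).Tens U k) :
    (X.homMap f).mapInv U k ((X.homSystem Y).avg U k x) = (X.homSystem Z).avg U k
      (TensorProduct.map LinearMap.id ((X.homMap f).app k) x) := by
  apply Subtype.ext
  change TensorProduct.map LinearMap.id ((X.homMap f).app k) (((k.factorial : ℂ)⁻¹ •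
    ∑ σ : Equiv.Perm (Fin k), (X.homSystem Y).act U σ) x) = ((k.factorial : ℂ)⁻¹ •
    ∑ σ : Equiv.Perm (Fin k), (X.homSystem Z).act U σ) _
  simp only [LinearMap.smul_apply, LinearMap.sum_apply, map_smul, map_sum,
    ResSystem.Hom.act_map]

variable [FiniteDimensional ℂ U]

/-- A morphism to `Δ_k` as an element of the `k`-th term. -/
noncomputable def toD {Y : C} {k : ℕ} (f : Y ⟶ X.obj k) : (X.homSystem Y).D k := f

/-- An element of the `k`-th term as a morphism to `Δ_k`. -/
noncomputable def ofD {Y : C} {k : ℕ} (f : (X.homSystem Y).D k) : Y ⟶ X.obj k := f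

variable [HasFiniteBiproducts C]

/-- The finite sums of the objects `U^{⊗ k} ⊗ Δ_k`, `k < N`. -/
noncomputable def truncation (N : ℕ) : C :=
  ⨁ fun j : Σ k : Fin N, Fin (Module.finrank ℂ (⨂[ℂ] _ : Fin k, U)) => X.obj j.1

/-- The projections of the truncation. -/
noncomputable def truncationπ {N : ℕ} (k : Fin N)
    (i : Fin (Module.finrank ℂ (⨂[ℂ] _ : Fin k, U))) : X.truncation U N ⟶ X.obj k :=
  biproduct.π (fun j : Σ k : Fin N, Fin (Module.finrank ℂ (⨂[ℂ] _ : Fin k, U)) => X.obj j.1) ⟨k, i⟩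

/-- Morphisms to the truncation. -/
noncomputable def truncationLift {N : ℕ} {Y : C} (p : (X.homSystem Y).Total U) :
    Y ⟶ X.truncation U N :=
  biproduct.lift fun j : Σ k : Fin N, Fin (Module.finrank ℂ (⨂[ℂ] _ : Fin k, U)) =>
    X.ofD (tensorCoeff (⨂[ℂ] _ : Fin j.1, U) j.2 (p j.1).1)

theorem truncationLift_π {N : ℕ} {Y : C} (p : (X.homSystem Y).Total U) (k : Fin N)
    (i : Fin (Module.finrank ℂ (⨂[ℂ] _ : Fin k, U))) :
    X.truncationLift U p ≫ X.truncationπ U k i = 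
      X.ofD (tensorCoeff (⨂[ℂ] _ : Fin k, U) i (p k).1) :=
  biproduct.lift_π _ _

theorem truncation_hom_ext {N : ℕ} {Z : C} {f g : Z ⟶ X.truncation U N}
    (h : ∀ k i, f ≫ X.truncationπ U k i = g ≫ X.truncationπ U k i) : f = g :=
  biproduct.hom_ext _ _ fun j => h j.1 j.2

/-- The generic element over the truncation. -/
noncomputable def genericElement (N : ℕ) : (X.homSystem (X.truncation U N)).Total U :=
  ∑ k : Fin N, DirectSum.lof ℂ ℕ (fun k => (X.homSystem (X.truncation U N)).inv U k) k
    ((X.homSystem (X.truncation U N)).avg U k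
      (∑ i, (Module.finBasis ℂ (⨂[ℂ] _ : Fin k, U) i) ⊗ₜ[ℂ]
        X.toD (X.truncationπ U k i)))

theorem isIndObject_presheaf :
    IsIndObject (X.presheaf U ⋙ CategoryTheory.forget (ModuleCat ℂ)) := by
  refine isIndObject_of_sequence _ (X.truncation U) (X.genericElement U) fun Y p => ?_
  change (X.homSystem Y).Total U at p
  obtain ⟨N₀, hN₀⟩ := DirectSum.exists_eq_sum_range p
  refine ⟨N₀, fun N hN => ⟨X.truncationLift U p, ?_, ?_⟩⟩
  · change (X.homMap (X.truncationLift U p)).map U (X.genericElement U N) = p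
    conv_rhs => rw [← hN₀ N hN, ← Fin.sum_univ_eq_sum_range
      (fun k => DirectSum.lof ℂ ℕ (fun k => (X.homSystem Y).inv U k) k (p k))]
    rw [genericElement, map_sum]
    refine Finset.sum_congr rfl fun k _ => ?_
    rw [ResSystem.Hom.map_lof, homMap_mapInv_avg, map_sum]
    congr 1
    conv_rhs => rw [← (X.homSystem Y).avg_inv U (p k)]
    congr 1
    conv_rhs => rw [← sum_tensorCoeff _ (p k).1]
    refine Finset.sum_congr rfl fun i _ => ?_
    rw [TensorProduct.map_tmul, LinearMap.id_apply]
    congr 1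
    exact X.truncationLift_π U p k i
  · intro Z f g hfg
    change (X.homMap f).map U p = (X.homMap g).map U p at hfg
    refine X.truncation_hom_ext U fun k i => ?_
    rw [Category.assoc, Category.assoc, truncationLift_π]
    have e : ∀ f : Z ⟶ Y, f ≫ X.ofD (tensorCoeff (⨂[ℂ] _ : Fin k, U) i (p k).1) =
        X.ofD (tensorCoeff (⨂[ℂ] _ : Fin k, U) i (((X.homMap f).map U p) k).1) := fun f =>
      (tensorCoeff_map (⨂[ℂ] _ : Fin k, U) i ((X.homMap f).app k) (p k).1).symm
    rw [e, e, hfg]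

end ResObject

section IndLinear

variable (C : Type 1) [Category.{0} C] [Preadditive C] [Linear ℂ C]

/-- The `ℂ`-linear presheaves of complex vector spaces that are small filtered colimits of
representable presheaves. -/
def IsLinearIndObject : ObjectProperty (Cᵒᵖ ⥤ ModuleCat.{0} ℂ) := fun P =>
  (∀ (Y Z : C) (f g : Z ⟶ Y), P.map (f + g).op = P.map f.op + P.map g.op) ∧
    (∀ (Y Z : C) (c : ℂ) (f : Z ⟶ Y), P.map (c • f).op = c • P.map f.op) ∧
    IsIndObject (P ⋙ CategoryTheory.forget (ModuleCat ℂ))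

/-- The Ind-category of a `ℂ`-linear category, with its `ℂ`-linear structure. -/
abbrev IndLin : Type 1 := (IsLinearIndObject C).FullSubcategory

/-- The comparison of the `ℂ`-linear Ind-category with the Ind-category of the underlying category:
forget the vector space structures. -/
noncomputable def IndLin.toInd : IndLin C ⥤ Ind C :=
  ObjectProperty.lift IsIndObject
    ((IsLinearIndObject C).ι ⋙
      (Functor.whiskeringRight _ _ _).obj (CategoryTheory.forget (ModuleCat.{0} ℂ)))
    (fun P => P.property.2.2) ⋙ (Ind.equivalence C).inverse

instance hasPointwiseLeftKanExtension_indYoneda {D : Type 1} [Category.{0} D] [HasColimits D]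
    (F : C ⥤ D) :
    (Ind.yoneda (C := C)).HasPointwiseLeftKanExtension F := by
  intro X
  have h1 : FinallySmall.{0} (CostructuredArrow yoneda ((Ind.inclusion C).obj X)) :=
    (Ind.isIndObject_inclusion_obj X).finallySmall
  have h2 : FinallySmall.{0} (CostructuredArrow Ind.yoneda X) :=
    finallySmall_of_final_of_finallySmall
      ((CostructuredArrow.post Ind.yoneda (Ind.inclusion C) X).asEquivalence.trans
        (CostructuredArrow.mapNatIso Ind.yonedaCompInclusion)).inverse
  have := hasColimitsOfShape_of_finallySmall.{0} (CostructuredArrow Ind.yoneda X) D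
  infer_instance

variable {C}

/-- The extension of a functor to Ind-objects commuting with filtered colimits: the value at an
Ind-object `P` is the colimit of the values at the `Y` over all morphisms from `Y` to `P`. -/
noncomputable def indExtension {D : Type 1} [Category.{0} D] [HasColimits D] (F : C ⥤ D) :
    Ind C ⥤ D := (Ind.yoneda (C := C)).pointwiseLeftKanExtension F

namespace ResObject

variable [HasFiniteBiproducts C] (X : ResObject C)
variable (U : Type) [AddCommGroup U] [Module ℂ U] [FiniteDimensional ℂ U]

/-- The Ind-object `⨁ (U^{⊗ k} ⊗ Δ_k)^{S_k}`. -/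
noncomputable def indObject : IndLin C where
  obj := X.presheaf U
  property := by
    refine ⟨fun Y Z f g => ?_, fun Y Z c f => ?_, X.isIndObject_presheaf U⟩
    · ext1
      exact ResSystem.Hom.map_eq_add _ _ _ fun k => LinearMap.ext fun h =>
        Preadditive.add_comp _ _ _ f g (X.ofD h)
    · ext1
      exact ResSystem.Hom.map_eq_smul c _ _ fun k => LinearMap.ext fun h =>
        Linear.smul_comp _ _ _ c f (X.ofD h)

/-- The endomorphism `F_u` of `⨁ (U^{⊗ k} ⊗ Δ_k)^{S_k}`. -/
noncomputable def create (u : U) : End (X.indObject U) :=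
  ObjectProperty.homMk
    { app := fun Y => ModuleCat.ofHom ((X.homSystem Y.unop).create U u)
      naturality := fun Y Z f => by
        ext x
        exact ((X.homMap f.unop).map_create u x).symm }

/-- The endomorphism `E_f` of `⨁ (U^{⊗ k} ⊗ Δ_k)^{S_k}`. -/
noncomputable def annih (f : Module.Dual ℂ U) : End (X.indObject U) :=
  ObjectProperty.homMk
    { app := fun Y => ModuleCat.ofHom ((X.homSystem Y.unop).annih U f)
      naturality := fun Y Z g => by
        ext x
        exact ((X.homMap g.unop).map_annih f x).symm }

/-- The diagonal action of `A` on `⨁ (U^{⊗ k} ⊗ Δ_k)^{S_k}`. -/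
noncomputable def diagonal (A : Module.End ℂ U) : End (X.indObject U) :=
  ObjectProperty.homMk
    { app := fun Y => ModuleCat.ofHom ((X.homSystem Y.unop).diagonal U A)
      naturality := fun Y Z g => by
        ext x
        exact ((X.homMap g.unop).map_diagonal A x).symm }

end ResObject

end IndLinear

namespace Deligne

open TensorPowers

/-- The objects `Δ_k` of the Deligne category, with the permutations and the morphisms `res_l`,
`res_l^*`. -/
noncomputable def deltaSystem (ν : ℂ) : ResObject (Deligne ν) where
  obj := Delta ν
  perm σ := deltaMap (permDiag ν σ)
  res l := deltaMap (resDiag ν l)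
  resStar l := deltaMap (resStarDiag ν l)
  perm_one k := by
    have h : permDiag ν (1 : Equiv.Perm (Fin k)) = 𝟙 _ := rfl
    rw [h, deltaMap_id]
  perm_mul σ τ := by rw [deltaMap_comp_permDiag, permDiag_mul]
  perm_res l σ τ h := by
    rw [deltaMap_comp_permDiag, permDiag_comp_deltaMap, resDiag_permDiag l σ τ h]
  perm_resStar l σ τ h := by
    rw [deltaMap_comp_permDiag, permDiag_comp_deltaMap, resStarDiag_permDiag l σ τ h]

/-- The complex tensor power `⨁ (U^{⊗ k} ⊗ Δ_k)^{S_k}` of the unital vector space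
`V = ℂ 𝟙 ⊕ U`, as an Ind-object of the Deligne category. -/
noncomputable def tensorPower (ν : ℂ) (U : Type) [AddCommGroup U] [Module ℂ U]
    [FiniteDimensional ℂ U] : IndLin (Deligne ν) := (deltaSystem ν).indObject U

end Deligne

/-! ### The functors to representations of the symmetric group -/

namespace SymmetricRep

/-- The representation of `S_n` on `ℂ Fun([r], [n])`, with `g • f = g ∘ f`. -/
noncomputable def funRep (n r : ℕ) :
    Representation ℂ (Equiv.Perm (Fin n)) ((Fin r → Fin n) →₀ ℂ) where
  toFun g := Finsupp.lmapDomain ℂ ℂ fun f => g ∘ f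
  map_one' := by ext; simp
  map_mul' g h := by ext; simp [Function.comp_assoc]

theorem funRep_single (n r : ℕ) (g : Equiv.Perm (Fin n)) (f : Fin r → Fin n) (c : ℂ) :
    funRep n r g (Finsupp.single f c) = Finsupp.single (g ∘ f) c := Finsupp.mapDomain_single

open scoped Classical in
/-- The linear map given by a diagram: a function `f` is sent to the sum of all functions `g` such
that `(f, g)` is constant on the parts of the diagram. -/
noncomputable def diagMap (n : ℕ) {r s : ℕ} (π : PartDiag r s) :
    ((Fin r → Fin n) →₀ ℂ) →ₗ[ℂ] ((Fin s → Fin n) →₀ ℂ) :=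
  Finsupp.lsum ℂ fun f => LinearMap.toSpanSingleton ℂ _
    (∑ g : Fin s → Fin n, if PartDiag.Compat π f g then Finsupp.single g 1 else 0)

open scoped Classical in
theorem diagMap_single (n : ℕ) {r s : ℕ} (π : PartDiag r s) (f : Fin r → Fin n) :
    diagMap n π (Finsupp.single f 1) =
      ∑ g : Fin s → Fin n, if PartDiag.Compat π f g then Finsupp.single g 1 else 0 := by
  simp [diagMap]

theorem diagMap_equivariant (n : ℕ) {r s : ℕ} (π : PartDiag r s) (g : Equiv.Perm (Fin n)) :
    diagMap n π ∘ₗ funRep n r g = funRep n s g ∘ₗ diagMap n π := by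
  classical
  refine Finsupp.lhom_ext' fun f => LinearMap.ext_ring ?_
  simp only [LinearMap.comp_apply, Finsupp.lsingle_apply, funRep_single, diagMap_single, map_sum]
  let e : (Fin s → Fin n) ≃ (Fin s → Fin n) := Equiv.arrowCongr (Equiv.refl _) g
  rw [← Equiv.sum_comp e]
  refine Finset.sum_congr rfl fun h _ => ?_
  have he : e h = g ∘ h := rfl
  have hc : PartDiag.Compat π (g ∘ f) (g ∘ h) ↔ PartDiag.Compat π f h := by
    have key : ∀ c, Sum.elim (g ∘ f) (g ∘ h) c = g (Sum.elim f h c) := by rintro (c | c) <;> rfl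
    unfold PartDiag.Compat
    simp only [key, g.injective.eq_iff]
  rw [he]
  by_cases h1 : PartDiag.Compat π f h
  · rw [if_pos h1, if_pos (hc.2 h1), funRep_single]
  · rw [if_neg h1, if_neg (fun h2 => h1 (hc.1 h2)), map_zero]

theorem diagMap_one (n r : ℕ) : diagMap n (PartDiag.fib (id : Fin r → Fin r) id) = LinearMap.id := by
  classical
  refine Finsupp.lhom_ext' fun f => LinearMap.ext_ring ?_
  simp only [LinearMap.comp_apply, Finsupp.lsingle_apply, diagMap_single, LinearMap.id_apply,
    PartDiag.compat_fib_left, Function.comp_id]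
  simp

theorem diagMap_comp (n : ℕ) {r s t : ℕ} (π : PartDiag r s) (ρ : PartDiag s t) :
    diagMap n ρ ∘ₗ diagMap n π =
      ((n : ℂ) ^ PartDiag.loops π ρ) • diagMap n (PartDiag.star π ρ) := by
  classical
  refine Finsupp.lhom_ext' fun f => LinearMap.ext_ring ?_
  simp only [LinearMap.comp_apply, Finsupp.lsingle_apply, diagMap_single, LinearMap.smul_apply,
    map_sum, apply_ite (diagMap n ρ), map_zero]
  have h1 : ∀ g : Fin s → Fin n, (if PartDiag.Compat π f g then
      ∑ h : Fin t → Fin n, (if PartDiag.Compat ρ g h then Finsupp.single h (1 : ℂ) else 0) else 0) =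
      ∑ h : Fin t → Fin n, if PartDiag.Compat π f g ∧ PartDiag.Compat ρ g h then
        Finsupp.single h (1 : ℂ) else 0 := by
    intro g
    split_ifs with hg <;> simp [hg]
  simp only [h1]
  rw [Finset.sum_comm, Finset.smul_sum]
  refine Finset.sum_congr rfl fun h _ => ?_
  have hc := PartDiag.count π ρ f h
  rw [Fintype.card_fin, Nat.card_eq_fintype_card, Fintype.card_subtype] at hc
  rw [← Finset.sum_filter, Finset.sum_const, hc]
  split_ifs with hs
  · rw [← Nat.cast_smul_eq_nsmul ℂ, Nat.cast_pow]
  · simp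

/-- The representation `ℂ Fun([r], [n])` as an object of the category of representations. -/
noncomputable abbrev funObj (n r : ℕ) : Rep.{0} ℂ (Equiv.Perm (Fin n)) := Rep.of (funRep n r)

/-- The morphism of representations given by a diagram. -/
noncomputable def diagHom (n : ℕ) {r s : ℕ} (π : PartDiag r s) : funObj n r ⟶ funObj n s :=
  Rep.ofHom ⟨diagMap n π, diagMap_equivariant n π⟩

theorem diagHom_comp (n : ℕ) {r s t : ℕ} (π : PartDiag r s) (ρ : PartDiag s t) :
    diagHom n π ≫ diagHom n ρ = ((n : ℂ) ^ PartDiag.loops π ρ) • diagHom n (PartDiag.star π ρ) := by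
  apply Rep.hom_ext
  apply Representation.IntertwiningMap.ext
  exact diagMap_comp n π ρ

/-- The functor `𝔥^{⊗ r} ↦ ℂ Fun([r], [n]) = (ℂ^n)^{⊗ r}`, sending a diagram to its linear map. -/
noncomputable def tensorPowersFunctor (n : ℕ) :
    TensorPowers (n : ℂ) ⥤ Rep.{0} ℂ (Equiv.Perm (Fin n)) where
  obj X := funObj n X.deg
  map {X Y} f := Finsupp.linearCombination ℂ (diagHom n) f
  map_id X := by
    refine (Finsupp.linearCombination_single ℂ _ _).trans ?_
    rw [one_smul]
    apply Rep.hom_ext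
    apply Representation.IntertwiningMap.ext
    exact diagMap_one n X.deg
  map_comp {X Y Z} f g := by
    change Finsupp.linearCombination ℂ (diagHom n) (TensorPowers.comp _ _ _ _ f g) = _
    change TensorPowers.HomSpace _ _ at f
    change TensorPowers.HomSpace _ _ at g
    induction f using Finsupp.induction_linear with
    | zero => simp
    | add f f' hf hf' => simp only [map_add, LinearMap.add_apply, hf, hf', Preadditive.add_comp]
    | single π a =>
      induction g using Finsupp.induction_linear with
      | zero => simp
      | add g g' hg hg' => simp only [map_add, hg, hg', Preadditive.comp_add]
      | single ρ b =>
        rw [TensorPowers.comp_single, Finsupp.linearCombination_single,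
          Finsupp.linearCombination_single, Finsupp.linearCombination_single, Linear.smul_comp,
          Linear.comp_smul, diagHom_comp, smul_smul, smul_smul, mul_assoc]

instance (n : ℕ) : (tensorPowersFunctor n).Additive where
  map_add {X Y f g} := map_add (Finsupp.linearCombination ℂ (diagHom n (r := X.deg) (s := Y.deg))) f g

instance (n : ℕ) : HasFiniteBiproducts (Rep.{0} ℂ (Equiv.Perm (Fin n))) :=
  Abelian.hasFiniteBiproducts

/-- The functor `S_n : Rep(S_{ν = n}) ⥤ Rep(S_n)`: the extension of the functor on the tensor
powers of `𝔥` to finite sums and to images of idempotents. -/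
noncomputable def deligneFunctor (n : ℕ) : Deligne (n : ℂ) ⥤ Rep.{0} ℂ (Equiv.Perm (Fin n)) :=
  (functorExtension (Mat_ (TensorPowers (n : ℂ))) (Rep.{0} ℂ (Equiv.Perm (Fin n)))).obj
    (Mat_.lift (tensorPowersFunctor n))

/-- The functor `S_n`, extended to Ind-objects. -/
noncomputable def indFunctor (n : ℕ) :
    IndLin (Deligne (n : ℂ)) ⥤ Rep.{0} ℂ (Equiv.Perm (Fin n)) :=
  IndLin.toInd (Deligne (n : ℂ)) ⋙ indExtension (deligneFunctor n)

end SymmetricRep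

namespace SymmetricRep

/-- The space `ℂ Inj([k], [n])` with basis the injections `{1, …, k} → {1, …, n}`. -/
abbrev InjSpace (n k : ℕ) : Type := (Fin k ↪ Fin n) →₀ ℂ

variable {n : ℕ}

theorem injSpace_ext {k : ℕ} {M : Type} [AddCommGroup M] [Module ℂ M] {f g : InjSpace n k →ₗ[ℂ] M}
    (h : ∀ j : Fin k ↪ Fin n, f (Finsupp.single j 1) = g (Finsupp.single j 1)) : f = g :=
  Finsupp.lhom_ext' fun j => LinearMap.ext_ring (h j)

/-- The map `f ↦ f ∘ σ⁻¹`. -/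
noncomputable def injPerm {k : ℕ} (σ : Equiv.Perm (Fin k)) : InjSpace n k →ₗ[ℂ] InjSpace n k :=
  Finsupp.lmapDomain ℂ ℂ fun f => σ.symm.toEmbedding.trans f

/-- The map `f ↦ f ∘ ι_l`, where `ι_l` is the increasing injection omitting `l`. -/
noncomputable def injRes {k : ℕ} (l : Fin (k + 1)) : InjSpace n (k + 1) →ₗ[ℂ] InjSpace n k :=
  Finsupp.lmapDomain ℂ ℂ fun f => l.succAboveEmb.trans f

/-- The map sending `f` to the sum of all injections `g` with `g ∘ ι_l = f`. -/
noncomputable def injResStar {k : ℕ} (l : Fin (k + 1)) : InjSpace n k →ₗ[ℂ] InjSpace n (k + 1) :=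
  Finsupp.lsum ℂ fun f => LinearMap.toSpanSingleton ℂ _
    (∑ g with l.succAboveEmb.trans g = f, Finsupp.single g 1)

/-- The map `f ↦ g ∘ f`. -/
noncomputable def injPost (k : ℕ) (g : Equiv.Perm (Fin n)) : InjSpace n k →ₗ[ℂ] InjSpace n k :=
  Finsupp.lmapDomain ℂ ℂ fun f => f.trans g.toEmbedding

theorem injPerm_single {k : ℕ} (σ : Equiv.Perm (Fin k)) (f : Fin k ↪ Fin n) :
    injPerm σ (Finsupp.single f 1) = Finsupp.single (σ.symm.toEmbedding.trans f) 1 :=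
  Finsupp.mapDomain_single

theorem injRes_single {k : ℕ} (l : Fin (k + 1)) (f : Fin (k + 1) ↪ Fin n) :
    injRes l (Finsupp.single f 1) = Finsupp.single (l.succAboveEmb.trans f) 1 :=
  Finsupp.mapDomain_single

theorem injResStar_single {k : ℕ} (l : Fin (k + 1)) (f : Fin k ↪ Fin n) :
    injResStar l (Finsupp.single f 1) =
      ∑ g with l.succAboveEmb.trans g = f, Finsupp.single g 1 := by
  simp [injResStar]

theorem injPost_single {k : ℕ} (g : Equiv.Perm (Fin n)) (f : Fin k ↪ Fin n) :
    injPost k g (Finsupp.single f 1) = Finsupp.single (f.trans g.toEmbedding) 1 :=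
  Finsupp.mapDomain_single

theorem injPerm_res {k : ℕ} (l : Fin (k + 1)) (σ : Equiv.Perm (Fin (k + 1)))
    (τ : Equiv.Perm (Fin k)) (h : ∀ j, σ (l.succAbove j) = (σ l).succAbove (τ j)) :
    injPerm (n := n) τ ∘ₗ injRes l = injRes (σ l) ∘ₗ injPerm σ := by
  refine injSpace_ext fun f => ?_
  simp only [LinearMap.comp_apply, injPerm_single, injRes_single]
  congr 1
  ext j
  obtain ⟨j, rfl⟩ := τ.surjective j
  simp [← h]

theorem injPerm_resStar {k : ℕ} (l : Fin (k + 1)) (σ : Equiv.Perm (Fin (k + 1)))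
    (τ : Equiv.Perm (Fin k)) (h : ∀ j, σ (l.succAbove j) = (σ l).succAbove (τ j)) :
    injPerm (n := n) σ ∘ₗ injResStar l = injResStar (σ l) ∘ₗ injPerm τ := by
  refine injSpace_ext fun f => ?_
  simp only [LinearMap.comp_apply, injPerm_single, injResStar_single, map_sum]
  refine Finset.sum_bij' (fun g _ => σ.symm.toEmbedding.trans g)
    (fun g _ => σ.toEmbedding.trans g) ?_ ?_ ?_ ?_ ?_
  · intro g hg
    simp only [Finset.mem_filter, Finset.mem_univ, true_and] at hg ⊢
    rw [← hg]
    ext j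
    obtain ⟨j, rfl⟩ := τ.surjective j
    simp [← h]
  · intro g hg
    simp only [Finset.mem_filter, Finset.mem_univ, true_and] at hg ⊢
    ext j
    have := DFunLike.congr_fun hg (τ j)
    simpa [h] using congrArg Fin.val this
  · intro g _
    ext j
    simp
  · intro g _
    ext j
    simp
  · intro g _
    rfl

theorem injPost_resStar {k : ℕ} (l : Fin (k + 1)) (g : Equiv.Perm (Fin n)) :
    injResStar l ∘ₗ injPost k g = injPost (k + 1) g ∘ₗ injResStar l := by
  refine injSpace_ext fun f => ?_
  simp only [LinearMap.comp_apply, injPost_single, injResStar_single, map_sum]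
  symm
  refine Finset.sum_bij' (fun h _ => h.trans g.toEmbedding)
    (fun h _ => h.trans g.symm.toEmbedding) ?_ ?_ ?_ ?_ ?_
  · intro h hh
    simp only [Finset.mem_filter, Finset.mem_univ, true_and] at hh ⊢
    rw [← hh]
    rfl
  · intro h hh
    simp only [Finset.mem_filter, Finset.mem_univ, true_and] at hh ⊢
    ext j
    have := DFunLike.congr_fun hh j
    simp only [Function.Embedding.trans_apply, Equiv.coe_toEmbedding] at this ⊢
    rw [this, Equiv.symm_apply_apply]
  · intro h _
    ext j
    simp
  · intro h _
    ext j
    simp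
  · intro h _
    rfl

/-- The spaces `ℂ Inj([k], [n])` with the actions of the groups `S_k` and the maps `res_l`,
`res_l^*`. -/
noncomputable def injSystem (n : ℕ) : ResSystem where
  D k := InjSpace n k
  perm σ := injPerm σ
  res l := injRes l
  resStar l := injResStar l
  perm_one k := injSpace_ext fun _ => injPerm_single _ _
  perm_mul σ τ := injSpace_ext fun f => by
    rw [LinearMap.comp_apply, injPerm_single, injPerm_single, injPerm_single]
    rfl
  perm_res l σ τ h := injPerm_res l σ τ h
  perm_resStar l σ τ h := injPerm_resStar l σ τ h

/-- Postcomposition with a permutation of `[n]`. -/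
noncomputable def injMap (n : ℕ) (g : Equiv.Perm (Fin n)) :
    ResSystem.Hom (injSystem n) (injSystem n) where
  app k := injPost k g
  perm_app σ := injSpace_ext fun _ => (congrArg (injPerm σ) (injPost_single _ _)).trans
    ((injPerm_single _ _).trans ((congrArg (injPost _ g) (injPerm_single _ _)).trans
      (injPost_single _ _)).symm)
  res_app l := injSpace_ext fun _ => (congrArg (injRes l) (injPost_single _ _)).trans
    ((injRes_single _ _).trans ((congrArg (injPost _ g) (injRes_single _ _)).trans
      (injPost_single _ _)).symm)
  resStar_app l := injPost_resStar l g

variable (U : Type) [AddCommGroup U] [Module ℂ U]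

/-- The space `⨁_k (U^{⊗ k} ⊗ ℂ Inj([k], [n]))^{S_k}`; the terms with `k > n` are zero. -/
abbrev InjSum (n : ℕ) : Type := (injSystem n).Total U

/-- The action of `S_n` on `⨁_k (U^{⊗ k} ⊗ ℂ Inj([k], [n]))^{S_k}` by postcomposition. -/
noncomputable def injSumRep (n : ℕ) : Representation ℂ (Equiv.Perm (Fin n)) (InjSum U n) where
  toFun g := (injMap n g).map U
  map_one' := ResSystem.Hom.map_eq_id _ fun _ =>
    injSpace_ext fun f => injPost_single 1 f
  map_mul' g h := ResSystem.Hom.map_eq_comp _ _ _ fun k =>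
    injSpace_ext fun f => (injPost_single (g * h) f).trans
      ((congrArg (injPost k g) (injPost_single h f)).trans (injPost_single g _)).symm

variable {U} in
/-- The element `e_{S_k} (w_1 ⊗ ⋯ ⊗ w_k ⊗ f)` of degree `k`. -/
noncomputable def injElement {n k : ℕ} (w : Fin k → U) (f : Fin k ↪ Fin n) : InjSum U n :=
  DirectSum.lof ℂ ℕ (fun k => (injSystem n).inv U k) k ((injSystem n).avg U k
    (PiTensorProduct.tprod ℂ w ⊗ₜ[ℂ] (Finsupp.single f 1 : (Fin k ↪ Fin n) →₀ ℂ)))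

/-- The action of `S_n` on `V^{⊗ n}` permuting the factors. -/
noncomputable def tensorRep (V : Type) [AddCommGroup V] [Module ℂ V] (n : ℕ) :
    Representation ℂ (Equiv.Perm (Fin n)) (⨂[ℂ] _ : Fin n, V) where
  toFun g := TensorPow.perm g
  map_one' := TensorPow.perm_one n
  map_mul' g h := TensorPow.perm_mul g h

end SymmetricRep

/-! ### The action of `gl(V)` -/

attribute [local instance] LieRing.ofAssociativeRing

namespace TensorPow

variable {V : Type} [AddCommGroup V] [Module ℂ V]

theorem app_mul_same {n : ℕ} (A B : Module.End ℂ V) (i : Fin n) :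
    app A i ∘ₗ app B i = app (A * B) i := by
  refine hom_ext fun w => ?_
  simp only [LinearMap.comp_apply, app_tprod, Function.update_self, Function.update_idem]
  rfl

theorem app_comm {n : ℕ} (A B : Module.End ℂ V) {i j : Fin n} (h : i ≠ j) :
    app A i ∘ₗ app B j = app B j ∘ₗ app A i := by
  refine hom_ext fun w => ?_
  simp only [LinearMap.comp_apply, app_tprod]
  rw [Function.update_of_ne h, Function.update_of_ne h.symm, Function.update_comm h]

theorem app_add {n : ℕ} (A B : Module.End ℂ V) (i : Fin n) :
    app (A + B) i = app A i + app B i := by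
  refine hom_ext fun w => ?_
  simp only [LinearMap.add_apply, app_tprod]
  exact (PiTensorProduct.tprod ℂ).map_update_add w i _ _

theorem app_smul {n : ℕ} (c : ℂ) (A : Module.End ℂ V) (i : Fin n) :
    app (c • A) i = c • app A i := by
  refine hom_ext fun w => ?_
  simp only [LinearMap.smul_apply, app_tprod]
  exact (PiTensorProduct.tprod ℂ).map_update_smul w i _ _

theorem diagAct_add (n : ℕ) (A B : Module.End ℂ V) :
    diagAct n (A + B) = diagAct n A + diagAct n B := by
  simp only [diagAct, app_add, Finset.sum_add_distrib]

theorem diagAct_smul (n : ℕ) (c : ℂ) (A : Module.End ℂ V) :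
    diagAct n (c • A) = c • diagAct n A := by
  simp only [diagAct, app_smul, Finset.smul_sum]

theorem diagAct_comp_sub (n : ℕ) (A B : Module.End ℂ V) :
    diagAct n A ∘ₗ diagAct n B - diagAct n B ∘ₗ diagAct n A = diagAct n (A * B - B * A) := by
  have h : ∀ A B : Module.End ℂ V, diagAct n A ∘ₗ diagAct n B =
      ∑ i, ∑ j, app A i ∘ₗ app B j := by
    intro A B
    refine LinearMap.ext fun x => ?_
    simp only [diagAct, LinearMap.comp_apply, LinearMap.sum_apply, map_sum]
    exact Finset.sum_comm
  rw [h, h, Finset.sum_comm (f := fun i j => app B i ∘ₗ app A j), ← Finset.sum_sub_distrib]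
  refine Finset.sum_congr rfl fun i _ => ?_
  rw [← Finset.sum_sub_distrib, Finset.sum_eq_single i]
  · rw [app_mul_same, app_mul_same, sub_eq_iff_eq_add, ← app_add, sub_add_cancel]
  · intro j _ hj
    rw [app_comm A B hj.symm, sub_self]
  · intro h
    exact absurd (Finset.mem_univ i) h

/-- The Lie algebra homomorphism `A ↦ ∑ A^{(i)}` from `gl(V)` to the endomorphisms of `V^{⊗ n}`. -/
noncomputable def glAction (V : Type) [AddCommGroup V] [Module ℂ V] (n : ℕ) :
    Module.End ℂ V →ₗ⁅ℂ⁆ Module.End ℂ (⨂[ℂ] _ : Fin n, V) where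
  toFun A := diagAct n A
  map_add' A B := diagAct_add n A B
  map_smul' c A := diagAct_smul n c A
  map_lie' {A B} := (diagAct_comp_sub n A B).symm

end TensorPow

/-- The universal enveloping algebra of `gl(V)`. -/
abbrev UGL (V : Type) [AddCommGroup V] [Module ℂ V] : Type :=
  UniversalEnvelopingAlgebra ℂ (Module.End ℂ V)

/-- The action of `U(gl(V))` on the usual tensor power `V^{⊗ n}`. -/
noncomputable def tensorAction (V : Type) [AddCommGroup V] [Module ℂ V] (n : ℕ) :
    UGL V →ₐ[ℂ] Module.End ℂ (⨂[ℂ] _ : Fin n, V) :=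
  UniversalEnvelopingAlgebra.lift ℂ (TensorPow.glAction V n)

namespace Splitting

variable {V : Type} [AddCommGroup V] [Module ℂ V] {one : V} (h1 : one ≠ 0) {U : Submodule ℂ V}
  (hU : IsCompl (ℂ ∙ one) U)

/-- The functional `𝟙^*` with `𝟙^*(𝟙) = 1` that vanishes on `U`. -/
noncomputable def oneDual : Module.Dual ℂ V :=
  (LinearEquiv.toSpanNonzeroSingleton ℂ V one h1).symm.toLinearMap ∘ₗ
    Submodule.projectionOnto (ℂ ∙ one) U hU

/-- The projection of `V = ℂ 𝟙 ⊕ U` onto `U`. -/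
noncomputable def proj : V →ₗ[ℂ] U := Submodule.projectionOnto U (ℂ ∙ one) hU.symm

/-- The element of `gl(V)` corresponding to `u ∈ U`: it sends `𝟙` to `u` and `U` to zero. -/
noncomputable def lower (u : U) : Module.End ℂ V := (oneDual h1 hU).smulRight (u : V)

/-- The element of `gl(V)` corresponding to `f ∈ U^*`: it sends `𝟙` to zero and `u ∈ U` to
`f(u) 𝟙`. -/
noncomputable def raise (f : Module.Dual ℂ U) : Module.End ℂ V := (f ∘ₗ proj hU).smulRight one

/-- The extension of `A ∈ gl(U)` to `V` by zero on `𝟙`. -/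
noncomputable def embed (A : Module.End ℂ U) : Module.End ℂ V := U.subtype ∘ₗ A ∘ₗ proj hU

/-- The homomorphism `ρ` from `U(gl(V))` to an algebra `B` is given by the scalar `c` on `id_V`, by
`F` on `U`, by `E` on `U^*` and by `D` on `gl(U)`, in terms of the decomposition
`gl(V) = ℂ id_V ⊕ U ⊕ U^* ⊕ gl(U)`. -/
structure IsGivenBy {B : Type*} [Ring B] [Algebra ℂ B] (ρ : UGL V →ₐ[ℂ] B) (c : ℂ) (F : U → B)
    (E : Module.Dual ℂ U → B) (D : Module.End ℂ U → B) : Prop where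
  map_id : ρ (UniversalEnvelopingAlgebra.ι ℂ (1 : Module.End ℂ V)) = algebraMap ℂ B c
  map_lower : ∀ u, ρ (UniversalEnvelopingAlgebra.ι ℂ (lower h1 hU u)) = F u
  map_raise : ∀ f, ρ (UniversalEnvelopingAlgebra.ι ℂ (raise hU f)) = E f
  map_embed : ∀ A, ρ (UniversalEnvelopingAlgebra.ι ℂ (embed hU A)) = D A

end Splitting

/-! ### Averaging and the sums of invariants -/

namespace ResSystem

/-! Expanding every factor along V = ℂ𝟙 ⊕ U splits V^{⊗n} into pieces indexed by subsets of [n]: the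
subset is the set of places filled from U, the others carry 𝟙. An enumeration of a k-element subset
is an injection f : [k] → [n], and forgetting the enumeration amounts to averaging over S_k. Hence
`collapse`, which sends w_1 ⊗ ⋯ ⊗ w_k ⊗ f to the tensor with w_s at place f(s) and 𝟙 elsewhere, is
bijective on the sum of invariants. Its inverse projects the places f(s) to U, applies 𝟙^* at the
remaining ones, and sums over f. Under `collapse` the operators F_u, E_f and ∑ A^{(i)} become the
diagonal operators of the corresponding elements of gl(V): u fills one free place, f frees one
occupied place, A changes one vector of U. On V^{⊗n} the relations of gl(V) are evident, which gives
the first assertion.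

On the complex tensor power no commutator is computed either. The operators are matrices of
combinations of diagrams with coefficients polynomial in ν, and this property survives sums and
products, because composing diagrams only contributes powers of ν. A combination of diagrams 𝔥^{⊗r}
→ 𝔥^{⊗s} that acts by zero on functions with values in [n] is zero once n ≥ r + s
(`repMap_injective`). So an identity valid on ⨁ (U^{⊗k} ⊗ ℂ Inj([k],[n]))^{S_k} for all n makes
polynomials vanish at infinitely many integers (`eq_zero_of_isPoly`), and therefore holds for every
ν. A `Realization` treats the spaces ℂ Inj([k],[n]) and Hom(Y, Δ_k) alike, `OpFamily.IsUniv.ext` is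
the transfer principle, and `glOp_lie` is its main application.

For the second isomorphism, the functor S_n turns x_k into the projection of ℂ Fun([k],[n]) onto ℂ
Inj([k],[n]); so it sends Δ_k to ℂ Inj([k],[n]), compatibly with all structure maps
(`deltaEquiv_deltaMap`, `deltaEquiv_rho`). The extension to Ind-objects is a colimit over all
sections of the presheaf. Evaluating sections makes ⨁ (U^{⊗k} ⊗ ℂ Inj([k],[n]))^{S_k} a cocone, and
it is universal because each generator e(b ⊗ z) is the value at z of the section e(b ⊗ id) over Δ_k
(`isColimitEvalCocone`). Evaluation is a morphism of systems, hence commutes with gl(V); composing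
with `collapse` finishes the proof. -/

theorem coe_avg (U : Type) [AddCommGroup U] [Module ℂ U] (S : ResSystem) (k : ℕ)
    (x : S.Tens U k) : (S.avg U k x : S.Tens U k) =
      (k.factorial : ℂ)⁻¹ • ∑ σ : Equiv.Perm (Fin k), S.act U σ x := by
  change ((k.factorial : ℂ)⁻¹ • ∑ σ : Equiv.Perm (Fin k), S.act U σ) x = _
  simp only [LinearMap.smul_apply, LinearMap.sum_apply]

/-- Averaging fixes invariants, so averages of arbitrary tensors already exhaust every summand. Maps
can thus be tested on unsymmetrised tensors. -/
theorem total_linearMap_ext {U : Type} [AddCommGroup U] [Module ℂ U] {S : ResSystem} {M : Type*}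
    [AddCommMonoid M] [Module ℂ M] {f g : S.Total U →ₗ[ℂ] M}
    (h : ∀ k x, f (DirectSum.lof ℂ ℕ (fun k => S.inv U k) k (S.avg U k x)) =
      g (DirectSum.lof ℂ ℕ (fun k => S.inv U k) k (S.avg U k x))) : f = g := by
  refine DirectSum.linearMap_ext ℂ fun k => LinearMap.ext fun x => ?_
  have := h k x
  rw [avg_inv] at this
  exact this

end ResSystem

/-! ### The map from the sum of invariants to the tensor power -/

namespace SymmetricRep

section Collapse

variable {V : Type} [AddCommGroup V] [Module ℂ V] (one : V) {U : Submodule ℂ V} {n : ℕ}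

/-- The family of vectors with `w_s` at the place `f(s)` and `𝟙` at all other places. -/
noncomputable def place {k : ℕ} (f : Fin k ↪ Fin n) (w : Fin k → U) : Fin n → V :=
  Function.extend f (fun s => (w s : V)) (fun _ => one)

theorem place_apply {k : ℕ} (f : Fin k ↪ Fin n) (w : Fin k → U) (s : Fin k) :
    place one f w (f s) = w s := f.injective.extend_apply _ _ _

theorem place_of_notMem {k : ℕ} (f : Fin k ↪ Fin n) (w : Fin k → U) {i : Fin n}
    (h : i ∉ Set.range f) : place one f w i = one := Function.extend_apply' _ _ _ h

theorem eq_place {k : ℕ} (f : Fin k ↪ Fin n) (w : Fin k → U) (v : Fin n → V)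
    (h1 : ∀ s, v (f s) = w s) (h2 : ∀ i, i ∉ Set.range f → v i = one) : v = place one f w := by
  funext i
  by_cases hi : i ∈ Set.range f
  · obtain ⟨s, rfl⟩ := hi
    rw [h1, place_apply]
  · rw [h2 i hi, place_of_notMem _ _ _ hi]

/-- Injectivity of f makes w_s occur at exactly one place. This reduces multilinearity in w to that
of the pure tensor. -/
theorem place_update {k : ℕ} (f : Fin k ↪ Fin n) (w : Fin k → U) (s : Fin k) (u : U) :
    place one f (Function.update w s u) = Function.update (place one f w) (f s) (u : V) := by
  symm
  apply eq_place
  · intro t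
    rcases eq_or_ne t s with rfl | h
    · simp
    · rw [Function.update_of_ne (f.injective.ne h), Function.update_of_ne h, place_apply]
  · intro i hi
    rw [Function.update_of_ne (fun h => hi ⟨s, h.symm⟩), place_of_notMem _ _ _ hi]

/-- The family of vectors as a multilinear map. -/
noncomputable def placeMultilinear {k : ℕ} (f : Fin k ↪ Fin n) :
    MultilinearMap ℂ (fun _ : Fin k => U) (⨂[ℂ] _ : Fin n, V) :=
  MultilinearMap.mk' (fun w => PiTensorProduct.tprod ℂ (place one f w))
    (by
      intro w s u u'
      simp only [place_update, Submodule.coe_add]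
      exact (PiTensorProduct.tprod ℂ).map_update_add _ _ _ _)
    (by
      intro w s c u
      simp only [place_update, Submodule.coe_smul]
      exact (PiTensorProduct.tprod ℂ).map_update_smul _ _ _ _)

variable (U n) in
/-- The linear map `U^{⊗ k} ⊗ ℂ Inj([k], [n]) → V^{⊗ n}` placing `w_s` at `f(s)`. -/
noncomputable def collapseTens (k : ℕ) : (injSystem n).Tens U k →ₗ[ℂ] ⨂[ℂ] _ : Fin n, V :=
  TensorProduct.lift (LinearMap.flip (Finsupp.linearCombination ℂ
    (fun f : Fin k ↪ Fin n => PiTensorProduct.lift (placeMultilinear (U := U) one f))))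

/-- The element `w_1 ⊗ ⋯ ⊗ w_k ⊗ f`. -/
noncomputable def pure {U : Type} [AddCommGroup U] [Module ℂ U] {k : ℕ} (w : Fin k → U)
    (f : Fin k ↪ Fin n) : (injSystem n).Tens U k :=
  PiTensorProduct.tprod ℂ w ⊗ₜ[ℂ] (Finsupp.single f 1 : (Fin k ↪ Fin n) →₀ ℂ)

theorem collapseTens_pure {k : ℕ} (w : Fin k → U) (f : Fin k ↪ Fin n) :
    collapseTens one U n k (pure w f) = PiTensorProduct.tprod ℂ (place one f w) := by
  refine (TensorProduct.lift.tmul _ _).trans ?_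
  change Finsupp.linearCombination ℂ
    (fun f : Fin k ↪ Fin n => PiTensorProduct.lift (placeMultilinear (U := U) one f))
    (Finsupp.single f 1) (PiTensorProduct.tprod ℂ w) = _
  rw [Finsupp.linearCombination_single, one_smul, PiTensorProduct.lift.tprod]
  rfl

/-- Pure tensors against basis injections span, so each identity below becomes a comparison of two
explicit families of vectors. -/
theorem tens_ext {U : Type} [AddCommGroup U] [Module ℂ U] {k : ℕ} {M : Type} [AddCommMonoid M]
    [Module ℂ M] {g h : (injSystem n).Tens U k →ₗ[ℂ] M}
    (H : ∀ (w : Fin k → U) (f : Fin k ↪ Fin n), g (pure w f) = h (pure w f)) : g = h := by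
  refine TensorProduct.ext (PiTensorProduct.ext (MultilinearMap.ext fun w => ?_))
  exact Finsupp.lhom_ext' fun f => LinearMap.ext_ring (H w f)

theorem act_pure {U : Type} [AddCommGroup U] [Module ℂ U] {k : ℕ} (σ : Equiv.Perm (Fin k))
    (w : Fin k → U) (f : Fin k ↪ Fin n) :
    (injSystem n).act U σ (pure w f) = pure (fun i => w (σ.symm i)) (σ.symm.toEmbedding.trans f) :=
  (TensorProduct.map_tmul _ _ _ _).trans
    (congrArg₂ (fun a (b : InjSpace n k) => a ⊗ₜ[ℂ] b) (TensorPow.perm_tprod σ w)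
      (injPerm_single σ f))

/-- Permuting the vectors and the injection simultaneously puts w_{σ⁻¹(s)} at f(σ⁻¹(s)): the placed
family is unchanged, only its enumeration differs. -/
theorem collapseTens_act {k : ℕ} (σ : Equiv.Perm (Fin k)) (x : (injSystem n).Tens U k) :
    collapseTens one U n k ((injSystem n).act U σ x) = collapseTens one U n k x := by
  refine LinearMap.congr_fun (f := collapseTens one U n k ∘ₗ (injSystem n).act U σ)
    (tens_ext fun w f => ?_) x
  rw [LinearMap.comp_apply, act_pure, collapseTens_pure, collapseTens_pure]
  congr 1
  symm
  apply eq_place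
  · intro s
    exact place_apply one f w (σ.symm s)
  · intro i hi
    refine place_of_notMem _ _ _ fun ⟨s, hs⟩ => hi ⟨σ s, ?_⟩
    simpa using hs

/-- All k! terms of the average have the same image. -/
theorem collapseTens_avg {k : ℕ} (x : (injSystem n).Tens U k) :
    collapseTens one U n k ((injSystem n).avg U k x : (injSystem n).Tens U k) =
      collapseTens one U n k x := by
  rw [ResSystem.coe_avg, map_smul, map_sum]
  simp only [collapseTens_act, Finset.sum_const, Finset.card_univ, Fintype.card_perm,
    Fintype.card_fin]
  rw [← Nat.cast_smul_eq_nsmul ℂ, smul_smul,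
    inv_mul_cancel₀ (by exact_mod_cast k.factorial_ne_zero), one_smul]

variable (U n) in
/-- The linear map `⨁ (U^{⊗ k} ⊗ ℂ Inj([k], [n]))^{S_k} → V^{⊗ n}` placing `w_s` at `f(s)`. -/
noncomputable def collapse : InjSum U n →ₗ[ℂ] ⨂[ℂ] _ : Fin n, V :=
  DirectSum.toModule ℂ ℕ _ fun k => collapseTens one U n k ∘ₗ ((injSystem n).inv U k).subtype

theorem collapse_lof (k : ℕ) (x : (injSystem n).inv U k) :
    collapse one U n (DirectSum.lof ℂ ℕ (fun k => (injSystem n).inv U k) k x) =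
      collapseTens one U n k x := by
  rw [collapse, DirectSum.toModule_lof]
  rfl

theorem collapse_injElement {k : ℕ} (w : Fin k → U) (f : Fin k ↪ Fin n) :
    collapse one U n (injElement w f) = PiTensorProduct.tprod ℂ (place one f w) :=
  (collapse_lof one k _).trans ((collapseTens_avg one _).trans (collapseTens_pure one w f))

/-! #### Intertwining properties -/

theorem map_ins_resStar_pure {U : Type} [AddCommGroup U] [Module ℂ U] {k : ℕ} (u : U)
    (l : Fin (k + 1)) (w : Fin k → U) (f : Fin k ↪ Fin n) :
    TensorProduct.map (TensorPow.ins l u) ((injSystem n).resStar l) (pure w f) =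
      ∑ g with l.succAboveEmb.trans g = f, pure (l.insertNth u w) g := by
  refine (TensorProduct.map_tmul _ _ _ _).trans ?_
  refine (congrArg₂ (fun a (b : InjSpace n (k + 1)) => a ⊗ₜ[ℂ] b) (TensorPow.ins_tprod l u w)
    (injResStar_single l f)).trans ?_
  exact TensorProduct.tmul_sum _ _ _

theorem map_contr_res_pure {U : Type} [AddCommGroup U] [Module ℂ U] {k : ℕ} (f : Module.Dual ℂ U)
    (l : Fin (k + 1)) (w : Fin (k + 1) → U) (g : Fin (k + 1) ↪ Fin n) :
    TensorProduct.map (TensorPow.contr l f) ((injSystem n).res l) (pure w g) =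
      f (w l) • pure (fun i => w (l.succAbove i)) (l.succAboveEmb.trans g) := by
  refine (TensorProduct.map_tmul _ _ _ _).trans ?_
  refine (congrArg₂ (fun a (b : InjSpace n k) => a ⊗ₜ[ℂ] b) (TensorPow.contr_tprod l f w)
    (injRes_single l g)).trans ?_
  exact (TensorProduct.smul_tmul' _ _ _).symm

theorem map_diagAct_pure {U : Type} [AddCommGroup U] [Module ℂ U] {k : ℕ} (A : Module.End ℂ U)
    (w : Fin k → U) (f : Fin k ↪ Fin n) :
    TensorProduct.map (TensorPow.diagAct k A) LinearMap.id (pure w f) =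
      ∑ i, pure (Function.update w i (A (w i))) f := by
  refine (TensorProduct.map_tmul _ _ _ _).trans ?_
  rw [TensorPow.diagAct, LinearMap.sum_apply]
  simp only [TensorPow.app_tprod]
  exact TensorProduct.sum_tmul _ _ _

/-- The injection `g` with `g(l) = i` and `g ∘ ι_l = f`. -/
noncomputable def insertEmb {k : ℕ} (l : Fin (k + 1)) (f : Fin k ↪ Fin n) (i : Fin n)
    (hi : i ∉ Set.range f) : Fin (k + 1) ↪ Fin n :=
  ⟨l.insertNth (α := fun _ => Fin n) i f, by
    intro a b h
    rcases Fin.eq_self_or_eq_succAbove l a with ha | ⟨a, rfl⟩ <;>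
      rcases Fin.eq_self_or_eq_succAbove l b with hb | ⟨b, rfl⟩
    · rw [ha, hb]
    · subst ha
      simp only [Fin.insertNth_apply_same, Fin.insertNth_apply_succAbove] at h
      exact absurd ⟨b, h.symm⟩ hi
    · subst hb
      simp only [Fin.insertNth_apply_same, Fin.insertNth_apply_succAbove] at h
      exact absurd ⟨a, h⟩ hi
    · simp only [Fin.insertNth_apply_succAbove] at h
      rw [f.injective h]⟩

theorem insertEmb_same {k : ℕ} (l : Fin (k + 1)) (f : Fin k ↪ Fin n) (i : Fin n)
    (hi : i ∉ Set.range f) : insertEmb l f i hi l = i :=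
  Fin.insertNth_apply_same (α := fun _ => Fin n) l i f

theorem insertEmb_succAbove {k : ℕ} (l : Fin (k + 1)) (f : Fin k ↪ Fin n) (i : Fin n)
    (hi : i ∉ Set.range f) (s : Fin k) : insertEmb l f i hi (l.succAbove s) = f s :=
  Fin.insertNth_apply_succAbove (α := fun _ => Fin n) l i f s

/-- An extension g of f is determined by g(l), which may be any place outside the image of f. The
sum defining res_l^* is therefore a sum over free places, and ψ vanishes at the occupied ones. -/
theorem sum_trans_eq {k : ℕ} {M : Type} [AddCommMonoid M] (l : Fin (k + 1)) (f : Fin k ↪ Fin n)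
    (φ : (Fin (k + 1) ↪ Fin n) → M) (ψ : Fin n → M)
    (h : ∀ g, l.succAboveEmb.trans g = f → φ g = ψ (g l)) (h0 : ∀ i ∈ Set.range f, ψ i = 0) :
    ∑ g with l.succAboveEmb.trans g = f, φ g = ∑ i, ψ i := by
  classical
  rw [← Finset.sum_filter_add_sum_filter_not Finset.univ (fun i => i ∈ Set.range f) ψ,
    Finset.sum_eq_zero (s := Finset.univ.filter fun i => i ∈ Set.range f)
      (fun i hi => h0 i (Finset.mem_filter.1 hi).2), zero_add]
  refine Finset.sum_bij' (fun g _ => g l)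
    (fun i hi => insertEmb l f i (Finset.mem_filter.1 hi).2) ?_ ?_ ?_ ?_ ?_
  · intro g hg
    simp only [Finset.mem_filter, Finset.mem_univ, true_and] at hg ⊢
    subst hg
    rintro ⟨s, hs⟩
    exact Fin.succAbove_ne l s (g.injective hs)
  · intro i hi
    simp only [Finset.mem_filter, Finset.mem_univ, true_and]
    ext s
    simp [insertEmb_succAbove]
  · intro g hg
    simp only [Finset.mem_filter, Finset.mem_univ, true_and] at hg
    subst hg
    ext s
    rcases Fin.eq_self_or_eq_succAbove l s with rfl | ⟨s, rfl⟩ <;>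
      simp [insertEmb_same, insertEmb_succAbove]
  · intro i hi
    exact insertEmb_same _ _ _ _
  · intro g hg
    exact h g (Finset.mem_filter.1 hg).2

theorem diagAct_tprod (A : Module.End ℂ V) (v : Fin n → V) :
    TensorPow.diagAct n A (PiTensorProduct.tprod ℂ v) =
      ∑ i, PiTensorProduct.tprod ℂ (Function.update v i (A (v i))) := by
  rw [TensorPow.diagAct, LinearMap.sum_apply]
  simp only [TensorPow.app_tprod]

theorem tprod_update_zero (v : Fin n → V) (i : Fin n) :
    PiTensorProduct.tprod ℂ (Function.update v i 0) = 0 :=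
  (PiTensorProduct.tprod ℂ).map_update_zero _ _

end Collapse

end SymmetricRep

/-! ### The elements of gl(V) evaluated on 𝟙 and on U -/

namespace Splitting

variable {V : Type} [AddCommGroup V] [Module ℂ V] {one : V} (h1 : one ≠ 0) {U : Submodule ℂ V}
  (hU : IsCompl (ℂ ∙ one) U)

theorem oneDual_one : oneDual h1 hU one = 1 := by
  have h : Submodule.projectionOnto (ℂ ∙ one) U hU one =
      ⟨one, Submodule.mem_span_singleton_self one⟩ :=
    Submodule.projectionOnto_apply_left hU ⟨one, Submodule.mem_span_singleton_self one⟩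
  rw [oneDual, LinearMap.comp_apply, h]
  refine (LinearEquiv.symm_apply_eq (LinearEquiv.toSpanNonzeroSingleton ℂ V one h1)).2 ?_
  apply Subtype.ext
  simp

theorem oneDual_coe (u : U) : oneDual h1 hU (u : V) = 0 := by
  rw [oneDual, LinearMap.comp_apply, Submodule.projectionOnto_apply_right, map_zero]

theorem proj_one : proj hU one = 0 :=
  Submodule.projectionOnto_apply_right hU.symm ⟨one, Submodule.mem_span_singleton_self one⟩

theorem proj_coe (u : U) : proj hU (u : V) = u := Submodule.projectionOnto_apply_left hU.symm u

theorem oneDual_smul_add_proj (v : V) : oneDual h1 hU v • one + (proj hU v : V) = v := by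
  obtain ⟨x, hx, u, hu, rfl⟩ := Submodule.mem_sup.1 (hU.sup_eq_top ▸ Submodule.mem_top : v ∈ _)
  obtain ⟨c, rfl⟩ := Submodule.mem_span_singleton.1 hx
  have h := oneDual_coe h1 hU ⟨u, hu⟩
  have h' := proj_coe hU ⟨u, hu⟩
  simp only at h h'
  rw [map_add, map_add, map_smul, map_smul, oneDual_one, proj_one, h, h']
  simp

theorem lower_one (u : U) : lower h1 hU u one = u := by
  rw [lower, LinearMap.smulRight_apply, oneDual_one, one_smul]

theorem lower_coe (u u' : U) : lower h1 hU u (u' : V) = 0 := by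
  rw [lower, LinearMap.smulRight_apply, oneDual_coe, zero_smul]

theorem raise_one (f : Module.Dual ℂ U) : raise hU f one = 0 := by
  rw [raise, LinearMap.smulRight_apply, LinearMap.comp_apply, proj_one, map_zero, zero_smul]

theorem raise_coe (f : Module.Dual ℂ U) (u : U) : raise hU f (u : V) = f u • one := by
  rw [raise, LinearMap.smulRight_apply, LinearMap.comp_apply, proj_coe]

theorem embed_one (A : Module.End ℂ U) : embed hU A one = 0 := by
  rw [embed, LinearMap.comp_apply, LinearMap.comp_apply, proj_one, map_zero, map_zero]

theorem embed_coe (A : Module.End ℂ U) (u : U) : embed hU A (u : V) = A u := by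
  rw [embed, LinearMap.comp_apply, LinearMap.comp_apply, proj_coe]
  rfl

end Splitting

/-! ### Compatibility of the placement map with gl(V) and S_n -/

namespace SymmetricRep

variable {V : Type} [AddCommGroup V] [Module ℂ V] {one : V} (h1 : one ≠ 0) {U : Submodule ℂ V}
  (hU : IsCompl (ℂ ∙ one) U) {n : ℕ}

open Splitting

/-- The endomorphism of u kills the vectors w_s and turns one 𝟙 into u, so its diagonal action is a
sum over free places, which res_l^* also produces. The position l of u in the enumeration is
irrelevant: each single l already gives the whole diagonal action. -/
theorem collapseTens_ins {k : ℕ} (u : U) (l : Fin (k + 1)) (x : (injSystem n).Tens U k) :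
    collapseTens one U n (k + 1)
      (TensorProduct.map (TensorPow.ins l u) ((injSystem n).resStar l) x) =
      TensorPow.diagAct n (lower h1 hU u) (collapseTens one U n k x) := by
  refine LinearMap.congr_fun (f := collapseTens one U n (k + 1) ∘ₗ
    TensorProduct.map (TensorPow.ins l u) ((injSystem n).resStar l))
    (g := TensorPow.diagAct n (lower h1 hU u) ∘ₗ collapseTens one U n k)
    (tens_ext fun w f => ?_) x
  rw [LinearMap.comp_apply, LinearMap.comp_apply, map_ins_resStar_pure, map_sum,
    collapseTens_pure, diagAct_tprod]
  apply sum_trans_eq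
  · rintro g rfl
    rw [collapseTens_pure, place_of_notMem one _ w, lower_one]
    · congr 1
      symm
      apply eq_place
      · intro s
        rcases Fin.eq_self_or_eq_succAbove l s with rfl | ⟨s, rfl⟩
        · simp
        · rw [Function.update_of_ne (g.injective.ne (Fin.succAbove_ne l s)),
            Fin.insertNth_apply_succAbove]
          exact place_apply one (l.succAboveEmb.trans g) w s
      · intro i hi
        rw [Function.update_of_ne (fun h => hi ⟨l, h.symm⟩), place_of_notMem]
        rintro ⟨s, rfl⟩
        exact hi ⟨_, rfl⟩
    · rintro ⟨s, hs⟩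
      exact Fin.succAbove_ne l s (g.injective hs)
  -- Occupied places contribute zero, as u annihilates U.
  · rintro _ ⟨s, rfl⟩
    rw [place_apply, lower_coe, tprod_update_zero]

/-- The endomorphism of f kills each 𝟙 and replaces w_l by f(w_l)𝟙, which frees the place g(l).
Different l free different places, so here the sum over l is needed and carries no normalising
factor. -/
theorem collapseTens_contr {k : ℕ} (f : Module.Dual ℂ U) (x : (injSystem n).Tens U (k + 1)) :
    ∑ l : Fin (k + 1), collapseTens one U n k
      (TensorProduct.map (TensorPow.contr l f) ((injSystem n).res l) x) =
      TensorPow.diagAct n (raise hU f) (collapseTens one U n (k + 1) x) := by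
  have := LinearMap.congr_fun (f := ∑ l : Fin (k + 1), collapseTens one U n k ∘ₗ
    TensorProduct.map (TensorPow.contr l f) ((injSystem n).res l))
    (g := TensorPow.diagAct n (raise hU f) ∘ₗ collapseTens one U n (k + 1))
    (tens_ext fun w g => ?_) x
  · rwa [LinearMap.sum_apply] at this
  rw [LinearMap.sum_apply, LinearMap.comp_apply, collapseTens_pure, diagAct_tprod]
  apply Fintype.sum_of_injective g g.injective
  · intro i hi
    rw [place_of_notMem _ _ _ hi, raise_one, tprod_update_zero]
  · intro l
    rw [LinearMap.comp_apply, map_contr_res_pure, map_smul, collapseTens_pure, place_apply,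
      raise_coe, (PiTensorProduct.tprod ℂ).map_update_smul]
    congr 2
    symm
    apply eq_place
    · intro s
      change Function.update (place one g w) (g l) one (g (l.succAbove s)) = _
      rw [Function.update_of_ne (g.injective.ne (Fin.succAbove_ne l s)), place_apply]
    · intro i hi
      rcases eq_or_ne i (g l) with rfl | h
      · rw [Function.update_self]
      · rw [Function.update_of_ne h, place_of_notMem]
        rintro ⟨s, rfl⟩
        rcases Fin.eq_self_or_eq_succAbove l s with rfl | ⟨s, rfl⟩
        · exact h rfl
        · exact hi ⟨s, rfl⟩

/-- In degree 0 all factors are 𝟙; this matches the convention that E_f vanishes there. -/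
theorem collapseTens_raise_zero (f : Module.Dual ℂ U) (x : (injSystem n).Tens U 0) :
    TensorPow.diagAct n (raise hU f) (collapseTens one U n 0 x) = 0 := by
  refine LinearMap.congr_fun (f := TensorPow.diagAct n (raise hU f) ∘ₗ collapseTens one U n 0)
    (g := 0) (tens_ext fun w g => ?_) x
  rw [LinearMap.comp_apply, collapseTens_pure, diagAct_tprod]
  refine Finset.sum_eq_zero fun i _ => ?_
  rw [place_of_notMem _ _ _ (fun ⟨s, _⟩ => s.elim0), raise_one, tprod_update_zero]

theorem collapseTens_diag {k : ℕ} (A : Module.End ℂ U) (x : (injSystem n).Tens U k) :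
    collapseTens one U n k (TensorProduct.map (TensorPow.diagAct k A) LinearMap.id x) =
      TensorPow.diagAct n (embed hU A) (collapseTens one U n k x) := by
  refine LinearMap.congr_fun (f := collapseTens one U n k ∘ₗ
    TensorProduct.map (TensorPow.diagAct k A) LinearMap.id)
    (g := TensorPow.diagAct n (embed hU A) ∘ₗ collapseTens one U n k)
    (tens_ext fun w f => ?_) x
  rw [LinearMap.comp_apply, LinearMap.comp_apply, map_diagAct_pure, map_sum,
    collapseTens_pure, diagAct_tprod]
  apply Fintype.sum_of_injective f f.injective
  · intro i hi
    rw [place_of_notMem _ _ _ hi, embed_one, tprod_update_zero]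
  · intro s
    rw [collapseTens_pure, place_update, place_apply, embed_coe]

theorem collapse_create (u : U) (x : InjSum U n) :
    collapse one U n ((injSystem n).create U u x) =
      TensorPow.diagAct n (lower h1 hU u) (collapse one U n x) := by
  refine LinearMap.congr_fun (f := collapse one U n ∘ₗ (injSystem n).create U u)
    (g := TensorPow.diagAct n (lower h1 hU u) ∘ₗ collapse one U n)
    (DirectSum.linearMap_ext ℂ fun k => LinearMap.ext fun x => ?_) x
  simp only [LinearMap.comp_apply, ResSystem.create_lof, collapse_lof, ResSystem.coe_createComp,
    map_smul, map_sum, collapseTens_ins h1 hU]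
  -- The k + 1 insertion positions contribute equally, which is what the factor 1/(k + 1) in F_u
  -- compensates.
  rw [Finset.sum_const, Finset.card_univ, Fintype.card_fin, ← Nat.cast_smul_eq_nsmul ℂ, smul_smul,
    Nat.cast_add, Nat.cast_one, one_div_mul_cancel (by exact_mod_cast k.succ_ne_zero), one_smul]

theorem collapse_annih (f : Module.Dual ℂ U) (x : InjSum U n) :
    collapse one U n ((injSystem n).annih U f x) =
      TensorPow.diagAct n (raise hU f) (collapse one U n x) := by
  refine LinearMap.congr_fun (f := collapse one U n ∘ₗ (injSystem n).annih U f)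
    (g := TensorPow.diagAct n (raise hU f) ∘ₗ collapse one U n)
    (DirectSum.linearMap_ext ℂ fun k => LinearMap.ext fun x => ?_) x
  rcases k with _ | k
  · simp only [LinearMap.comp_apply, ResSystem.annih_lof_zero, collapse_lof, map_zero,
      collapseTens_raise_zero]
  · simp only [LinearMap.comp_apply, ResSystem.annih_lof_succ, collapse_lof,
      ResSystem.coe_annihComp, map_sum, collapseTens_contr hU]

theorem collapse_diagonal (A : Module.End ℂ U) (x : InjSum U n) :
    collapse one U n ((injSystem n).diagonal U A x) =
      TensorPow.diagAct n (embed hU A) (collapse one U n x) := by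
  refine LinearMap.congr_fun (f := collapse one U n ∘ₗ (injSystem n).diagonal U A)
    (g := TensorPow.diagAct n (embed hU A) ∘ₗ collapse one U n)
    (DirectSum.linearMap_ext ℂ fun k => LinearMap.ext fun x => ?_) x
  simp only [LinearMap.comp_apply, ResSystem.diagonal_lof, collapse_lof, ResSystem.coe_diagComp,
    collapseTens_diag hU]

theorem mapInv_avg {U : Type} [AddCommGroup U] [Module ℂ U] {S S' : ResSystem}
    (φ : ResSystem.Hom S S') (k : ℕ) (x : S.Tens U k) :
    φ.mapInv U k (S.avg U k x) = S'.avg U k (TensorProduct.map LinearMap.id (φ.app k) x) := by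
  apply Subtype.ext
  rw [ResSystem.Hom.coe_mapInv, ResSystem.coe_avg, ResSystem.coe_avg, map_smul, map_sum]
  simp only [ResSystem.Hom.act_map]

theorem collapse_rep (g : Equiv.Perm (Fin n)) (x : InjSum U n) :
    collapse one U n (injSumRep U n g x) = tensorRep V n g (collapse one U n x) := by
  refine LinearMap.congr_fun (f := collapse one U n ∘ₗ (injMap n g).map U)
    (g := TensorPow.perm g ∘ₗ collapse one U n)
    (DirectSum.linearMap_ext ℂ fun k => LinearMap.ext fun x => ?_) x
  simp only [LinearMap.comp_apply, ResSystem.Hom.map_lof, collapse_lof,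
    ResSystem.Hom.coe_mapInv]
  refine LinearMap.congr_fun (f := collapseTens one U n k ∘ₗ
    TensorProduct.map LinearMap.id ((injMap n g).app k))
    (g := TensorPow.perm g ∘ₗ collapseTens one U n k) (tens_ext fun w f => ?_) x.1
  have h : TensorProduct.map LinearMap.id ((injMap n g).app k) (pure w f) =
      pure w (f.trans g.toEmbedding) :=
    (TensorProduct.map_tmul _ _ _ _).trans
      (congrArg (fun b : InjSpace n k => _ ⊗ₜ[ℂ] b) (injPost_single g f))
  rw [LinearMap.comp_apply, LinearMap.comp_apply, h, collapseTens_pure, collapseTens_pure,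
    TensorPow.perm_tprod]
  congr 1
  symm
  -- The permutation g moves the vector from place f(s) to place g(f(s)).
  apply eq_place
  · intro s
    change place one f w (g.symm (g (f s))) = _
    rw [Equiv.symm_apply_apply, place_apply]
  · intro i hi
    rw [place_of_notMem]
    rintro ⟨s, hs⟩
    exact hi ⟨s, (congrArg g hs).trans (g.apply_symm_apply i)⟩

/-! #### The inverse map -/

/-- Contract the factors outside the image of `f` with the functional `𝟙^*`, and project the
others to `U`. -/
noncomputable def contractFun {k : ℕ} (f : Fin k ↪ Fin n) (v : Fin n → V) : ⨂[ℂ] _ : Fin k, U :=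
  open scoped Classical in
  (∏ i with i ∉ Set.range f, oneDual h1 hU (v i)) •
    PiTensorProduct.tprod ℂ fun s => proj hU (v (f s))

/-- A change at an occupied place f(s) only affects the tensor factor s; c is the product of the
values of 𝟙^* at the free places. This and the next lemma exhibit the dependence on one argument in
linear form, from which multilinearity follows. -/
theorem contractFun_update_apply {k : ℕ} (f : Fin k ↪ Fin n) (v : Fin n → V) (s : Fin k) :
    ∃ c : ℂ, ∀ x, contractFun h1 hU f (Function.update v (f s) x) = c • PiTensorProduct.tprod ℂ
      (Function.update (fun s => proj hU (v (f s))) s (proj hU x)) := by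
  classical
  refine ⟨∏ i with i ∉ Set.range f, oneDual h1 hU (v i), fun x => ?_⟩
  unfold contractFun
  congr 1
  · refine Finset.prod_congr rfl fun i hi => ?_
    rw [Function.update_of_ne]
    rintro rfl
    exact (Finset.mem_filter.1 hi).2 ⟨s, rfl⟩
  · congr 1
    funext t
    rcases eq_or_ne t s with rfl | h
    · simp
    · rw [Function.update_of_ne (f.injective.ne h), Function.update_of_ne h]

/-- A change at a free place only affects one factor of the scalar product, while the tensor stays
fixed. -/
theorem contractFun_update_of_notMem {k : ℕ} (f : Fin k ↪ Fin n) (v : Fin n → V) (i : Fin n)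
    (hi : i ∉ Set.range f) : ∃ y, ∀ x, contractFun h1 hU f (Function.update v i x) =
      oneDual h1 hU x • y := by
  classical
  refine ⟨(∏ j ∈ (Finset.univ.filter fun j => j ∉ Set.range f).erase i, oneDual h1 hU (v j)) •
    PiTensorProduct.tprod ℂ fun s => proj hU (v (f s)), fun x => ?_⟩
  rw [smul_smul]
  unfold contractFun
  congr 2
  · rw [← Finset.mul_prod_erase (Finset.univ.filter fun j => j ∉ Set.range f) _
      (Finset.mem_filter.2 ⟨Finset.mem_univ i, hi⟩), Function.update_self]
    congr 1
    refine Finset.prod_congr rfl fun j hj => ?_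
    rw [Function.update_of_ne (Finset.ne_of_mem_erase hj)]
  · funext s
    rw [Function.update_of_ne fun h => hi ⟨s, h⟩]

/-- The contraction as a multilinear map. -/
noncomputable def contractMultilinear {k : ℕ} (f : Fin k ↪ Fin n) :
    MultilinearMap ℂ (fun _ : Fin n => V) (⨂[ℂ] _ : Fin k, U) :=
  MultilinearMap.mk' (contractFun h1 hU f)
    (by
      intro v i x y
      by_cases hi : i ∈ Set.range f
      · obtain ⟨s, rfl⟩ := hi
        obtain ⟨c, h⟩ := contractFun_update_apply h1 hU f v s
        rw [h, h, h, map_add, (PiTensorProduct.tprod ℂ).map_update_add, smul_add]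
      · obtain ⟨z, h⟩ := contractFun_update_of_notMem h1 hU f v i hi
        rw [h, h, h, map_add, add_smul])
    (by
      intro v i c x
      by_cases hi : i ∈ Set.range f
      · obtain ⟨s, rfl⟩ := hi
        obtain ⟨c, h⟩ := contractFun_update_apply h1 hU f v s
        rw [h, h, map_smul, (PiTensorProduct.tprod ℂ).map_update_smul, smul_comm]
      · obtain ⟨z, h⟩ := contractFun_update_of_notMem h1 hU f v i hi
        rw [h, h, map_smul, smul_eq_mul, mul_smul])

/-- If g(s) is not an occupied place it carries 𝟙, which the projection to U kills; if f(s) is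
missed by g, then 𝟙^* is applied to w_s ∈ U. So contraction distinguishes the sets of occupied
places. -/
theorem contractFun_place_ne_zero {k k' : ℕ} (f : Fin k ↪ Fin n) (w : Fin k → U)
    (g : Fin k' ↪ Fin n) (h : contractFun h1 hU g (place one f w) ≠ 0) :
    Set.range g = Set.range f := by
  classical
  apply Set.Subset.antisymm
  · rintro _ ⟨s, rfl⟩
    by_contra hs
    apply h
    unfold contractFun
    rw [(PiTensorProduct.tprod ℂ).map_coord_zero s, smul_zero]
    rw [place_of_notMem _ _ _ hs, proj_one]
  · rintro _ ⟨s, rfl⟩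
    by_contra hs
    apply h
    unfold contractFun
    rw [Finset.prod_eq_zero (i := f s) (by simpa using hs), zero_smul]
    rw [place_apply, oneDual_coe]

/-- For a re-enumeration f ∘ σ⁻¹ of the same places every free place carries 𝟙 and gives the scalar
1. What remains is the tensor part of the σ-term of the average. -/
theorem contractFun_place_perm {k : ℕ} (f : Fin k ↪ Fin n) (w : Fin k → U)
    (σ : Equiv.Perm (Fin k)) :
    contractFun h1 hU (σ.symm.toEmbedding.trans f) (place one f w) =
      PiTensorProduct.tprod ℂ fun i => w (σ.symm i) := by
  classical
  unfold contractFun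
  rw [Finset.prod_eq_one, one_smul]
  · congr 1
    funext s
    exact (congrArg _ (place_apply one f w (σ.symm s))).trans (proj_coe hU _)
  · intro i hi
    rw [place_of_notMem, oneDual_one]
    rintro ⟨s, rfl⟩
    exact (Finset.mem_filter.1 hi).2 ⟨σ s, by simp⟩

variable (n) in
/-- The component of degree `k` of the inverse map. -/
noncomputable def expandTens (k : ℕ) : (⨂[ℂ] _ : Fin n, V) →ₗ[ℂ] (injSystem n).Tens U k :=
  (k.factorial : ℂ)⁻¹ • ∑ g : Fin k ↪ Fin n,
    (TensorProduct.mk ℂ (⨂[ℂ] _ : Fin k, U) ((injSystem n).D k)).flip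
      (Finsupp.single g 1 : (Fin k ↪ Fin n) →₀ ℂ) ∘ₗ
      PiTensorProduct.lift (contractMultilinear h1 hU g)

theorem expandTens_tprod (k : ℕ) (v : Fin n → V) :
    expandTens h1 hU n k (PiTensorProduct.tprod ℂ v) = (k.factorial : ℂ)⁻¹ •
      ∑ g : Fin k ↪ Fin n, (contractFun h1 hU g v ⊗ₜ[ℂ]
        (Finsupp.single g 1 : (Fin k ↪ Fin n) →₀ ℂ) : (injSystem n).Tens U k) := by
  rw [expandTens, LinearMap.smul_apply, LinearMap.sum_apply]
  congr 1
  refine Finset.sum_congr rfl fun g _ => ?_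
  rw [LinearMap.comp_apply, PiTensorProduct.lift.tprod]
  rfl

theorem expandTens_place_of_ne {k k' : ℕ} (hk : k ≠ k') (f : Fin k' ↪ Fin n) (w : Fin k' → U) :
    expandTens h1 hU n k (PiTensorProduct.tprod ℂ (place one f w)) = 0 := by
  rw [expandTens_tprod, Finset.sum_eq_zero, smul_zero]
  intro g _
  by_cases h : contractFun h1 hU g (place one f w) = 0
  · rw [h]
    exact TensorProduct.zero_tmul _ _
  · exfalso
    apply hk
    -- Injections with equal images have domains of equal cardinality.
    have := congrArg Set.ncard (contractFun_place_ne_zero h1 hU f w g h)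
    simpa [← Set.image_univ, Set.ncard_image_of_injective, f.injective, g.injective] using this

/-- Only the k! injections f ∘ σ⁻¹ survive in the sum over all injections, and the prefactor 1/k! is
that of the average. -/
theorem expandTens_place {k : ℕ} (f : Fin k ↪ Fin n) (w : Fin k → U) :
    expandTens h1 hU n k (PiTensorProduct.tprod ℂ (place one f w)) =
      (injSystem n).avg U k (pure w f) := by
  rw [expandTens_tprod, ResSystem.coe_avg]
  congr 1
  symm
  apply Fintype.sum_of_injective (fun σ : Equiv.Perm (Fin k) => σ.symm.toEmbedding.trans f)
  · intro σ τ h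
    have : σ.symm = τ.symm := Equiv.ext fun s => f.injective (DFunLike.congr_fun h s)
    exact Equiv.symm_bijective.injective this
  · intro g hg
    by_cases h : contractFun h1 hU g (place one f w) = 0
    · rw [h]
      exact TensorProduct.zero_tmul _ _
    · exfalso
      have hr := contractFun_place_ne_zero h1 hU f w g h
      -- Equality of the images gives g = f ∘ τ with τ a permutation, so g would be the term of σ =
      -- τ⁻¹.
      have h2 : ∀ s, ∃ t, f t = g s := fun s => hr.subset ⟨s, rfl⟩
      choose τ hτ using h2
      have hτi : Function.Injective τ := fun a b hab => g.injective <| by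
        rw [← hτ, ← hτ, hab]
      refine hg ⟨(Equiv.ofBijective τ (Finite.injective_iff_bijective.1 hτi)).symm, ?_⟩
      ext s
      exact congrArg Fin.val (hτ s)
  · intro σ
    rw [act_pure, contractFun_place_perm]
    rfl

/-- Placed families of the wrong degree are annihilated and those of degree k come back as averages,
so the contraction recovers each component of x. This yields a left inverse. -/
theorem expandTens_collapse (k : ℕ) (x : InjSum U n) :
    expandTens h1 hU n k (collapse one U n x) = (x k : (injSystem n).Tens U k) := by
  refine LinearMap.congr_fun (f := expandTens h1 hU n k ∘ₗ collapse one U n)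
    (g := ((injSystem n).inv U k).subtype ∘ₗ
      DirectSum.component ℂ ℕ (fun k => (injSystem n).inv U k) k) ?_ x
  apply ResSystem.total_linearMap_ext
  intro k' x
  rw [LinearMap.comp_apply, collapse_lof, collapseTens_avg, LinearMap.comp_apply]
  rcases eq_or_ne k k' with rfl | hk
  · rw [DirectSum.component.lof_self]
    have e : expandTens h1 hU n k ∘ₗ collapseTens one U n k =
        ((injSystem n).inv U k).subtype ∘ₗ (injSystem n).avg U k := by
      apply tens_ext
      intro w f
      rw [LinearMap.comp_apply, collapseTens_pure, expandTens_place]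
      rfl
    exact LinearMap.congr_fun e x
  · rw [DirectSum.component.of, dif_neg hk.symm, map_zero]
    have e : expandTens h1 hU n k ∘ₗ collapseTens one U n k' = 0 := by
      apply tens_ext
      intro w f
      rw [LinearMap.comp_apply, collapseTens_pure, expandTens_place_of_ne h1 hU hk]
      rfl
    exact LinearMap.congr_fun e x

include h1 hU in
theorem collapse_injective : Function.Injective (collapse one U n) := by
  intro x y h
  refine DFinsupp.ext fun k => Subtype.ext ?_
  rw [← expandTens_collapse h1 hU k x, ← expandTens_collapse h1 hU k y, h]

-- Multilinear expansion of v_i = proj(v_i) + 𝟙^*(v_i)𝟙 writes a pure tensor as a sum over subsets s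
-- of places; each term is a scalar multiple of a placed family, enumerated increasingly along s.
include h1 hU in
theorem collapse_surjective : Function.Surjective (collapse one U n) := by
  classical
  rw [← LinearMap.range_eq_top, eq_top_iff, ← PiTensorProduct.span_tprod_eq_top,
    Submodule.span_le]
  rintro _ ⟨v, rfl⟩
  have hv : v = (fun i => (proj hU (v i) : V)) + fun i => oneDual h1 hU (v i) • one := by
    funext i
    rw [Pi.add_apply, add_comm, oneDual_smul_add_proj]
  rw [hv, (PiTensorProduct.tprod ℂ).map_add_univ]
  refine Submodule.sum_mem _ fun s _ => ?_
  -- This form separates the scalars 𝟙^*(v_i), i ∉ s, so that `map_piecewise_smul` can extract them.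
  have hs : s.piecewise (fun i => (proj hU (v i) : V)) (fun i => oneDual h1 hU (v i) • one) =
      sᶜ.piecewise (fun i => oneDual h1 hU (v i) •
        s.piecewise (fun i => (proj hU (v i) : V)) (fun _ => one) i)
        (s.piecewise (fun i => (proj hU (v i) : V)) (fun _ => one)) := by
    funext i
    by_cases hi : i ∈ s <;> simp [hi]
  rw [hs, (PiTensorProduct.tprod ℂ).map_piecewise_smul]
  refine Submodule.smul_mem _ _ ⟨injElement (fun t => proj hU (v (s.orderEmbOfFin rfl t)))
    (s.orderEmbOfFin rfl).toEmbedding, ?_⟩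
  rw [collapse_injElement]
  congr 1
  symm
  apply eq_place
  · intro t
    exact Finset.piecewise_eq_of_mem _ _ _ (s.orderEmbOfFin_mem rfl t)
  · intro i hi
    apply Finset.piecewise_eq_of_notMem
    intro h
    apply hi
    change i ∈ Set.range (s.orderEmbOfFin rfl)
    rwa [Finset.range_orderEmbOfFin]

variable (n) in
/-- The isomorphism `V^{⊗ n} ≃ ⨁ (U^{⊗ k} ⊗ ℂ Inj([k], [n]))^{S_k}`. -/
noncomputable def expandEquiv : (⨂[ℂ] _ : Fin n, V) ≃ₗ[ℂ] InjSum U n :=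
  (LinearEquiv.ofBijective (collapse one U n)
    ⟨collapse_injective h1 hU, collapse_surjective h1 hU⟩).symm

theorem expandEquiv_collapse (x : InjSum U n) : expandEquiv h1 hU n (collapse one U n x) = x :=
  (LinearEquiv.ofBijective (collapse one U n) _).symm_apply_apply x

theorem collapse_expandEquiv (x : ⨂[ℂ] _ : Fin n, V) :
    collapse one U n (expandEquiv h1 hU n x) = x :=
  (LinearEquiv.ofBijective (collapse one U n) _).apply_symm_apply x

end SymmetricRep

/-! ### Families of morphisms depending polynomially on the parameter -/

namespace TensorPowers

instance {r s : ℕ} : Finite (PartDiag r s) :=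
  Finite.of_injective (fun π : PartDiag r s => π.r) fun _ _ h =>
    Setoid.ext fun a b => iff_of_eq (congrFun (congrFun h a) b)

/-- The coefficient of a diagram in a morphism `𝔥^{⊗ r} ⟶ 𝔥^{⊗ s}`. -/
noncomputable def coef {ν : ℂ} {r s : ℕ} (π : PartDiag r s) :
    ((⟨r⟩ : TensorPowers ν) ⟶ ⟨s⟩) →ₗ[ℂ] ℂ :=
  (Finsupp.lapply π : HomSpace r s →ₗ[ℂ] ℂ)

/-- The multiple of a diagram as a morphism. -/
noncomputable def diagSmul (ν : ℂ) {r s : ℕ} (π : PartDiag r s) (c : ℂ) :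
    (⟨r⟩ : TensorPowers ν) ⟶ ⟨s⟩ := (Finsupp.single π c : HomSpace r s)

theorem coef_diagSmul {ν : ℂ} {r s : ℕ} [DecidableEq (PartDiag r s)] (π ρ : PartDiag r s) (c : ℂ) :
    coef ρ (diagSmul ν π c) = if π = ρ then c else 0 := by
  classical
  refine (Finsupp.single_apply (a := π) (a' := ρ) (b := c)).trans ?_
  congr

theorem hom_ext {ν : ℂ} {r s : ℕ} {f g : (⟨r⟩ : TensorPowers ν) ⟶ ⟨s⟩}
    (h : ∀ π, coef π f = coef π g) : f = g := Finsupp.ext (α := PartDiag r s) (M := ℂ) h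

theorem sum_coef {ν : ℂ} {r s : ℕ} [Fintype (PartDiag r s)] (f : (⟨r⟩ : TensorPowers ν) ⟶ ⟨s⟩) :
    ∑ π, diagSmul ν π (coef π f) = f := Finsupp.univ_sum_single (α := PartDiag r s) (M := ℂ) f

theorem diagSmul_comp {ν : ℂ} {r s t : ℕ} (π : PartDiag r s) (ρ : PartDiag s t) (a b : ℂ) :
    diagSmul ν π a ≫ diagSmul ν ρ b =
      diagSmul ν (PartDiag.star π ρ) (a * (b * ν ^ PartDiag.loops π ρ)) :=
  comp_single r s t π ρ a b

/-- The coefficients of the family of morphisms `𝔥^{⊗ r} ⟶ 𝔥^{⊗ s}` are polynomials in `ν`. -/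
def IsPoly {r s : ℕ} (f : ∀ ν : ℂ, (⟨r⟩ : TensorPowers ν) ⟶ ⟨s⟩) : Prop :=
  ∀ π : PartDiag r s, ∃ p : Polynomial ℂ, ∀ ν, coef π (f ν) = p.eval ν

theorem isPoly_zero {r s : ℕ} : IsPoly (r := r) (s := s) fun _ => 0 := fun _ => ⟨0, fun ν => by
  rw [Polynomial.eval_zero, map_zero]⟩

theorem isPoly_single {r s : ℕ} (π : PartDiag r s) (p : Polynomial ℂ) :
    IsPoly fun ν => diagSmul ν π (p.eval ν) := by
  classical
  intro ρ
  refine ⟨if π = ρ then p else 0, fun ν => ?_⟩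
  rw [coef_diagSmul]
  split_ifs <;> simp

theorem isPoly_diag {r s : ℕ} (π : PartDiag r s) : 
    IsPoly fun ν => (diag π : (⟨r⟩ : TensorPowers ν) ⟶ ⟨s⟩) := by
  have := isPoly_single π 1
  simp only [Polynomial.eval_one] at this
  exact this

theorem IsPoly.add {r s : ℕ} {f g : ∀ ν : ℂ, (⟨r⟩ : TensorPowers ν) ⟶ ⟨s⟩} (hf : IsPoly f)
    (hg : IsPoly g) : IsPoly fun ν => f ν + g ν := fun π => by
  obtain ⟨p, hp⟩ := hf π
  obtain ⟨q, hq⟩ := hg π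
  refine ⟨p + q, fun ν => ?_⟩
  rw [Polynomial.eval_add, ← hp, ← hq, map_add]

theorem IsPoly.smul_poly {r s : ℕ} {f : ∀ ν : ℂ, (⟨r⟩ : TensorPowers ν) ⟶ ⟨s⟩} (p : Polynomial ℂ)
    (hf : IsPoly f) : IsPoly fun ν => p.eval ν • f ν := fun π => by
  obtain ⟨q, hq⟩ := hf π
  refine ⟨p * q, fun ν => ?_⟩
  rw [Polynomial.eval_mul, ← hq, map_smul, smul_eq_mul]

theorem IsPoly.smul {r s : ℕ} {f : ∀ ν : ℂ, (⟨r⟩ : TensorPowers ν) ⟶ ⟨s⟩} (c : ℂ)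
    (hf : IsPoly f) : IsPoly fun ν => c • f ν := by
  simpa only [Polynomial.eval_C] using hf.smul_poly (Polynomial.C c)

theorem IsPoly.sum {r s : ℕ} {ι : Type*} (A : Finset ι)
    {f : ι → ∀ ν : ℂ, (⟨r⟩ : TensorPowers ν) ⟶ ⟨s⟩} (hf : ∀ i ∈ A, IsPoly (f i)) :
    IsPoly fun ν => ∑ i ∈ A, f i ν := by
  classical
  induction A using Finset.induction_on with
  | empty => simpa only [Finset.sum_empty] using isPoly_zero
  | insert a A ha ih =>
    simp only [Finset.sum_insert ha]
    exact (hf a (Finset.mem_insert_self _ _)).add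
      (ih fun i hi => hf i (Finset.mem_insert_of_mem hi))

/-- The composition law depends on ν only through the monomials ν^{n(ρ,π)}, and there are finitely
many diagrams. -/
theorem IsPoly.comp {r s t : ℕ} {f : ∀ ν : ℂ, (⟨r⟩ : TensorPowers ν) ⟶ ⟨s⟩}
    {g : ∀ ν : ℂ, (⟨s⟩ : TensorPowers ν) ⟶ ⟨t⟩} (hf : IsPoly f) (hg : IsPoly g) :
    IsPoly fun ν => f ν ≫ g ν := by
  classical
  have := Fintype.ofFinite (PartDiag r s)
  have := Fintype.ofFinite (PartDiag s t)
  choose p hp using hf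
  choose q hq using hg
  have h : ∀ ν, f ν ≫ g ν = ∑ π : PartDiag r s, ∑ ρ : PartDiag s t,
      diagSmul ν (PartDiag.star π ρ)
        ((p π * (q ρ * Polynomial.X ^ PartDiag.loops π ρ)).eval ν) := by
    intro ν
    conv_lhs => rw [← sum_coef (f ν), ← sum_coef (g ν), Preadditive.sum_comp]
    refine Finset.sum_congr rfl fun π _ => ?_
    rw [Preadditive.comp_sum]
    refine Finset.sum_congr rfl fun ρ _ => ?_
    rw [diagSmul_comp, hp, hq]
    simp
  rw [funext h]
  exact IsPoly.sum _ fun π _ => IsPoly.sum _ fun ρ _ => isPoly_single _ _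

theorem isPoly_id (r : ℕ) : IsPoly fun ν => 𝟙 (⟨r⟩ : TensorPowers ν) :=
  isPoly_diag (PartDiag.fib id id)

theorem IsPoly.noncommProd {k : ℕ} {ι : Type} [DecidableEq ι] (A : Finset ι)
    (f : ∀ ν : ℂ, ι → End (⟨k⟩ : TensorPowers ν))
    (hc : ∀ ν, (A : Set ι).Pairwise (Function.onFun Commute (f ν)))
    (hf : ∀ i ∈ A, IsPoly fun ν => f ν i) : 
    IsPoly fun ν => (A.noncommProd (f ν) (hc ν) : End (⟨k⟩ : TensorPowers ν)) := by
  induction A using Finset.induction_on with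
  | empty =>
    simp only [Finset.noncommProd_empty]
    exact isPoly_id k
  | insert a A ha ih =>
    simp only [Finset.noncommProd_insert_of_notMem _ _ _ _ ha]
    -- Multiplication of endomorphisms is composition in the opposite order, hence the new factor
    -- comes last.
    exact (ih _ fun i hi => hf i (Finset.mem_insert_of_mem hi)).comp
      (hf a (Finset.mem_insert_self _ _))

/-- The factors 1 - c_{ij} have constant coefficients; ν enters only through their composition. -/
theorem isPoly_injProj (k : ℕ) : IsPoly fun ν => injProj ν k := by
  simp only [injProj_eq]
  refine IsPoly.noncommProd _ _ _ fun p _ => ?_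
  have h : IsPoly fun ν => 𝟙 (⟨k⟩ : TensorPowers ν) +
      (-1 : ℂ) • (diag (PartDiag.join p.1 p.2) : (⟨k⟩ : TensorPowers ν) ⟶ ⟨k⟩) :=
    (isPoly_id k).add ((isPoly_diag _).smul _)
  convert h using 2 with ν
  rw [neg_one_smul, ← sub_eq_add_neg]
  rfl

end TensorPowers

namespace SymmetricRep

open TensorPowers

/-! ### Faithfulness of the functors to representations -/

/-- The linear map given by a linear combination of diagrams. -/
noncomputable def repMap (n : ℕ) {r s : ℕ} :
    ((⟨r⟩ : TensorPowers (n : ℂ)) ⟶ ⟨s⟩) →ₗ[ℂ]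
      ((Fin r → Fin n) →₀ ℂ) →ₗ[ℂ] ((Fin s → Fin n) →₀ ℂ) :=
  (Finsupp.linearCombination ℂ (diagMap n) : HomSpace r s →ₗ[ℂ] _)

theorem repMap_diagSmul (n : ℕ) {r s : ℕ} (π : PartDiag r s) (c : ℂ) :
    repMap n (diagSmul n π c) = c • diagMap n π :=
  Finsupp.linearCombination_single ℂ _ _

/-- Passing from the functor to bare linear maps makes matrix entries accessible; conversely,
functoriality yields the composition rule for `repMap`. -/
theorem tensorPowersFunctor_map_hom (n : ℕ) {r s : ℕ} (f : (⟨r⟩ : TensorPowers (n : ℂ)) ⟶ ⟨s⟩)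
    (x : (Fin r → Fin n) →₀ ℂ) :
    ((tensorPowersFunctor n).map f).hom x = repMap n f x := by
  have := Fintype.ofFinite (PartDiag r s)
  rw [← sum_coef f, Functor.map_sum, map_sum, LinearMap.sum_apply]
  have h : ∀ (ι : Type) (A : Finset ι) (g : ι → (funObj n r ⟶ funObj n s)),
      (∑ i ∈ A, g i).hom x = ∑ i ∈ A, (g i).hom x := by
    classical
    intro ι A g
    induction A using Finset.induction_on with
    | empty => simp
    | insert a A ha ih => rw [Finset.sum_insert ha, Finset.sum_insert ha, ← ih]; rfl
  refine (h _ _ _).trans (Finset.sum_congr rfl fun π _ => ?_)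
  rw [repMap_diagSmul]
  exact congrArg (fun g : funObj n r ⟶ funObj n s => g.hom x)
    (Finsupp.linearCombination_single ℂ (coef π f) π (v := diagHom n))

theorem repMap_comp (n : ℕ) {r s t : ℕ} (f : (⟨r⟩ : TensorPowers (n : ℂ)) ⟶ ⟨s⟩)
    (g : (⟨s⟩ : TensorPowers (n : ℂ)) ⟶ ⟨t⟩) :
    repMap n (f ≫ g : (⟨r⟩ : TensorPowers (n : ℂ)) ⟶ ⟨t⟩) = repMap n g ∘ₗ repMap n f := by
  refine LinearMap.ext fun x => ?_
  refine (tensorPowersFunctor_map_hom n (f ≫ g) x).symm.trans ?_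
  rw [Functor.map_comp, LinearMap.comp_apply]
  refine Eq.trans ?_ (tensorPowersFunctor_map_hom n g _)
  exact congrArg _ (tensorPowersFunctor_map_hom n f x)

theorem repMap_diag (n : ℕ) {r s : ℕ} (π : PartDiag r s) :
    repMap n (diag π : (⟨r⟩ : TensorPowers (n : ℂ)) ⟶ ⟨s⟩) = diagMap n π :=
  (Finsupp.linearCombination_single ℂ _ _).trans (one_smul _ _)

theorem repMap_id (n r : ℕ) : repMap n (𝟙 (⟨r⟩ : TensorPowers (n : ℂ))) = LinearMap.id :=
  (repMap_diag n _).trans (diagMap_one n r)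

open scoped Classical in
theorem repMap_single_apply (n : ℕ) {r s : ℕ} (a : (⟨r⟩ : TensorPowers (n : ℂ)) ⟶ ⟨s⟩)
    [Fintype (PartDiag r s)] (x : Fin r → Fin n) (y : Fin s → Fin n) :
    repMap n a (Finsupp.single x 1) y =
      ∑ π : PartDiag r s, if PartDiag.Compat π x y then coef π a else 0 := by
  conv_lhs => rw [← sum_coef a]
  rw [map_sum, LinearMap.sum_apply, Finsupp.finsetSum_apply]
  refine Finset.sum_congr rfl fun π _ => ?_
  rw [repMap_diagSmul, LinearMap.smul_apply, diagMap_single, Finsupp.smul_apply,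
    Finsupp.finsetSum_apply, Finset.sum_eq_single y]
  · split_ifs <;> simp
  · intro b _ hb
    split_ifs
    · simp [hb]
    · rfl
  · simp

/-- A partition of r + s vertices has at most n parts, so every τ is exactly the partition into
fibres of a labelling by [n]. The matrix entry at this labelling sums the coefficients over all π
finer than τ; this system is triangular for refinement, hence invertible. -/
theorem repMap_injective (n : ℕ) {r s : ℕ} (h : r + s ≤ n)
    (a : (⟨r⟩ : TensorPowers (n : ℂ)) ⟶ ⟨s⟩)
    (ha : repMap n a = 0) : a = 0 := by
  classical
  have := Fintype.ofFinite (PartDiag r s)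
  have key : ∀ τ : PartDiag r s, ∑ π : PartDiag r s, (if π ≤ τ then coef π a else 0) = 0 := by
    intro τ
    have := Fintype.ofFinite (Quotient τ)
    have hc : Fintype.card (Quotient τ) ≤ Fintype.card (Fin n) := by
      rw [← Nat.card_eq_fintype_card]
      refine (Nat.card_le_card_of_surjective _ (Quotient.mk_surjective (s := τ))).trans ?_
      simpa using h
    obtain ⟨e⟩ := Function.Embedding.nonempty_of_card_le hc
    -- Distinct parts of τ get distinct labels, so a diagram is compatible with c exactly when it
    -- refines τ.
    let c : Fin r ⊕ Fin s → Fin n := fun u => e (Quotient.mk τ u)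
    have h1 := repMap_single_apply n a (c ∘ Sum.inl) (c ∘ Sum.inr)
    rw [ha] at h1
    refine Eq.trans (Finset.sum_congr rfl fun π _ => ?_) h1.symm
    congr 1
    rw [PartDiag.Compat, Sum.elim_comp_inl_inr]
    refine propext (forall_congr' fun u => forall_congr' fun v => ?_)
    have : c u = c v ↔ τ u v := e.injective.eq_iff.trans Quotient.eq
    rw [this]
  refine hom_ext fun τ => ?_
  rw [map_zero]
  -- Once the coefficients of all strictly finer partitions vanish, the sum for τ has a single term
  -- left.
  induction τ using WellFoundedLT.induction with
  | ind τ ih =>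
    have h1 := key τ
    rw [Finset.sum_eq_single τ] at h1
    · simpa using h1
    · intro π _ hπ
      split_ifs with h2
      · exact ih π (lt_of_le_of_ne h2 hπ)
      · rfl
    · simp

/-- Each coefficient is a polynomial vanishing at all sufficiently large integers, hence
identically. -/
theorem eq_zero_of_isPoly {r s : ℕ} {f : ∀ ν : ℂ, (⟨r⟩ : TensorPowers ν) ⟶ ⟨s⟩} (hf : IsPoly f)
    (h : ∀ n : ℕ, repMap n (f n) = 0) (ν : ℂ) : f ν = 0 := by
  refine hom_ext fun π => ?_
  obtain ⟨p, hp⟩ := hf π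
  have hz : p = 0 := by
    apply Polynomial.eq_zero_of_infinite_isRoot
    -- The shift by r + s restricts to the integers where the representation is faithful.
    refine Set.Infinite.mono ?_ ((Set.infinite_range_of_injective
      (f := fun m : ℕ => ((m + (r + s) : ℕ) : ℂ)) ?_))
    · rintro _ ⟨m, rfl⟩
      change p.eval _ = 0
      rw [← hp, repMap_injective (m + (r + s)) (Nat.le_add_left _ _) _ (h _), map_zero]
    · intro a b hab
      have := Nat.cast_injective (R := ℂ) hab
      omega
  rw [hp, hz, Polynomial.eval_zero, map_zero]

/-! ### The projection to injective functions -/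

variable (n : ℕ)

/-- The inclusion of `ℂ Inj([k], [n])` into `ℂ Fun([k], [n])`. -/
noncomputable def inclInj (k : ℕ) : InjSpace n k →ₗ[ℂ] ((Fin k → Fin n) →₀ ℂ) :=
  Finsupp.lmapDomain ℂ ℂ fun f => f

open scoped Classical in
/-- The projection of `ℂ Fun([k], [n])` to `ℂ Inj([k], [n])` that kills non-injective functions. -/
noncomputable def toInj (k : ℕ) : ((Fin k → Fin n) →₀ ℂ) →ₗ[ℂ] InjSpace n k :=
  Finsupp.linearCombination ℂ fun f =>
    if h : Function.Injective f then Finsupp.single ⟨f, h⟩ 1 else 0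

variable {n}

theorem inclInj_single {k : ℕ} (f : Fin k ↪ Fin n) (c : ℂ) :
    inclInj n k (Finsupp.single f c) = Finsupp.single (f : Fin k → Fin n) c :=
  Finsupp.mapDomain_single

theorem toInj_single {k : ℕ} (f : Fin k ↪ Fin n) :
    toInj n k (Finsupp.single (f : Fin k → Fin n) 1) = Finsupp.single f 1 := by
  rw [toInj, Finsupp.linearCombination_single, one_smul, dif_pos f.injective]
  rfl

theorem toInj_single_of_not {k : ℕ} {f : Fin k → Fin n} (h : ¬ Function.Injective f) :
    toInj n k (Finsupp.single f 1) = 0 := by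
  rw [toInj, Finsupp.linearCombination_single, one_smul, dif_neg h]

theorem toInj_comp_inclInj (k : ℕ) : toInj n k ∘ₗ inclInj n k = LinearMap.id :=
  injSpace_ext fun f => by
    rw [LinearMap.comp_apply, inclInj_single, toInj_single, LinearMap.id_apply]

theorem repMap_joinEnd {k : ℕ} (i j : Fin k) (f : Fin k → Fin n) :
    repMap n (1 - joinEnd n i j : End (⟨k⟩ : TensorPowers (n : ℂ))) (Finsupp.single f 1) =
      if f i = f j then 0 else Finsupp.single f 1 := by
  classical
  have h : repMap n (1 - joinEnd n i j : End (⟨k⟩ : TensorPowers (n : ℂ))) =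
      repMap n (𝟙 (⟨k⟩ : TensorPowers (n : ℂ))) -
        repMap n (diag (PartDiag.join i j) : (⟨k⟩ : TensorPowers (n : ℂ)) ⟶ ⟨k⟩) :=
    map_sub (repMap n) _ _
  rw [h, repMap_id, repMap_diag, LinearMap.sub_apply, LinearMap.id_apply, diagMap_single]
  simp only [PartDiag.compat_join]
  rw [Finset.sum_eq_single f]
  · split_ifs <;> simp_all
  · intro g _ hg
    rw [if_neg fun h => hg h.1]
  · simp

theorem repMap_noncommProd {k : ℕ} (A : Finset (Fin k × Fin k))
    (hA : (A : Set (Fin k × Fin k)).Pairwise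
      (Function.onFun Commute fun p => 1 - joinEnd (n : ℂ) p.1 p.2)) (f : Fin k → Fin n) :
    repMap n (A.noncommProd (fun p => 1 - joinEnd (n : ℂ) p.1 p.2) hA :
      End (⟨k⟩ : TensorPowers (n : ℂ))) (Finsupp.single f 1) =
      if ∀ p ∈ A, f p.1 ≠ f p.2 then Finsupp.single f 1 else 0 := by
  induction A using Finset.induction_on with
  | empty =>
    rw [Finset.noncommProd_empty]
    refine (LinearMap.congr_fun (repMap_id n k) _).trans ?_
    simp
  | insert a A ha ih =>
    rw [Finset.noncommProd_insert_of_notMem _ _ _ _ ha]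
    refine (LinearMap.congr_fun (repMap_comp n _ _) _).trans ?_
    rw [LinearMap.comp_apply, ih]
    by_cases h : ∀ p ∈ A, f p.1 ≠ f p.2
    · rw [if_pos h, repMap_joinEnd]
      by_cases h' : f a.1 = f a.2
      · rw [if_pos h', if_neg fun h2 => h2 a (Finset.mem_insert_self _ _) h']
      · rw [if_neg h', if_pos]
        intro p hp
        rcases Finset.mem_insert.1 hp with rfl | hp
        · exact h'
        · exact h p hp
    · rw [if_neg h, map_zero, if_neg fun h2 => h fun p hp => h2 p (Finset.mem_insert_of_mem hp)]

/-- The factor 1 - c_{ij} kills the basis functions with f(i) = f(j) and fixes the others. The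
product over all i ≠ j therefore keeps exactly the injective functions. -/
theorem repMap_injProj (k : ℕ) : repMap n (injProj (n : ℂ) k) = inclInj n k ∘ₗ toInj n k := by
  refine Finsupp.lhom_ext' fun f => LinearMap.ext_ring ?_
  have e : repMap n (injProj (n : ℂ) k) (Finsupp.single f 1) =
      if ∀ p ∈ (Finset.univ : Finset (Fin k)).offDiag, f p.1 ≠ f p.2 then Finsupp.single f 1
      else 0 := by
    rw [injProj_eq]
    exact repMap_noncommProd _ _ f
  refine e.trans ?_
  rw [LinearMap.comp_apply, LinearMap.comp_apply, Finsupp.lsingle_apply]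
  have h : (∀ p ∈ (Finset.univ : Finset (Fin k)).offDiag, f p.1 ≠ f p.2) ↔
      Function.Injective f := by
    simp only [Finset.mem_offDiag, Finset.mem_univ, true_and, Prod.forall]
    exact ⟨fun h a b hab => by_contra fun hne => h a b hne hab, fun h a b hne => h.ne hne⟩
  by_cases hf : Function.Injective f
  · rw [if_pos (h.2 hf)]
    have := toInj_single ⟨f, hf⟩
    rw [Function.Embedding.coeFn_mk] at this
    rw [this, inclInj_single]
    rfl
  · rw [if_neg fun h2 => hf (h.1 h2), toInj_single_of_not hf, map_zero]

/-- The linear map `ℂ Inj([r], [n]) → ℂ Inj([s], [n])` given by a linear combination of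
diagrams. -/
noncomputable def injEv (n : ℕ) {r s : ℕ} :
    ((⟨r⟩ : TensorPowers (n : ℂ)) ⟶ ⟨s⟩) →ₗ[ℂ] InjSpace n r →ₗ[ℂ] InjSpace n s :=
  (LinearMap.compRight ℂ (toInj n s)) ∘ₗ (LinearMap.lcomp ℂ _ (inclInj n r)) ∘ₗ repMap n

theorem injEv_apply {r s : ℕ} (f : (⟨r⟩ : TensorPowers (n : ℂ)) ⟶ ⟨s⟩) (x : InjSpace n r) :
    injEv n f x = toInj n s (repMap n f (inclInj n r x)) := rfl

theorem injEv_id (r : ℕ) : injEv n (𝟙 (⟨r⟩ : TensorPowers (n : ℂ))) = LinearMap.id := by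
  refine LinearMap.ext fun x => ?_
  rw [injEv_apply, repMap_id]
  exact LinearMap.congr_fun (toInj_comp_inclInj r) x

/-- The idempotent x_s in the middle acts as projection to injections followed by inclusion, which
cuts the composite at ℂ Inj([s],[n]). Without it non-injective intermediate functions would
contribute. -/
theorem injEv_comp {r s t : ℕ} (f : (⟨r⟩ : TensorPowers (n : ℂ)) ⟶ ⟨s⟩)
    (g : (⟨s⟩ : TensorPowers (n : ℂ)) ⟶ ⟨t⟩) :
    injEv n (f ≫ injProj (n : ℂ) s ≫ g : (⟨r⟩ : TensorPowers (n : ℂ)) ⟶ ⟨t⟩) =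
      injEv n g ∘ₗ injEv n f := by
  refine LinearMap.ext fun x => ?_
  rw [injEv_apply, repMap_comp, repMap_comp, repMap_injProj]
  rfl

theorem injEv_diag {r s : ℕ} (π : PartDiag r s) (f : Fin r ↪ Fin n) :
    open scoped Classical in
    injEv n (diag π : (⟨r⟩ : TensorPowers (n : ℂ)) ⟶ ⟨s⟩) (Finsupp.single f 1) =
      ∑ g : Fin s ↪ Fin n, if PartDiag.Compat π f g then Finsupp.single g 1 else 0 := by
  classical
  rw [injEv_apply, repMap_diag, inclInj_single, diagMap_single, map_sum]
  symm
  apply Fintype.sum_of_injective (fun g : Fin s ↪ Fin n => (g : Fin s → Fin n))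
    DFunLike.coe_injective
  · intro g hg
    rw [apply_ite (toInj n s), map_zero, toInj_single_of_not, ite_self]
    exact fun h => hg ⟨⟨g, h⟩, rfl⟩
  · intro g
    rw [apply_ite (toInj n s), map_zero, toInj_single]

theorem injEv_permDiag {k : ℕ} (σ : Equiv.Perm (Fin k)) :
    injEv n (permDiag (n : ℂ) σ) = injPerm σ := by
  classical
  refine injSpace_ext fun f => ?_
  refine (injEv_diag _ f).trans ?_
  rw [injPerm_single, Finset.sum_eq_single (σ.symm.toEmbedding.trans f)]
  · rw [if_pos]
    rw [PartDiag.compat_fib_right]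
    funext i
    simp
  · intro g _ hg
    rw [if_neg]
    rw [PartDiag.compat_fib_right]
    intro h
    apply hg
    ext i
    have := congrFun h (σ.symm i)
    simp at this
    simp [this]
  · simp

theorem injEv_resDiag {k : ℕ} (l : Fin (k + 1)) : injEv n (resDiag (n : ℂ) l) = injRes l := by
  classical
  refine injSpace_ext fun f => ?_
  refine (injEv_diag _ f).trans ?_
  rw [injRes_single, Finset.sum_eq_single (l.succAboveEmb.trans f)]
  · rw [if_pos]
    rw [PartDiag.compat_fib_left]
    rfl
  · intro g _ hg
    rw [if_neg]
    rw [PartDiag.compat_fib_left]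
    exact fun h => hg (DFunLike.coe_injective h)
  · simp

theorem injEv_resStarDiag {k : ℕ} (l : Fin (k + 1)) :
    injEv n (resStarDiag (n : ℂ) l) = injResStar l := by
  classical
  refine injSpace_ext fun f => ?_
  refine (injEv_diag _ f).trans ?_
  rw [injResStar_single, Finset.sum_filter]
  refine Finset.sum_congr rfl fun g _ => ?_
  congr 1
  rw [PartDiag.compat_fib_right]
  exact propext ⟨fun h => DFunLike.coe_injective h.symm, fun h => by rw [← h]; rfl⟩

end SymmetricRep

/-! ### Linearity and composition of the morphisms between the objects Δ_k -/

theorem sandwich_comp_sandwich {C : Type 1} [Category.{0} C] {X Y Z : C} {p : X ⟶ X} {q : Y ⟶ Y}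
    {r : Z ⟶ Z} (hq : q ≫ q = q) (f : X ⟶ Y) (g : Y ⟶ Z) :
    (p ≫ f ≫ q) ≫ q ≫ g ≫ r = p ≫ (f ≫ q ≫ g) ≫ r := by
  simp only [Category.assoc]
  rw [← Category.assoc q q, hq]

theorem sandwich_add {C : Type 1} [Category.{0} C] [Preadditive C] {X Y : C} (p : X ⟶ X)
    (q : Y ⟶ Y) (f g : X ⟶ Y) : p ≫ (f + g) ≫ q = p ≫ f ≫ q + p ≫ g ≫ q := by
  rw [Preadditive.add_comp, Preadditive.comp_add]

theorem sandwich_smul {C : Type 1} [Category.{0} C] [Preadditive C] [Linear ℂ C] {X Y : C}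
    (p : X ⟶ X) (q : Y ⟶ Y) (c : ℂ) (f : X ⟶ Y) : p ≫ (c • f) ≫ q = c • (p ≫ f ≫ q) := by
  rw [Linear.smul_comp, Linear.comp_smul]

theorem Mat_.embedding_map_smul {C : Type 1} [Category.{0} C] [Preadditive C] [Linear ℂ C]
    {X Y : C} (c : ℂ) (f : X ⟶ Y) :
    (Mat_.embedding C).map (c • f) = c • (Mat_.embedding C).map f := rfl

namespace Deligne

open TensorPowers

/-- The two copies of x_s meeting at Δ_s merge into one by idempotency. It has the same shape as
`injEv_comp`, so both settings obey one composition law. -/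
theorem deltaMap_comp {ν : ℂ} {r s t : ℕ} (f : (⟨r⟩ : TensorPowers ν) ⟶ ⟨s⟩)
    (g : (⟨s⟩ : TensorPowers ν) ⟶ ⟨t⟩) :
    deltaMap f ≫ deltaMap g = deltaMap (f ≫ injProj ν s ≫ g) :=
  Karoubi.hom_ext_iff.2 (((Mat_.embedding _).map_comp _ _).symm.trans (congrArg _
    (sandwich_comp_sandwich (injProj_idem ν s) f g)))

theorem deltaMap_add {ν : ℂ} {r s : ℕ} (f g : (⟨r⟩ : TensorPowers ν) ⟶ ⟨s⟩) :
    deltaMap (f + g) = deltaMap f + deltaMap g :=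
  Karoubi.hom_ext_iff.2 ((congrArg (Mat_.embedding _).map (sandwich_add _ _ f g)).trans
    (Mat_.embedding _).map_add)

theorem deltaMap_smul {ν : ℂ} {r s : ℕ} (c : ℂ) (f : (⟨r⟩ : TensorPowers ν) ⟶ ⟨s⟩) :
    deltaMap (c • f) = c • deltaMap f :=
  Karoubi.hom_ext_iff.2 ((congrArg (Mat_.embedding _).map (sandwich_smul _ _ c f)).trans
    (Mat_.embedding_map_smul c _))

end Deligne

/-! ### Operators given by universal formulas -/

open TensorPowers

/-- A system of vector spaces `D_k` on which the morphisms `Δ_r ⟶ Δ_s` act. -/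
structure Realization (ν : ℂ) where
  /-- the spaces -/
  S : ResSystem
  /-- the action of the morphism `Δ_r ⟶ Δ_s` induced by a morphism `𝔥^{⊗ r} ⟶ 𝔥^{⊗ s}` -/
  ev : ∀ {r s : ℕ}, ((⟨r⟩ : TensorPowers ν) ⟶ ⟨s⟩) →ₗ[ℂ] S.D r →ₗ[ℂ] S.D s
  ev_id : ∀ r, ev (𝟙 (⟨r⟩ : TensorPowers ν)) = LinearMap.id
  ev_comp : ∀ {r s t : ℕ} (f : (⟨r⟩ : TensorPowers ν) ⟶ ⟨s⟩) (g : (⟨s⟩ : TensorPowers ν) ⟶ ⟨t⟩),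
    ev (f ≫ injProj ν s ≫ g) = ev g ∘ₗ ev f
  ev_perm : ∀ {k : ℕ} (σ : Equiv.Perm (Fin k)), ev (permDiag ν σ) = S.perm σ
  ev_res : ∀ {k : ℕ} (l : Fin (k + 1)), ev (resDiag ν l) = S.res l
  ev_resStar : ∀ {k : ℕ} (l : Fin (k + 1)), ev (resStarDiag ν l) = S.resStar l

namespace Realization

/-- The realization by the spaces `Hom(Y, Δ_k)`. -/
noncomputable def hom (ν : ℂ) (Y : Deligne ν) : Realization ν where
  S := (Deligne.deltaSystem ν).homSystem Y
  ev :=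
    { toFun := fun f => Linear.rightComp ℂ Y (Deligne.deltaMap f)
      map_add' := fun f g => LinearMap.ext fun h =>
        (congrArg (fun φ => h ≫ φ) (Deligne.deltaMap_add f g)).trans (Preadditive.comp_add _ _ _ h _ _)
      map_smul' := fun c f => LinearMap.ext fun h =>
        (congrArg (fun φ => h ≫ φ) (Deligne.deltaMap_smul c f)).trans (Linear.comp_smul _ _ _ h c _) }
  ev_id r := LinearMap.ext fun h =>
    (congrArg (fun φ => h ≫ φ) (Deligne.deltaMap_id ν r)).trans (Category.comp_id h)
  ev_comp f g := LinearMap.ext fun h =>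
    (congrArg (fun φ => h ≫ φ) (Deligne.deltaMap_comp f g).symm).trans (Category.assoc h _ _).symm
  ev_perm _ := rfl
  ev_res _ := rfl
  ev_resStar _ := rfl

/-- The realization by the spaces `ℂ Inj([k], [n])`. -/
noncomputable def inj (n : ℕ) : Realization (n : ℂ) where
  S := SymmetricRep.injSystem n
  ev := SymmetricRep.injEv n
  ev_id := SymmetricRep.injEv_id
  ev_comp := SymmetricRep.injEv_comp
  ev_perm := SymmetricRep.injEv_permDiag
  ev_res := SymmetricRep.injEv_resDiag
  ev_resStar := SymmetricRep.injEv_resStarDiag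

/-- Inserting identities into the composition law shows that the idempotents act trivially: a
realization sees a morphism only through its restriction to Δ_r and Δ_s. -/
theorem ev_sandwich {ν : ℂ} (R : Realization ν) {r s : ℕ} (f : (⟨r⟩ : TensorPowers ν) ⟶ ⟨s⟩) :
    R.ev (injProj ν r ≫ f ≫ injProj ν s) = R.ev f := by
  have h1 := R.ev_comp (𝟙 _) (f ≫ injProj ν s)
  rw [R.ev_id, LinearMap.comp_id, Category.id_comp] at h1
  have h2 := R.ev_comp f (𝟙 _)
  rw [R.ev_id, LinearMap.id_comp, Category.comp_id] at h2
  rw [h1, h2]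

/-- A family of morphisms that depends polynomially on `ν` is zero in every realization if it is
zero on the spaces `ℂ Inj([k], [n])` for all `n`. -/
theorem ev_eq_zero {r s : ℕ} {c : ∀ ν : ℂ, (⟨r⟩ : TensorPowers ν) ⟶ ⟨s⟩} (hc : IsPoly c)
    (h : ∀ n : ℕ, (inj n).ev (c n) = 0) {ν : ℂ} (R : Realization ν) : R.ev (c ν) = 0 := by
  -- The family c itself may be nonzero on non-injective functions. Its sandwich between x_r and x_s
  -- factors through injections, hence vanishes on all functions, and faithfulness applies to it.
  rw [← ev_sandwich, SymmetricRep.eq_zero_of_isPoly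
    (f := fun ν => injProj ν r ≫ c ν ≫ injProj ν s)
    ((isPoly_injProj r).comp (hc.comp (isPoly_injProj s))) (fun n => ?_) ν, map_zero]
  rw [SymmetricRep.repMap_comp, SymmetricRep.repMap_comp, SymmetricRep.repMap_injProj,
    SymmetricRep.repMap_injProj]
  refine LinearMap.ext fun x => ?_
  have h2 := LinearMap.congr_fun (h n) (SymmetricRep.toInj n r x)
  exact (congrArg (SymmetricRep.inclInj n s) h2).trans (map_zero _)

end Realization

section Universal

variable (U : Type) [AddCommGroup U] [Module ℂ U]

/-- Families of linear maps `U^{⊗ k} ⊗ D_k → U^{⊗ k'} ⊗ D_{k'}` for all realizations. -/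
abbrev TensFamily (k k' : ℕ) : Type 1 :=
  ∀ (ν : ℂ) (R : Realization ν), R.S.Tens U k →ₗ[ℂ] R.S.Tens U k'

variable {U} [FiniteDimensional ℂ U]

theorem tensorCoeff_tmul {W D : Type} [AddCommGroup W] [Module ℂ W] [FiniteDimensional ℂ W]
    [AddCommGroup D] [Module ℂ D] (i : Fin (Module.finrank ℂ W)) (w : W) (d : D) :
    tensorCoeff W i (w ⊗ₜ[ℂ] d) = (Module.finBasis ℂ W).coord i w • d := rfl

/-- The coefficients of the family are morphisms depending polynomially on the parameter. -/
def TensFamily.IsPoly {k k' : ℕ} (Q : TensFamily U k k') : Prop :=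
  ∀ (u : ⨂[ℂ] _ : Fin k, U) (j : Fin (Module.finrank ℂ (⨂[ℂ] _ : Fin k', U))),
    ∃ c : ∀ ν : ℂ, (⟨k⟩ : TensorPowers ν) ⟶ ⟨k'⟩, TensorPowers.IsPoly c ∧
      ∀ (ν : ℂ) (R : Realization ν) (z : R.S.D k),
        tensorCoeff _ j (Q ν R (u ⊗ₜ[ℂ] z)) = R.ev (c ν) z

namespace TensFamily.IsPoly

theorem map {k k' : ℕ} (T : (⨂[ℂ] _ : Fin k, U) →ₗ[ℂ] ⨂[ℂ] _ : Fin k', U)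
    {d : ∀ ν : ℂ, (⟨k⟩ : TensorPowers ν) ⟶ ⟨k'⟩} (hd : TensorPowers.IsPoly d) :
    TensFamily.IsPoly fun _ R => TensorProduct.map T (R.ev (d _)) := fun u j =>
  ⟨fun ν => (Module.finBasis ℂ _).coord j (T u) • d ν, hd.smul _, fun ν R z => by
    rw [TensorProduct.map_tmul, tensorCoeff_tmul, map_smul, LinearMap.smul_apply]⟩

theorem zero {k k' : ℕ} : TensFamily.IsPoly (U := U) (k := k) (k' := k') fun _ _ => 0 := fun u j =>
  ⟨_, isPoly_zero, fun ν R z => by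
    rw [LinearMap.zero_apply, map_zero, map_zero, LinearMap.zero_apply]⟩

theorem add {k k' : ℕ} {Q Q' : TensFamily U k k'} (h : Q.IsPoly) (h' : Q'.IsPoly) :
    TensFamily.IsPoly fun ν R => Q ν R + Q' ν R := fun u j => by
  obtain ⟨c, hc, e⟩ := h u j
  obtain ⟨c', hc', e'⟩ := h' u j
  exact ⟨_, hc.add hc', fun ν R z => by
    rw [LinearMap.add_apply, map_add, e, e', map_add, LinearMap.add_apply]⟩

theorem smul {k k' : ℕ} {Q : TensFamily U k k'} (a : ℂ) (h : Q.IsPoly) :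
    TensFamily.IsPoly fun ν R => a • Q ν R := fun u j => by
  obtain ⟨c, hc, e⟩ := h u j
  exact ⟨_, hc.smul a, fun ν R z => by
    rw [LinearMap.smul_apply, map_smul, e, map_smul, LinearMap.smul_apply]⟩

theorem sum {k k' : ℕ} {ι : Type*} (A : Finset ι) {Q : ι → TensFamily U k k'}
    (h : ∀ i, (Q i).IsPoly) : TensFamily.IsPoly fun ν R => ∑ i ∈ A, Q i ν R := by
  classical
  induction A using Finset.induction_on with
  | empty => simpa only [Finset.sum_empty] using zero
  | insert a A ha ih =>
    simp only [Finset.sum_insert ha]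
    exact (h a).add ih

/-- This is matrix multiplication over a basis of U^{⊗k'}, with x_{k'} between the entries as the
composition law of realizations requires. -/
theorem comp {k k' k'' : ℕ} {Q : TensFamily U k k'} {Q' : TensFamily U k' k''} (h : Q.IsPoly)
    (h' : Q'.IsPoly) : TensFamily.IsPoly fun ν R => Q' ν R ∘ₗ Q ν R := fun u j => by
  choose c hc e using fun i => h u i
  choose c' hc' e' using fun i => h' (Module.finBasis ℂ _ i) j
  refine ⟨fun ν => ∑ i, c i ν ≫ injProj ν k' ≫ c' i ν,
    TensorPowers.IsPoly.sum _ fun i _ => (hc i).comp ((isPoly_injProj k').comp (hc' i)),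
    fun ν R z => ?_⟩
  rw [LinearMap.comp_apply, ← sum_tensorCoeff _ (Q ν R (u ⊗ₜ[ℂ] z)), map_sum, map_sum, map_sum,
    LinearMap.sum_apply]
  refine Finset.sum_congr rfl fun i _ => ?_
  rw [e', e, R.ev_comp, LinearMap.comp_apply]

theorem act {k : ℕ} (σ : Equiv.Perm (Fin k)) :
    TensFamily.IsPoly (U := U) fun _ R => R.S.act U σ := by
  have h := map (U := U) (TensorPow.perm σ) (d := fun ν => permDiag ν σ) (isPoly_diag _)
  simp only [Realization.ev_perm] at h
  exact h

theorem avg (k : ℕ) :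
    TensFamily.IsPoly (U := U) fun _ R => (R.S.inv U k).subtype ∘ₗ R.S.avg U k := by
  have h := smul (U := U) ((k.factorial : ℂ)⁻¹) (sum Finset.univ fun σ => act (U := U) (k := k) σ)
  convert h using 3 with ν R
  refine LinearMap.ext fun x => ?_
  rw [LinearMap.smul_apply, LinearMap.sum_apply]
  exact R.S.coe_avg U k x

/-- Each coefficient acts by zero on all the spaces ℂ Inj([k],[n]), so `Realization.ev_eq_zero`
kills it in every realization. -/
theorem eq_zero {k k' : ℕ} {Q : TensFamily U k k'} (h : Q.IsPoly)
    (h0 : ∀ n : ℕ, Q n (Realization.inj n) = 0) {ν : ℂ} (R : Realization ν) : Q ν R = 0 := by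
  refine TensorProduct.ext' fun u z => ?_
  rw [← sum_tensorCoeff _ (Q ν R (u ⊗ₜ[ℂ] z))]
  refine Finset.sum_eq_zero fun j _ => ?_
  obtain ⟨c, hc, e⟩ := h u j
  rw [e, Realization.ev_eq_zero hc (fun n => ?_), LinearMap.zero_apply, TensorProduct.tmul_zero]
  refine LinearMap.ext fun z => ?_
  rw [← e, h0, LinearMap.zero_apply, map_zero, LinearMap.zero_apply]

end TensFamily.IsPoly

/-- Families of linear maps `U^{⊗ k} ⊗ D_k → ⨁ (U^{⊗ k'} ⊗ D_{k'})^{S_{k'}}` that are finite sums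
of families with polynomial coefficients. -/
inductive IsUnivAt {k : ℕ} :
    (∀ (ν : ℂ) (R : Realization ν), R.S.Tens U k →ₗ[ℂ] R.S.Total U) → Prop
  | base {k' : ℕ} (Q : TensFamily U k k') (hQ : Q.IsPoly) : IsUnivAt fun _ R =>
      DirectSum.lof ℂ ℕ (fun k => R.S.inv U k) k' ∘ₗ R.S.avg U k' ∘ₗ Q _ R
  | zero : IsUnivAt fun _ _ => 0
  | add {P P' : ∀ (ν : ℂ) (R : Realization ν), R.S.Tens U k →ₗ[ℂ] R.S.Total U} :
      IsUnivAt P → IsUnivAt P' → IsUnivAt fun ν R => P ν R + P' ν R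

theorem IsUnivAt.comp {k k' : ℕ}
    {P : ∀ (ν : ℂ) (R : Realization ν), R.S.Tens U k' →ₗ[ℂ] R.S.Total U} (h : IsUnivAt P)
    {Q : TensFamily U k k'} (hQ : Q.IsPoly) : IsUnivAt fun ν R => P ν R ∘ₗ Q ν R := by
  induction h with
  | base Q' hQ' => exact IsUnivAt.base _ (hQ.comp hQ')
  | zero =>
    simp only [LinearMap.zero_comp]
    exact IsUnivAt.zero
  | add _ _ ih ih' =>
    simp only [LinearMap.add_comp]
    exact ih.add ih'

/-- Fixing the target degree turns an operator on the infinite sum into a family between two tensor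
degrees, to which the vanishing criterion applies. Summands of other degrees drop out. -/
theorem IsUnivAt.component {k : ℕ}
    {P : ∀ (ν : ℂ) (R : Realization ν), R.S.Tens U k →ₗ[ℂ] R.S.Total U} (h : IsUnivAt P)
    (k' : ℕ) : TensFamily.IsPoly fun ν R => (R.S.inv U k').subtype ∘ₗ
      DirectSum.component ℂ ℕ (fun k => R.S.inv U k) k' ∘ₗ P ν R := by
  induction h with
  | @base k'' Q hQ =>
    rcases eq_or_ne k'' k' with rfl | hk
    · convert hQ.comp (TensFamily.IsPoly.avg k'') using 3 with ν R
      refine LinearMap.ext fun x => ?_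
      simp only [LinearMap.comp_apply, DirectSum.component.lof_self]
    · convert TensFamily.IsPoly.zero (U := U) using 3 with ν R
      refine LinearMap.ext fun x => ?_
      simp only [LinearMap.comp_apply]
      rw [DirectSum.component.of, dif_neg hk, map_zero, LinearMap.zero_apply]
  | zero =>
    simp only [LinearMap.comp_zero]
    exact TensFamily.IsPoly.zero
  | add _ _ ih ih' =>
    simp only [LinearMap.comp_add]
    exact ih.add ih'

variable (U) in
/-- Families of operators on the sums `⨁ (U^{⊗ k} ⊗ D_k)^{S_k}` for all realizations. -/
abbrev OpFamily : Type 1 := ∀ (ν : ℂ) (R : Realization ν), Module.End ℂ (R.S.Total U)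

/-- The family of operators is given by universal formulas. -/
def OpFamily.IsUniv (O : OpFamily U) : Prop :=
  ∀ k, IsUnivAt fun ν R => O ν R ∘ₗ DirectSum.lof ℂ ℕ (fun k => R.S.inv U k) k ∘ₗ R.S.avg U k

namespace OpFamily.IsUniv

theorem add {O O' : OpFamily U} (h : O.IsUniv) (h' : O'.IsUniv) :
    OpFamily.IsUniv fun ν R => O ν R + O' ν R := fun k => (h k).add (h' k)

/-- Each summand of P ends with an average in some degree k', which is exactly where universality of
O is formulated. -/
theorem comp_isUnivAt {O : OpFamily U} (h : O.IsUniv) {k : ℕ}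
    {P : ∀ (ν : ℂ) (R : Realization ν), R.S.Tens U k →ₗ[ℂ] R.S.Total U} (hP : IsUnivAt P) :
    IsUnivAt fun ν R => O ν R ∘ₗ P ν R := by
  induction hP with
  | @base k' Q hQ => exact (h k').comp hQ
  | zero =>
    simp only [LinearMap.comp_zero]
    exact IsUnivAt.zero
  | add _ _ ih ih' =>
    simp only [LinearMap.comp_add]
    exact ih.add ih'

theorem mul {O O' : OpFamily U} (h : O.IsUniv) (h' : O'.IsUniv) :
    OpFamily.IsUniv fun ν R => O ν R * O' ν R := fun k => h.comp_isUnivAt (h' k)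

theorem of_degree {O : OpFamily U} (h : ∀ k, ∃ (k' : ℕ) (Q : TensFamily U k k'), Q.IsPoly ∧
    ∀ (ν : ℂ) (R : Realization ν) (x : R.S.inv U k), ∃ y : R.S.inv U k', Q ν R x = y ∧
      O ν R (DirectSum.lof ℂ ℕ (fun k => R.S.inv U k) k x) =
        DirectSum.lof ℂ ℕ (fun k => R.S.inv U k) k' y) : O.IsUniv := by
  intro k
  obtain ⟨k', Q, hQ, hO⟩ := h k
  convert IsUnivAt.base _ ((TensFamily.IsPoly.avg k).comp hQ) using 3 with ν R
  refine LinearMap.ext fun x => ?_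
  obtain ⟨y, h1, h2⟩ := hO ν R (R.S.avg U k x)
  simp only [LinearMap.comp_apply, Submodule.subtype_apply]
  rw [h1, h2, ResSystem.avg_inv]

/-- Scalars depending on ν must be allowed because id_V acts by ν itself. -/
theorem polySmul (p : Polynomial ℂ) :
    OpFamily.IsUniv (U := U) fun ν R => p.eval ν • (1 : Module.End ℂ (R.S.Total U)) := by
  refine of_degree fun k => ⟨k, _, TensFamily.IsPoly.map LinearMap.id ((isPoly_id k).smul_poly p),
    fun ν R x => ⟨p.eval ν • x, ?_, ?_⟩⟩
  · rw [map_smul, R.ev_id, TensorProduct.map_smul_right, TensorProduct.map_id]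
    rfl
  · rw [map_smul]
    rfl

theorem create (u : U) : OpFamily.IsUniv fun _ R => R.S.create U u := by
  refine of_degree fun k => ⟨k + 1, fun _ R => (1 / ((k : ℂ) + 1)) •
    ∑ l : Fin (k + 1), TensorProduct.map (TensorPow.ins l u) (R.S.resStar l), ?_,
    fun ν R x => ⟨_, ?_, R.S.create_lof U u k x⟩⟩
  · refine TensFamily.IsPoly.smul _ (TensFamily.IsPoly.sum _ fun l => ?_)
    have h := TensFamily.IsPoly.map (TensorPow.ins l u) (d := fun ν => resStarDiag ν l)
      (isPoly_diag _)
    simp only [Realization.ev_resStar] at h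
    exact h
  · rw [ResSystem.coe_createComp, LinearMap.smul_apply, LinearMap.sum_apply]

theorem annih (f : Module.Dual ℂ U) : OpFamily.IsUniv fun _ R => R.S.annih U f := by
  refine of_degree fun k => ?_
  rcases k with _ | k
  -- In degree 0 the operator is zero, so the choice of the target degree 0 is arbitrary.
  · exact ⟨0, _, TensFamily.IsPoly.zero, fun ν R x => ⟨0, rfl, by
      rw [ResSystem.annih_lof_zero, map_zero]⟩⟩
  · refine ⟨k, fun _ R => ∑ l : Fin (k + 1), TensorProduct.map (TensorPow.contr l f) (R.S.res l),
      TensFamily.IsPoly.sum _ fun l => ?_, fun ν R x => ⟨_, ?_, R.S.annih_lof_succ U f k x⟩⟩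
    · have h := TensFamily.IsPoly.map (TensorPow.contr l f) (d := fun ν => resDiag ν l)
        (isPoly_diag _)
      simp only [Realization.ev_res] at h
      exact h
    · rw [ResSystem.coe_annihComp, LinearMap.sum_apply]

theorem diagonal (A : Module.End ℂ U) : OpFamily.IsUniv fun _ R => R.S.diagonal U A := by
  refine of_degree fun k => ⟨k, fun _ R => TensorProduct.map (TensorPow.diagAct k A) LinearMap.id,
    ?_, fun ν R x => ⟨_, (R.S.coe_diagComp U A k x).symm, R.S.diagonal_lof U A k x⟩⟩
  have h := TensFamily.IsPoly.map (TensorPow.diagAct k A) (isPoly_id k)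
  simp only [Realization.ev_id] at h
  exact h

theorem smul {O : OpFamily U} (c : ℂ) (h : O.IsUniv) : OpFamily.IsUniv fun ν R => c • O ν R := by
  have := (polySmul (U := U) (Polynomial.C c)).mul h
  simpa only [Polynomial.eval_C, smul_mul_assoc, one_mul] using this

theorem sub {O O' : OpFamily U} (h : O.IsUniv) (h' : O'.IsUniv) :
    OpFamily.IsUniv fun ν R => O ν R - O' ν R := by
  have e : (fun ν R => O ν R - O' ν R : OpFamily U) = fun ν R => O ν R + (-1 : ℂ) • O' ν R := by
    funext ν R
    refine LinearMap.ext fun x => ?_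
    rw [LinearMap.sub_apply, LinearMap.add_apply, LinearMap.smul_apply, sub_eq_add_neg]
    exact congrArg _ (neg_one_smul ℂ (O' ν R x)).symm
  rw [e]
  exact h.add (h'.smul (-1))

/-- Families of operators given by universal formulas agree in all realizations as soon as they
agree on the sums `⨁ (U^{⊗ k} ⊗ ℂ Inj([k], [n]))^{S_k}` for all `n`. -/
theorem ext {O O' : OpFamily U} (h : O.IsUniv) (h' : O'.IsUniv)
    (hn : ∀ n : ℕ, O n (Realization.inj n) = O' n (Realization.inj n)) {ν : ℂ}
    (R : Realization ν) : O ν R = O' ν R := by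
  rw [← sub_eq_zero]
  refine ResSystem.total_linearMap_ext fun k x => ?_
  refine DFinsupp.ext fun k' => Subtype.ext ?_
  -- The component of the difference from degree k to degree k' is a polynomial family that vanishes
  -- on all systems of injections.
  exact LinearMap.congr_fun (((h.sub h') k).component k' |>.eq_zero (fun n => by
    dsimp only
    rw [hn, sub_self, LinearMap.zero_comp, LinearMap.comp_zero, LinearMap.comp_zero]) R) x

end OpFamily.IsUniv

end Universal

/-! ### The action of `gl(V)` in all realizations -/

/-- The Lie algebra maps into S, so the universal property gives a homomorphism to S; followed by
the inclusion it is the identity by uniqueness. -/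
theorem UniversalEnvelopingAlgebra.mem_of_forall_ι_mem {R L : Type*} [CommRing R] [LieRing L]
    [LieAlgebra R L] (S : Subalgebra R (UniversalEnvelopingAlgebra R L))
    (h : ∀ x, UniversalEnvelopingAlgebra.ι R x ∈ S) (a : UniversalEnvelopingAlgebra R L) :
    a ∈ S := by
  let f : L →ₗ⁅R⁆ S :=
    { toFun := fun x => ⟨UniversalEnvelopingAlgebra.ι R x, h x⟩
      map_add' := fun x y => Subtype.ext (map_add _ x y)
      map_smul' := fun c x => Subtype.ext (map_smul _ c x)
      map_lie' := fun {x y} => Subtype.ext (LieHom.map_lie _ x y) }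
  have e : S.val.comp (UniversalEnvelopingAlgebra.lift R f) = AlgHom.id R _ := by
    apply UniversalEnvelopingAlgebra.hom_ext
    refine LieHom.ext fun x => ?_
    exact congrArg Subtype.val (UniversalEnvelopingAlgebra.lift_ι_apply R f x)
  have := (UniversalEnvelopingAlgebra.lift R f a).2
  have e2 : ((UniversalEnvelopingAlgebra.lift R f a : S) : UniversalEnvelopingAlgebra R L) = a :=
    AlgHom.congr_fun e a
  rwa [e2] at this

/-- The elements whose actions φ intertwines form a subalgebra, so generators suffice. -/
theorem UniversalEnvelopingAlgebra.intertwine {L M M' : Type*} [LieRing L]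
    [LieAlgebra ℂ L] [AddCommGroup M] [Module ℂ M] [AddCommGroup M'] [Module ℂ M']
    (ρ : UniversalEnvelopingAlgebra ℂ L →ₐ[ℂ] Module.End ℂ M)
    (ρ' : UniversalEnvelopingAlgebra ℂ L →ₐ[ℂ] Module.End ℂ M') (φ : M →ₗ[ℂ] M')
    (h : ∀ A x, φ (ρ (UniversalEnvelopingAlgebra.ι ℂ A) x) =
      ρ' (UniversalEnvelopingAlgebra.ι ℂ A) (φ x)) (a : UniversalEnvelopingAlgebra ℂ L) (x : M) :
    φ (ρ a x) = ρ' a (φ x) := by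
  let S : Subalgebra ℂ (UniversalEnvelopingAlgebra ℂ L) :=
    { carrier := {a | ∀ x, φ (ρ a x) = ρ' a (φ x)}
      mul_mem' := fun {a b} ha hb x => by
        rw [map_mul, map_mul, Module.End.mul_apply, Module.End.mul_apply, ha, hb]
      add_mem' := fun {a b} ha hb x => by
        rw [map_add, map_add, LinearMap.add_apply, LinearMap.add_apply, map_add, ha, hb]
      algebraMap_mem' := fun c x => by
        rw [AlgHom.commutes, AlgHom.commutes, Module.algebraMap_end_apply,
          Module.algebraMap_end_apply, map_smul] }
  exact UniversalEnvelopingAlgebra.mem_of_forall_ι_mem S h a x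

namespace Splitting

variable {V : Type} [AddCommGroup V] [Module ℂ V] {one : V} (h1 : one ≠ 0) {U : Submodule ℂ V}
  (hU : IsCompl (ℂ ∙ one) U)

/-- The component of `A` in `U`. -/
noncomputable def lowerPart (A : Module.End ℂ V) : U := proj hU (A one)

/-- The component of `A` in `U^*`. -/
noncomputable def raisePart (A : Module.End ℂ V) : Module.Dual ℂ U :=
  oneDual h1 hU ∘ₗ A ∘ₗ U.subtype

/-- The component of `A` in `gl(U)`. -/
noncomputable def embedPart (A : Module.End ℂ V) : Module.End ℂ U :=
  proj hU ∘ₗ A ∘ₗ U.subtype - oneDual h1 hU (A one) • LinearMap.id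

/-- The id_V-component must account for the coefficient of 𝟙 in A𝟙, and it then also acts on U by
this scalar; hence the subtraction in `embedPart`. The identity is checked on 𝟙 and on U. -/
theorem eq_sum_parts (A : Module.End ℂ V) : A = oneDual h1 hU (A one) • 1 +
    lower h1 hU (lowerPart hU A) + raise hU (raisePart h1 hU A) +
    embed hU (embedPart h1 hU A) := by
  have hone : A one = (oneDual h1 hU (A one) • 1 + lower h1 hU (lowerPart hU A) +
      raise hU (raisePart h1 hU A) + embed hU (embedPart h1 hU A)) one := by
    simp only [LinearMap.add_apply, LinearMap.smul_apply, Module.End.one_apply, lower_one,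
      raise_one, embed_one, add_zero]
    exact (oneDual_smul_add_proj h1 hU (A one)).symm
  have hu : ∀ u : U, A u = (oneDual h1 hU (A one) • 1 + lower h1 hU (lowerPart hU A) +
      raise hU (raisePart h1 hU A) + embed hU (embedPart h1 hU A)) u := by
    intro u
    simp only [LinearMap.add_apply, LinearMap.smul_apply, Module.End.one_apply, lower_coe,
      raise_coe, embed_coe, add_zero, embedPart, raisePart, LinearMap.sub_apply,
      LinearMap.comp_apply, LinearMap.id_apply, Submodule.subtype_apply, Submodule.coe_sub,
      Submodule.coe_smul]
    conv_lhs => rw [← oneDual_smul_add_proj h1 hU (A u)]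
    abel
  refine LinearMap.ext fun v => ?_
  rw [← oneDual_smul_add_proj h1 hU v, map_add, map_add, map_smul, map_smul, ← hone, ← hu]

/-- The operator on `⨁ (U^{⊗ k} ⊗ D_k)^{S_k}` corresponding to an element of `gl(V)`. -/
noncomputable def glOp (S : ResSystem) (c : ℂ) (A : Module.End ℂ V) : Module.End ℂ (S.Total U) :=
  (oneDual h1 hU (A one) * c) • (1 : Module.End ℂ (S.Total U)) + S.create U (lowerPart hU A) +
    S.annih U (raisePart h1 hU A) + S.diagonal U (embedPart h1 hU A)

/-- This supplies both naturality of the operators in Y and compatibility with evaluation at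
elements of the image of Y. -/
theorem map_glOp {S S' : ResSystem} (φ : ResSystem.Hom S S') (c : ℂ) (A : Module.End ℂ V)
    (x : S.Total U) : φ.map U (glOp h1 hU S c A x) = glOp h1 hU S' c A (φ.map U x) := by
  unfold glOp
  simp only [LinearMap.add_apply, map_add, LinearMap.smul_apply, map_smul, φ.map_create,
    φ.map_annih, φ.map_diagonal]
  rfl

theorem diagAct_one (n : ℕ) (x : ⨂[ℂ] _ : Fin n, V) :
    TensorPow.diagAct n (1 : Module.End ℂ V) x = (n : ℂ) • x := by
  refine LinearMap.congr_fun (f := TensorPow.diagAct n (1 : Module.End ℂ V))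
    (g := (n : ℂ) • LinearMap.id) (TensorPow.hom_ext fun v => ?_) x
  rw [SymmetricRep.diagAct_tprod]
  simp only [Module.End.one_apply, Function.update_eq_self, LinearMap.smul_apply,
    LinearMap.id_apply]
  rw [Finset.sum_const, Finset.card_univ, Fintype.card_fin, Nat.cast_smul_eq_nsmul]

/-- The scalar n arises as the diagonal action of id_V on n factors. From here on, relations between
the operators `glOp` for ν = n can be read off on V^{⊗n}. -/
theorem collapse_glOp (n : ℕ) (A : Module.End ℂ V) (x : SymmetricRep.InjSum U n) :
    SymmetricRep.collapse one U n (glOp h1 hU (SymmetricRep.injSystem n) n A x) =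
      TensorPow.diagAct n A (SymmetricRep.collapse one U n x) := by
  conv_rhs => rw [eq_sum_parts h1 hU A]
  simp only [TensorPow.diagAct_add, TensorPow.diagAct_smul, LinearMap.add_apply,
    LinearMap.smul_apply, diagAct_one, smul_smul]
  rw [← SymmetricRep.collapse_create, ← SymmetricRep.collapse_annih hU,
    ← SymmetricRep.collapse_diagonal hU]
  simp only [glOp, LinearMap.add_apply, map_add, LinearMap.smul_apply, map_smul]
  rfl

variable [FiniteDimensional ℂ U]

theorem glOp_isUniv (A : Module.End ℂ V) :
    OpFamily.IsUniv fun ν R => glOp h1 hU R.S ν A := by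
  -- The scalar part of the operator is the value at ν of the linear polynomial 𝟙^*(A𝟙) X.
  have h := ((OpFamily.IsUniv.polySmul (U := U)
    (Polynomial.C (oneDual h1 hU (A one)) * Polynomial.X)).add
    (OpFamily.IsUniv.create (lowerPart hU A))).add
    (OpFamily.IsUniv.annih (raisePart h1 hU A)) |>.add
    (OpFamily.IsUniv.diagonal (embedPart h1 hU A))
  simp only [Polynomial.eval_mul, Polynomial.eval_C, Polynomial.eval_X] at h
  exact h

include h1 hU in
/-- Families of operators given by universal formulas agree in all realizations as soon as they
correspond to the same operators on `V^{⊗ n}` for all `n`. -/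
theorem univ_ext {O O' : OpFamily U} (h : O.IsUniv) (h' : O'.IsUniv)
    (T : ∀ n, (⨂[ℂ] _ : Fin n, V) →ₗ[ℂ] ⨂[ℂ] _ : Fin n, V)
    (hO : ∀ (n : ℕ) (x : SymmetricRep.InjSum U n),
      SymmetricRep.collapse one U n (O n (Realization.inj n) x) =
        T n (SymmetricRep.collapse one U n x))
    (hO' : ∀ (n : ℕ) (x : SymmetricRep.InjSum U n),
      SymmetricRep.collapse one U n (O' n (Realization.inj n) x) =
        T n (SymmetricRep.collapse one U n x)) {ν : ℂ} (R : Realization ν) : O ν R = O' ν R :=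
  h.ext h' (fun n => LinearMap.ext fun x => SymmetricRep.collapse_injective h1 hU
    ((hO n x).trans (hO' n x).symm)) R

theorem glOp_add {ν : ℂ} (R : Realization ν) (A B : Module.End ℂ V) :
    glOp h1 hU R.S ν (A + B) = glOp h1 hU R.S ν A + glOp h1 hU R.S ν B :=
  univ_ext h1 hU (glOp_isUniv h1 hU (A + B)) ((glOp_isUniv h1 hU A).add (glOp_isUniv h1 hU B))
    (fun n => TensorPow.diagAct n (A + B)) (fun n x => collapse_glOp h1 hU n _ x)
    (fun n x => by
      rw [TensorPow.diagAct_add, LinearMap.add_apply, ← collapse_glOp h1 hU n A,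
        ← collapse_glOp h1 hU n B, ← map_add]
      rfl) R

theorem glOp_smul {ν : ℂ} (R : Realization ν) (c : ℂ) (A : Module.End ℂ V) :
    glOp h1 hU R.S ν (c • A) = c • glOp h1 hU R.S ν A :=
  univ_ext h1 hU (glOp_isUniv h1 hU (c • A)) ((glOp_isUniv h1 hU A).smul c)
    (fun n => TensorPow.diagAct n (c • A)) (fun n x => collapse_glOp h1 hU n _ x)
    (fun n x => by
      rw [TensorPow.diagAct_smul, LinearMap.smul_apply, ← collapse_glOp h1 hU n A, ← map_smul]
      rfl) R

/-- Both sides are universal and correspond on every V^{⊗n} to the diagonal action of [A, B], so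
they agree for all ν. No commutator of F_u with E_f has to be evaluated. -/
theorem glOp_lie {ν : ℂ} (R : Realization ν) (A B : Module.End ℂ V) :
    glOp h1 hU R.S ν (A * B - B * A) =
      glOp h1 hU R.S ν A * glOp h1 hU R.S ν B - glOp h1 hU R.S ν B * glOp h1 hU R.S ν A :=
  univ_ext h1 hU (glOp_isUniv h1 hU (A * B - B * A))
    (((glOp_isUniv h1 hU A).mul (glOp_isUniv h1 hU B)).sub
      ((glOp_isUniv h1 hU B).mul (glOp_isUniv h1 hU A)))
    (fun n => TensorPow.diagAct n (A * B - B * A)) (fun n x => collapse_glOp h1 hU n _ x)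
    (fun n x => by
      rw [← TensorPow.diagAct_comp_sub, LinearMap.sub_apply, LinearMap.comp_apply,
        LinearMap.comp_apply, ← collapse_glOp h1 hU n A, ← collapse_glOp h1 hU n B,
        ← collapse_glOp h1 hU n A, ← collapse_glOp h1 hU n B, ← map_sub]
      rfl) R

theorem glOp_one {ν : ℂ} (R : Realization ν) :
    glOp h1 hU R.S ν 1 = ν • (1 : Module.End ℂ (R.S.Total U)) := by
  have h := OpFamily.IsUniv.polySmul (U := U) Polynomial.X
  simp only [Polynomial.eval_X] at h
  refine univ_ext h1 hU (glOp_isUniv h1 hU 1) h (fun n => TensorPow.diagAct n 1)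
    (fun n x => collapse_glOp h1 hU n _ x) (fun n x => ?_) R
  rw [diagAct_one, ← map_smul]
  rfl

theorem glOp_lower {ν : ℂ} (R : Realization ν) (u : U) :
    glOp h1 hU R.S ν (lower h1 hU u) = R.S.create U u :=
  univ_ext h1 hU (glOp_isUniv h1 hU _) (OpFamily.IsUniv.create u)
    (fun n => TensorPow.diagAct n (lower h1 hU u)) (fun n x => collapse_glOp h1 hU n _ x)
    (fun _ x => SymmetricRep.collapse_create h1 hU u x) R

theorem glOp_raise {ν : ℂ} (R : Realization ν) (f : Module.Dual ℂ U) :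
    glOp h1 hU R.S ν (raise hU f) = R.S.annih U f :=
  univ_ext h1 hU (glOp_isUniv h1 hU _) (OpFamily.IsUniv.annih f)
    (fun n => TensorPow.diagAct n (raise hU f)) (fun n x => collapse_glOp h1 hU n _ x)
    (fun _ x => SymmetricRep.collapse_annih hU f x) R

theorem glOp_embed {ν : ℂ} (R : Realization ν) (A : Module.End ℂ U) :
    glOp h1 hU R.S ν (embed hU A) = R.S.diagonal U A :=
  univ_ext h1 hU (glOp_isUniv h1 hU _) (OpFamily.IsUniv.diagonal A)
    (fun n => TensorPow.diagAct n (embed hU A)) (fun n x => collapse_glOp h1 hU n _ x)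
    (fun _ x => SymmetricRep.collapse_diagonal hU A x) R

/-- The Lie algebra homomorphism from `gl(V)` to the operators of a realization. -/
noncomputable def glHom {ν : ℂ} (R : Realization ν) :
    Module.End ℂ V →ₗ⁅ℂ⁆ Module.End ℂ (R.S.Total U) where
  toFun A := glOp h1 hU R.S ν A
  map_add' A B := glOp_add h1 hU R A B
  map_smul' c A := glOp_smul h1 hU R c A
  map_lie' {A B} := glOp_lie h1 hU R A B

/-- The action of `U(gl(V))` in a realization. -/
noncomputable def realizationAction {ν : ℂ} (R : Realization ν) :
    UGL V →ₐ[ℂ] Module.End ℂ (R.S.Total U) :=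
  UniversalEnvelopingAlgebra.lift ℂ (glHom h1 hU R)

theorem realizationAction_ι {ν : ℂ} (R : Realization ν) (A : Module.End ℂ V) :
    realizationAction h1 hU R (UniversalEnvelopingAlgebra.ι ℂ A) = glOp h1 hU R.S ν A :=
  UniversalEnvelopingAlgebra.lift_ι_apply ℂ _ A

theorem realizationAction_isGivenBy {ν : ℂ} (R : Realization ν) :
    IsGivenBy h1 hU (realizationAction h1 hU R) ν (R.S.create U) (R.S.annih U)
      (R.S.diagonal U) where
  map_id := by
    rw [realizationAction_ι, glOp_one, Algebra.algebraMap_eq_smul_one]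
  map_lower u := by rw [realizationAction_ι, glOp_lower]
  map_raise f := by rw [realizationAction_ι, glOp_raise]
  map_embed A := by rw [realizationAction_ι, glOp_embed]

theorem collapse_realizationAction (n : ℕ) (a : UGL V) (x : SymmetricRep.InjSum U n) :
    SymmetricRep.collapse one U n (realizationAction h1 hU (Realization.inj n) a x) =
      tensorAction V n a (SymmetricRep.collapse one U n x) := by
  refine UniversalEnvelopingAlgebra.intertwine (realizationAction h1 hU (Realization.inj n))
    (tensorAction V n) (SymmetricRep.collapse one U n) (fun A x => ?_) a x
  rw [realizationAction_ι, tensorAction, UniversalEnvelopingAlgebra.lift_ι_apply]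
  exact collapse_glOp h1 hU n A x

/-! #### The action on the complex tensor power -/

/-- The endomorphism of the complex tensor power corresponding to an element of `gl(V)`. -/
noncomputable def indOp (ν : ℂ) (A : Module.End ℂ V) : End (Deligne.tensorPower ν U) :=
  ObjectProperty.homMk
    { app := fun Y => ModuleCat.ofHom (glOp h1 hU (Realization.hom ν Y.unop).S ν A)
      naturality := fun Y Z f => by
        ext x
        exact (map_glOp h1 hU ((Deligne.deltaSystem ν).homMap f.unop) ν A x).symm }

theorem ind_hom_ext {ν : ℂ} {α β : End (Deligne.tensorPower ν U)}
    (h : ∀ Y : (Deligne ν)ᵒᵖ, α.hom.app Y = β.hom.app Y) : α = β :=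
  ObjectProperty.hom_ext _ (NatTrans.ext (funext h))

/-- The action of the endomorphisms of the complex tensor power on its sections. -/
noncomputable def sectionAction (ν : ℂ) (U : Type) [AddCommGroup U] [Module ℂ U]
    [FiniteDimensional ℂ U] (Y : Deligne ν) :
    End (Deligne.tensorPower ν U) →ₐ[ℂ] Module.End ℂ ((Realization.hom ν Y).S.Total U) :=
  AlgHom.ofLinearMap
    { toFun := fun α => (α.hom.app (Opposite.op Y)).hom
      map_add' := fun _ _ => rfl
      map_smul' := fun _ _ => rfl } rfl fun _ _ => rfl

/-- An endomorphism of the Ind-object is a natural transformation, determined by its action on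
sections over each Y; these sections form the realization Hom(Y, Δ_k). -/
theorem indOp_eq {ν : ℂ} {A : Module.End ℂ V} {β : End (Deligne.tensorPower ν U)}
    (h : ∀ Y, glOp h1 hU (Realization.hom ν Y).S ν A = sectionAction ν U Y β) :
    indOp h1 hU ν A = β :=
  ind_hom_ext fun Y => ModuleCat.hom_ext (h Y.unop)

/-- The Lie algebra homomorphism from `gl(V)` to the endomorphisms of the complex tensor power. -/
noncomputable def indHom (ν : ℂ) : Module.End ℂ V →ₗ⁅ℂ⁆ End (Deligne.tensorPower ν U) where
  toFun A := indOp h1 hU ν A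
  map_add' A B := indOp_eq h1 hU fun Y => glOp_add h1 hU (Realization.hom ν Y) A B
  map_smul' c A := indOp_eq h1 hU fun Y => glOp_smul h1 hU (Realization.hom ν Y) c A
  map_lie' {A B} := indOp_eq h1 hU fun Y => glOp_lie h1 hU (Realization.hom ν Y) A B

/-- The action of `U(gl(V))` on the complex tensor power. -/
noncomputable def indAction (ν : ℂ) : UGL V →ₐ[ℂ] End (Deligne.tensorPower ν U) :=
  UniversalEnvelopingAlgebra.lift ℂ (indHom h1 hU ν)

theorem indAction_ι (ν : ℂ) (A : Module.End ℂ V) :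
    indAction h1 hU ν (UniversalEnvelopingAlgebra.ι ℂ A) = indOp h1 hU ν A :=
  UniversalEnvelopingAlgebra.lift_ι_apply ℂ _ A

theorem indAction_isGivenBy (ν : ℂ) :
    IsGivenBy h1 hU (indAction h1 hU ν) ν ((Deligne.deltaSystem ν).create U)
      ((Deligne.deltaSystem ν).annih U) ((Deligne.deltaSystem ν).diagonal U) where
  map_id := by
    rw [indAction_ι]
    refine indOp_eq h1 hU fun Y => ?_
    rw [glOp_one, AlgHom.commutes, Algebra.algebraMap_eq_smul_one]
  map_lower u := by
    rw [indAction_ι]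
    exact indOp_eq h1 hU fun Y => glOp_lower h1 hU (Realization.hom ν Y) u
  map_raise f := by
    rw [indAction_ι]
    exact indOp_eq h1 hU fun Y => glOp_raise h1 hU (Realization.hom ν Y) f
  map_embed A := by
    rw [indAction_ι]
    exact indOp_eq h1 hU fun Y => glOp_embed h1 hU (Realization.hom ν Y) A

theorem sectionAction_indAction (ν : ℂ) (Y : Deligne ν) (a : UGL V)
    (x : (Realization.hom ν Y).S.Total U) :
    sectionAction ν U Y (indAction h1 hU ν a) x =
      realizationAction h1 hU (Realization.hom ν Y) a x := by
  refine UniversalEnvelopingAlgebra.intertwine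
    ((sectionAction ν U Y).comp (indAction h1 hU ν)) (realizationAction h1 hU (Realization.hom ν Y))
    LinearMap.id (fun A x => ?_) a x
  rw [realizationAction_ι, AlgHom.comp_apply, indAction_ι]
  rfl

end Splitting

/-! ### The images of the objects `Δ_k` -/

section RetractTransport

variable {A B E : Type 1} [Category.{0} A] [Category.{0} B] [Category.{0} E] {G : A ⥤ B}
  {F : B ⥤ E} {T : A ⥤ E}

theorem CategoryTheory.Iso.map_retract_comp (e : G ⋙ F ≅ T) {a : A} {b : B} (i : b ⟶ G.obj a)
    (p : G.obj a ⟶ b) (h : i ≫ p = 𝟙 b) :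
    (F.map i ≫ e.hom.app a) ≫ e.inv.app a ≫ F.map p = 𝟙 (F.obj b) := by
  have := F.map_comp i p
  rw [h, F.map_id] at this
  rw [Category.assoc, Iso.hom_inv_id_app_assoc, this]

/-- A morphism between retracts of G a and G a' is computed, after F, by the morphism T g between
the ambient objects; only naturality of e enters. -/
theorem CategoryTheory.Iso.map_sandwich (e : G ⋙ F ≅ T) {a a' : A} {b b' : B} (p : G.obj a ⟶ b)
    (f : b ⟶ b') (i : b' ⟶ G.obj a') (g : a ⟶ a') (h : p ≫ f ≫ i = G.map g) :
    (e.inv.app a ≫ F.map p) ≫ F.map f ≫ F.map i ≫ e.hom.app a' = T.map g := by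
  have h1 := e.hom.naturality g
  rw [← cancel_epi (e.hom.app a), ← h1, Functor.comp_map, ← h, F.map_comp, F.map_comp]
  simp only [Category.assoc, Iso.hom_inv_id_app_assoc]

end RetractTransport

namespace Deligne

open TensorPowers

/-- The objects `𝔥^{⊗ r}` of the Deligne category. -/
noncomputable abbrev tensorPowersEmbedding (ν : ℂ) : TensorPowers ν ⥤ Deligne ν :=
  Mat_.embedding (TensorPowers ν) ⋙ toKaroubi _

/-- The inclusion of `Δ_k` into `𝔥^{⊗ k}`. -/
noncomputable def deltaι (ν : ℂ) (k : ℕ) : Delta ν k ⟶ (tensorPowersEmbedding ν).obj ⟨k⟩ :=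
  Karoubi.decompId_i (Delta ν k)

/-- The projection of `𝔥^{⊗ k}` onto `Δ_k`. -/
noncomputable def deltaπ (ν : ℂ) (k : ℕ) : (tensorPowersEmbedding ν).obj ⟨k⟩ ⟶ Delta ν k :=
  Karoubi.decompId_p (Delta ν k)

theorem deltaι_deltaπ (ν : ℂ) (k : ℕ) : deltaι ν k ≫ deltaπ ν k = 𝟙 _ :=
  (Karoubi.decompId (Delta ν k)).symm

/-- Between objects with trivial idempotent, a morphism of the Karoubi envelope is its underlying
morphism, and that of `deltaMap f` already absorbs x_r and x_s. -/
theorem deltaπ_deltaMap_deltaι {ν : ℂ} {r s : ℕ} (f : (⟨r⟩ : TensorPowers ν) ⟶ ⟨s⟩) :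
    deltaπ ν r ≫ deltaMap f ≫ deltaι ν s =
      (tensorPowersEmbedding ν).map (injProj ν r ≫ f ≫ injProj ν s) :=
  Karoubi.hom_ext_iff.2 ((Category.assoc _ _ _).symm.trans ((congrArg (fun x => x ≫ _)
    (Karoubi.p_comp (Deligne.deltaMap f))).trans (Karoubi.comp_p (Deligne.deltaMap f))))

end Deligne

namespace SymmetricRep

open TensorPowers

/-- The extension to Karoubi envelopes acts on underlying morphisms by an additive functor, and the
inverse of the equivalence with the Karoubi envelope is additive. -/
instance (n : ℕ) : (deligneFunctor n).Additive := by
  have h : ((functorExtension₂ (Mat_ (TensorPowers (n : ℂ))) (Rep.{0} ℂ (Equiv.Perm (Fin n)))).obj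
      (Mat_.lift (tensorPowersFunctor n))).Additive :=
    ⟨fun {X Y f g} => Karoubi.hom_ext_iff.2 ((Mat_.lift (tensorPowersFunctor n)).map_add)⟩
  have h2 : (toKaroubiEquivalence (Rep.{0} ℂ (Equiv.Perm (Fin n)))).inverse.Additive :=
    inferInstance
  exact inferInstanceAs (Functor.Additive (_ ⋙ _))

/-- The functor `S_n` on the objects `𝔥^{⊗ r}`. -/
noncomputable def deligneFunctorIso (n : ℕ) :
    Deligne.tensorPowersEmbedding n ⋙ deligneFunctor n ≅ tensorPowersFunctor n :=
  Functor.isoWhiskerLeft (Mat_.embedding _)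
    (Functor.isoWhiskerRight
      ((functorExtension₂CompWhiskeringLeftToKaroubiIso _ _).app
        (Mat_.lift (tensorPowersFunctor n))) (toKaroubiEquivalence _).inverse ≪≫
      Functor.isoWhiskerLeft (Mat_.lift (tensorPowersFunctor n))
        (toKaroubiEquivalence _).unitIso.symm) ≪≫
    Mat_.embeddingLiftIso (tensorPowersFunctor n)

/-- The inclusion of the image of `Δ_k` into `ℂ Fun([k], [n])`. -/
noncomputable def deltaIncl (n k : ℕ) :
    (deligneFunctor n).obj (Deligne.Delta n k) ⟶ (tensorPowersFunctor n).obj ⟨k⟩ :=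
  (deligneFunctor n).map (Deligne.deltaι n k) ≫ (deligneFunctorIso n).hom.app ⟨k⟩

/-- The projection of `ℂ Fun([k], [n])` onto the image of `Δ_k`. -/
noncomputable def deltaProj (n k : ℕ) :
    (tensorPowersFunctor n).obj ⟨k⟩ ⟶ (deligneFunctor n).obj (Deligne.Delta n k) :=
  (deligneFunctorIso n).inv.app ⟨k⟩ ≫ (deligneFunctor n).map (Deligne.deltaπ n k)

variable {n : ℕ}

theorem deltaIncl_deltaProj (k : ℕ) : deltaIncl n k ≫ deltaProj n k = 𝟙 _ :=
  (deligneFunctorIso n).map_retract_comp _ _ (Deligne.deltaι_deltaπ n k)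

theorem deltaProj_map_deltaIncl {r s : ℕ} (f : (⟨r⟩ : TensorPowers (n : ℂ)) ⟶ ⟨s⟩) :
    deltaProj n r ≫ (deligneFunctor n).map (Deligne.deltaMap f) ≫ deltaIncl n s =
      (tensorPowersFunctor n).map (injProj n r ≫ f ≫ injProj n s) :=
  (deligneFunctorIso n).map_sandwich _ _ _ _ (Deligne.deltaπ_deltaMap_deltaι f)

theorem deltaProj_map_deltaIncl_apply {r s : ℕ} (f : (⟨r⟩ : TensorPowers (n : ℂ)) ⟶ ⟨s⟩)
    (x : (Fin r → Fin n) →₀ ℂ) :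
    (deltaIncl n s).hom (((deligneFunctor n).map (Deligne.deltaMap f)).hom
      ((deltaProj n r).hom x)) = inclInj n s (injEv n f (toInj n r x)) := by
  have h := congrArg (fun φ => φ.hom x) (deltaProj_map_deltaIncl f)
  refine Eq.trans h ((tensorPowersFunctor_map_hom n _ x).trans ?_)
  rw [repMap_comp, repMap_comp, repMap_injProj, repMap_injProj]
  rfl

theorem toInj_inclInj (k : ℕ) (x : InjSpace n k) : toInj n k (inclInj n k x) = x :=
  LinearMap.congr_fun (toInj_comp_inclInj k) x

theorem deltaProj_deltaIncl_apply (k : ℕ) (x : (Fin k → Fin n) →₀ ℂ) :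
    (deltaIncl n k).hom ((deltaProj n k).hom x) = inclInj n k (toInj n k x) := by
  have h := deltaProj_map_deltaIncl_apply (n := n) (𝟙 (⟨k⟩ : TensorPowers (n : ℂ))) x
  rw [Deligne.deltaMap_id, CategoryTheory.Functor.map_id, injEv_id] at h
  exact h

theorem deltaIncl_deltaProj_apply (k : ℕ) (y : (deligneFunctor n).obj (Deligne.Delta n k)) :
    (deltaProj n k).hom ((deltaIncl n k).hom y) = y :=
  congrArg (fun φ => φ.hom y) (deltaIncl_deltaProj (n := n) k)

/-- The image of `Δ_k` is the space `ℂ Inj([k], [n])`. -/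
noncomputable def deltaEquiv (n k : ℕ) :
    (deligneFunctor n).obj (Deligne.Delta n k) ≃ₗ[ℂ] InjSpace n k :=
  LinearEquiv.ofLinearMap (toInj n k ∘ₗ (deltaIncl n k).hom.toLinearMap)
    ((deltaProj n k).hom.toLinearMap ∘ₗ inclInj n k)
    (LinearMap.ext fun x => (congrArg (toInj n k) (deltaProj_deltaIncl_apply k _)).trans
      ((toInj_inclInj k _).trans (toInj_inclInj k x)))
    (LinearMap.ext fun x => by
      have h := deltaProj_deltaIncl_apply k ((deltaIncl n k).hom x)
      rw [deltaIncl_deltaProj_apply] at h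
      exact (congrArg (deltaProj n k).hom h.symm).trans (deltaIncl_deltaProj_apply k x))

/-- Applied to the diagrams of σ, res_l and res_l^*, this identifies the images of the structure
maps of Δ_k with those of ℂ Inj([k],[n]). -/
theorem deltaEquiv_deltaMap {r s : ℕ} (f : (⟨r⟩ : TensorPowers (n : ℂ)) ⟶ ⟨s⟩)
    (y : (deligneFunctor n).obj (Deligne.Delta n r)) :
    deltaEquiv n s (((deligneFunctor n).map (Deligne.deltaMap f)).hom y) =
      injEv n f (deltaEquiv n r y) := by
  have h := deltaProj_map_deltaIncl_apply f ((deltaIncl n r).hom y)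
  rw [deltaIncl_deltaProj_apply] at h
  exact (congrArg (toInj n s) h).trans (toInj_inclInj s _)

theorem toInj_funRep (k : ℕ) (g : Equiv.Perm (Fin n)) (x : (Fin k → Fin n) →₀ ℂ) :
    toInj n k (funRep n k g x) = injPost k g (toInj n k x) := by
  refine LinearMap.congr_fun (f := toInj n k ∘ₗ funRep n k g) (g := injPost k g ∘ₗ toInj n k)
    (Finsupp.lhom_ext' fun f => LinearMap.ext_ring ?_) x
  change toInj n k (funRep n k g (Finsupp.single f 1)) = injPost k g (toInj n k (Finsupp.single f 1))
  rw [funRep_single]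
  by_cases hf : Function.Injective f
  · have h1 := toInj_single (n := n) (k := k) ⟨f, hf⟩
    have h2 := toInj_single (n := n) (k := k) ((⟨f, hf⟩ : Fin k ↪ Fin n).trans g.toEmbedding)
    exact h2.trans ((congrArg (injPost k g) h1).trans (injPost_single g _)).symm
  · rw [toInj_single_of_not hf, map_zero, toInj_single_of_not]
    exact fun h => hf (Function.Injective.of_comp h)

theorem deltaEquiv_rho (k : ℕ) (g : Equiv.Perm (Fin n))
    (y : (deligneFunctor n).obj (Deligne.Delta n k)) :
    deltaEquiv n k (((deligneFunctor n).obj (Deligne.Delta n k)).ρ g y) =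
      injPost k g (deltaEquiv n k y) := by
  have h := Rep.hom_comm_apply (deltaIncl n k) g y
  exact (congrArg (toInj n k) h).trans (toInj_funRep k g _)

end SymmetricRep

/-! ### Sections of an Ind-object as morphisms from representable objects -/

namespace IndLin

variable {C : Type 1} [Category.{0} C] [Preadditive C] [Linear ℂ C] (P : IndLin C)

/-- The presheaf of sets underlying a linear Ind-object. -/
noncomputable def toPresheaf : ObjectProperty.FullSubcategory (IsIndObject (C := C)) :=
  ⟨P.obj ⋙ CategoryTheory.forget (ModuleCat.{0} ℂ), P.property.2.2⟩

/-- The representable presheaves as Ind-objects. -/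
noncomputable abbrev yonedaFull : C ⥤ ObjectProperty.FullSubcategory (IsIndObject (C := C)) :=
  ObjectProperty.lift IsIndObject CategoryTheory.yoneda isIndObject_yoneda

/-- The section of an Ind-object given by a morphism from a representable one. -/
noncomputable def sectionOf {Y : C} (m : Ind.yoneda.obj Y ⟶ (IndLin.toInd C).obj P) :
    P.obj.obj (Opposite.op Y) :=
  yonedaEquiv ((Ind.equivalence C).inverse.preimage
    (X := yonedaFull.obj Y) (Y := P.toPresheaf) m).hom

/-- The morphism from a representable Ind-object given by a section. -/
noncomputable def homOf {Y : C} (p : P.obj.obj (Opposite.op Y)) :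
    Ind.yoneda.obj Y ⟶ (IndLin.toInd C).obj P :=
  (Ind.equivalence C).inverse.map (X := yonedaFull.obj Y) (Y := P.toPresheaf)
    (ObjectProperty.homMk ((yonedaEquiv (X := Y) (F := P.toPresheaf.obj)).symm p))

theorem sectionOf_homOf {Y : C} (p : P.obj.obj (Opposite.op Y)) :
    P.sectionOf (P.homOf p) = p := by
  unfold sectionOf homOf
  rw [Functor.preimage_map]
  exact (yonedaEquiv (X := Y) (F := P.toPresheaf.obj)).apply_symm_apply p

theorem homOf_sectionOf {Y : C} (m : Ind.yoneda.obj Y ⟶ (IndLin.toInd C).obj P) :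
    P.homOf (P.sectionOf m) = m := by
  unfold sectionOf homOf
  rw [Equiv.symm_apply_apply]
  exact Functor.map_preimage _ _

theorem yoneda_map_homOf {Y Z : C} (f : Z ⟶ Y) (p : P.obj.obj (Opposite.op Y)) :
    Ind.yoneda.map f ≫ P.homOf p = P.homOf (P.obj.map f.op p) := by
  refine ((Ind.equivalence C).inverse.map_comp (X := yonedaFull.obj Z) (Y := yonedaFull.obj Y)
    (Z := P.toPresheaf) (yonedaFull.map f) _).symm.trans ?_
  refine congrArg ((Ind.equivalence C).inverse.map (X := yonedaFull.obj Z)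
    (Y := P.toPresheaf)) ?_
  refine ObjectProperty.hom_ext _ ?_
  exact (yonedaEquiv_symm_naturality_left f P.toPresheaf.obj p)

theorem homOf_toInd_map {P' : IndLin C} (α : P ⟶ P') {Y : C} (p : P.obj.obj (Opposite.op Y)) :
    P.homOf p ≫ (IndLin.toInd C).map α = P'.homOf (α.hom.app (Opposite.op Y) p) := by
  refine ((Ind.equivalence C).inverse.map_comp (X := yonedaFull.obj Y) (Y := P.toPresheaf)
    (Z := P'.toPresheaf) _ _).symm.trans ?_
  refine congrArg ((Ind.equivalence C).inverse.map (X := yonedaFull.obj Y)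
    (Y := P'.toPresheaf)) ?_
  refine ObjectProperty.hom_ext _ ?_
  exact yonedaEquiv_symm_naturality_right Y
    (Functor.whiskerRight α.hom (CategoryTheory.forget (ModuleCat.{0} ℂ))) p

/-- The object of the category of representables over an Ind-object given by a section. -/
noncomputable def arrow {Y : C} (p : P.obj.obj (Opposite.op Y)) :
    CostructuredArrow Ind.yoneda ((IndLin.toInd C).obj P) := CostructuredArrow.mk (P.homOf p)

/-- By the Yoneda lemma the index category of the colimit is the category of sections, so cocones
are described by one leg per section. -/
theorem eq_arrow (X : CostructuredArrow Ind.yoneda ((IndLin.toInd C).obj P)) :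
    X = P.arrow (P.sectionOf X.hom) :=
  (CostructuredArrow.eq_mk X).trans (congrArg CostructuredArrow.mk (P.homOf_sectionOf X.hom).symm)

theorem map_sectionOf {X X' : CostructuredArrow Ind.yoneda ((IndLin.toInd C).obj P)}
    (f : X ⟶ X') : P.obj.map f.left.op (P.sectionOf X'.hom) = P.sectionOf X.hom := by
  have h := P.yoneda_map_homOf f.left (P.sectionOf X'.hom)
  rw [homOf_sectionOf] at h
  have h2 := congrArg P.sectionOf (h.symm.trans (CostructuredArrow.w f))
  rwa [sectionOf_homOf] at h2

/-- The morphism over an Ind-object given by restriction of a section. -/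
noncomputable def arrowMap {Y Z : C} (f : Z ⟶ Y) (p : P.obj.obj (Opposite.op Y)) :
    P.arrow (P.obj.map f.op p) ⟶ P.arrow p :=
  CostructuredArrow.homMk f (P.yoneda_map_homOf f p)

end IndLin

/-! ### Evaluation of sections of the complex tensor power -/

namespace SymmetricRep

open TensorPowers

variable {n : ℕ}

theorem deligneFunctor_map_comp_apply {X Y Z : Deligne (n : ℂ)} (f : X ⟶ Y) (g : Y ⟶ Z)
    (y : (deligneFunctor n).obj X) : ((deligneFunctor n).map (f ≫ g)).hom y =
      ((deligneFunctor n).map g).hom (((deligneFunctor n).map f).hom y) :=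
  congrArg (fun φ => φ.hom y) ((deligneFunctor n).map_comp f g)

theorem deligneFunctor_map_add_apply {X Y : Deligne (n : ℂ)} (f g : X ⟶ Y)
    (y : (deligneFunctor n).obj X) : ((deligneFunctor n).map (f + g)).hom y =
      ((deligneFunctor n).map f).hom y + ((deligneFunctor n).map g).hom y :=
  congrArg (fun φ => φ.hom y) ((deligneFunctor n).map_add (f := f) (g := g))

theorem deltaEquiv_map_smul {Y : Deligne (n : ℂ)} {k : ℕ} (c : ℂ) (h : Y ⟶ Deligne.Delta n k)
    (y : (deligneFunctor n).obj Y) :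
    deltaEquiv n k (((deligneFunctor n).map (c • h)).hom y) =
      c • deltaEquiv n k (((deligneFunctor n).map h).hom y) := by
  -- Moving the scalar into an endomorphism of Δ_k reduces ℂ-linearity to that of `injEv`, using
  -- only functoriality.
  have e : c • h = h ≫ Deligne.deltaMap (c • 𝟙 (⟨k⟩ : TensorPowers (n : ℂ))) := by
    rw [Deligne.deltaMap_smul, Deligne.deltaMap_id, Linear.comp_smul, Category.comp_id]
  rw [e, deligneFunctor_map_comp_apply, deltaEquiv_deltaMap, map_smul, injEv_id]
  rfl

/-- The maps `Hom(Y, Δ_k) → ℂ Inj([k], [n])` given by an element of the image of `Y`. -/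
noncomputable def evalHom {Y : Deligne (n : ℂ)} (y : (deligneFunctor n).obj Y) :
    ResSystem.Hom ((Deligne.deltaSystem (n : ℂ)).homSystem Y) (injSystem n) where
  app k :=
    { toFun := fun h => deltaEquiv n k (((deligneFunctor n).map h).hom y)
      map_add' := fun f g => (congrArg (deltaEquiv n k)
        (deligneFunctor_map_add_apply (X := Y) (Y := Deligne.Delta n k) f g y)).trans (map_add _ _ _)
      map_smul' := fun c f => deltaEquiv_map_smul (Y := Y) (k := k) c f y }
  perm_app {k} σ := LinearMap.ext fun h =>
    ((congrArg (deltaEquiv n k) (deligneFunctor_map_comp_apply (X := Y) (Y := Deligne.Delta n k) h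
      (Deligne.deltaMap (permDiag n σ)) y)).trans ((deltaEquiv_deltaMap _ _).trans
        (LinearMap.congr_fun (injEv_permDiag σ) _))).symm
  res_app {k} l := LinearMap.ext fun h =>
    ((congrArg (deltaEquiv n k) (deligneFunctor_map_comp_apply (X := Y)
      (Y := Deligne.Delta n (k + 1)) h
      (Deligne.deltaMap (resDiag n l)) y)).trans ((deltaEquiv_deltaMap _ _).trans
        (LinearMap.congr_fun (injEv_resDiag l) _))).symm
  resStar_app {k} l := LinearMap.ext fun h =>
    ((congrArg (deltaEquiv n (k + 1)) (deligneFunctor_map_comp_apply (X := Y)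
      (Y := Deligne.Delta n k) h
      (Deligne.deltaMap (resStarDiag n l)) y)).trans ((deltaEquiv_deltaMap _ _).trans
        (LinearMap.congr_fun (injEv_resStarDiag l) _))).symm

variable (U : Type) [AddCommGroup U] [Module ℂ U]

/-- The element `e_{S_k} (b ⊗ h)` of `⨁ (U^{⊗ k} ⊗ Hom(Y, Δ_k))^{S_k}`. -/
noncomputable def sectionOfHom {Y : Deligne (n : ℂ)} {k : ℕ} (b : ⨂[ℂ] _ : Fin k, U)
    (h : Y ⟶ Deligne.Delta n k) : ((Deligne.deltaSystem (n : ℂ)).homSystem Y).Total U :=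
  DirectSum.lof ℂ ℕ (fun k => ((Deligne.deltaSystem (n : ℂ)).homSystem Y).inv U k) k
    (((Deligne.deltaSystem (n : ℂ)).homSystem Y).avg U k
      (b ⊗ₜ[ℂ] (Deligne.deltaSystem (n : ℂ)).toD h))

/-- The element `e_{S_k} (b ⊗ z)` of `⨁ (U^{⊗ k} ⊗ ℂ Inj([k], [n]))^{S_k}`. -/
noncomputable def injSection {k : ℕ} (b : ⨂[ℂ] _ : Fin k, U) (z : InjSpace n k) : InjSum U n :=
  DirectSum.lof ℂ ℕ (fun k => (injSystem n).inv U k) k ((injSystem n).avg U k (b ⊗ₜ[ℂ] z))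

/-- The map from the image of `Y` to `⨁ (U^{⊗ k} ⊗ ℂ Inj([k], [n]))^{S_k}` given by an element of
`⨁ (U^{⊗ k} ⊗ Hom(Y, Δ_k))^{S_k}`. -/
noncomputable def evalSection {Y : Deligne (n : ℂ)}
    (p : ((Deligne.deltaSystem (n : ℂ)).homSystem Y).Total U) :
    (deligneFunctor n).obj Y ⟶ Rep.of (injSumRep U n) :=
  Rep.ofHom
    ⟨{ toFun := fun y => (evalHom y).map U p
       map_add' := fun y y' => LinearMap.congr_fun (ResSystem.Hom.map_eq_add (evalHom y)
        (evalHom y') (evalHom (y + y')) fun k => LinearMap.ext fun _ =>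
          (congrArg (deltaEquiv n k) (map_add _ _ _)).trans (map_add _ _ _)) p
       map_smul' := fun c y => LinearMap.congr_fun (ResSystem.Hom.map_eq_smul c (evalHom y)
        (evalHom (c • y)) fun k => LinearMap.ext fun _ =>
          (congrArg (deltaEquiv n k) (map_smul _ _ _)).trans (map_smul _ _ _)) p },
      fun g => LinearMap.ext fun y => LinearMap.congr_fun (ResSystem.Hom.map_eq_comp (evalHom y)
        (injMap n g) (evalHom (((deligneFunctor n).obj Y).ρ g y)) fun k => LinearMap.ext fun h =>
          (congrArg (deltaEquiv n k) (Rep.hom_comm_apply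
            ((deligneFunctor n).map (Y := Deligne.Delta n k) h) g y)).trans
            (deltaEquiv_rho k g _)) p⟩

theorem evalSection_apply {Y : Deligne (n : ℂ)}
    (p : ((Deligne.deltaSystem (n : ℂ)).homSystem Y).Total U) (y : (deligneFunctor n).obj Y) :
    (evalSection U p).hom y = (evalHom y).map U p := rfl

/-- This is the cocone condition: evaluating a restricted section at y is evaluating the section at
the image of y. -/
theorem map_evalSection {Y Z : Deligne (n : ℂ)} (f : Z ⟶ Y)
    (p : ((Deligne.deltaSystem (n : ℂ)).homSystem Y).Total U) :
    (deligneFunctor n).map f ≫ evalSection U p =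
      evalSection U (((Deligne.deltaSystem (n : ℂ)).homMap f).map U p) := by
  apply Rep.hom_ext
  apply Representation.IntertwiningMap.ext
  refine LinearMap.ext fun y => ?_
  exact LinearMap.congr_fun (ResSystem.Hom.map_eq_comp ((Deligne.deltaSystem (n : ℂ)).homMap f)
    (evalHom y) (evalHom (((deligneFunctor n).map f).hom y)) fun k => LinearMap.ext fun h =>
      (congrArg (deltaEquiv n k) (deligneFunctor_map_comp_apply (Z := Deligne.Delta n k)
        f h y)).symm) p

theorem evalSection_lof {Y : Deligne (n : ℂ)} {k : ℕ} (b : ⨂[ℂ] _ : Fin k, U)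
    (h : Y ⟶ Deligne.Delta n k) (y : (deligneFunctor n).obj Y) :
    (evalSection U (sectionOfHom U b h)).hom y = injSection U b
      (deltaEquiv n k (((deligneFunctor n).map h).hom y)) := by
  rw [evalSection_apply, sectionOfHom, ResSystem.Hom.map_lof, mapInv_avg]
  rfl

end SymmetricRep

/-! ### Generators of the sums of invariants -/

namespace ResSystem

variable {U : Type} [AddCommGroup U] [Module ℂ U] {S : ResSystem}

theorem total_induction {motive : S.Total U → Prop}
    (tmul : ∀ (k : ℕ) (b : ⨂[ℂ] _ : Fin k, U) (z : S.D k), motive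
      (DirectSum.lof ℂ ℕ (fun k => S.inv U k) k (S.avg U k (b ⊗ₜ[ℂ] z))))
    (add : ∀ x y, motive x → motive y → motive (x + y)) (x : S.Total U) : motive x := by
  have zero : motive 0 := by
    have := tmul 0 0 0
    rwa [TensorProduct.zero_tmul, map_zero, map_zero] at this
  induction x using DirectSum.induction_on with
  | zero => exact zero
  | add x y hx hy => exact add x y hx hy
  | of k x =>
    have key : ∀ t, motive (DirectSum.lof ℂ ℕ (fun k => S.inv U k) k (S.avg U k t)) := by
      intro t
      induction t using TensorProduct.induction_on with
      | zero =>
        rw [map_zero, map_zero]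
        exact zero
      | tmul b z => exact tmul k b z
      | add t t' h h' =>
        rw [map_add, map_add]
        exact add _ _ h h'
    have := key x
    rwa [avg_inv] at this

theorem avg_act {k : ℕ} (σ : Equiv.Perm (Fin k)) (x : S.Tens U k) :
    S.avg U k (S.act U σ x) = S.avg U k x := by
  apply Subtype.ext
  rw [coe_avg, coe_avg, ← Equiv.sum_comp (Equiv.mulRight σ) (fun τ => S.act U τ x)]
  congr 1
  refine Finset.sum_congr rfl fun τ _ => ?_
  rw [Equiv.coe_mulRight, act_mul]
  rfl

end ResSystem

/-! ### Cocones over the sections of an Ind-object -/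

namespace IndLin

variable {C : Type 1} [Category.{0} C] [Preadditive C] [Linear ℂ C] (P : IndLin C)
  {E : Type 1} [Category.{0} E] {F : C ⥤ E}

theorem map_add {Y Z : C} (f g : Z ⟶ Y) (p : P.obj.obj (Opposite.op Y)) :
    P.obj.map (f + g).op p = P.obj.map f.op p + P.obj.map g.op p := by
  rw [P.property.1]
  rfl

theorem map_smul {Y Z : C} (c : ℂ) (f : Z ⟶ Y) (p : P.obj.obj (Opposite.op Y)) :
    P.obj.map (c • f).op p = c • P.obj.map f.op p := by
  rw [P.property.2.1]
  rfl

theorem map_zero {Y Z : C} (p : P.obj.obj (Opposite.op Y)) :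
    P.obj.map (0 : Z ⟶ Y).op p = 0 := by
  have := P.map_smul 0 (0 : Z ⟶ Y) p
  rwa [zero_smul, zero_smul] at this

theorem map_comp {Y Z W : C} (f : Z ⟶ Y) (g : W ⟶ Z) (p : P.obj.obj (Opposite.op Y)) :
    P.obj.map g.op (P.obj.map f.op p) = P.obj.map (g ≫ f).op p := by
  rw [op_comp, P.obj.map_comp]
  rfl

theorem map_id {Y : C} (p : P.obj.obj (Opposite.op Y)) : P.obj.map (𝟙 Y).op p = p := by
  rw [op_id, P.obj.map_id]
  rfl

/-- The component of a cocone at a section of an Ind-object. -/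
noncomputable def leg (s : Cocone (CostructuredArrow.proj Ind.yoneda ((IndLin.toInd C).obj P) ⋙ F))
    {Y : C} (p : P.obj.obj (Opposite.op Y)) : F.obj Y ⟶ s.pt := s.ι.app (P.arrow p)

variable (s : Cocone (CostructuredArrow.proj Ind.yoneda ((IndLin.toInd C).obj P) ⋙ F))

theorem map_leg {Y Z : C} (f : Z ⟶ Y) (p : P.obj.obj (Opposite.op Y)) :
    F.map f ≫ P.leg s p = P.leg s (P.obj.map f.op p) := s.w (P.arrowMap f p)

/-- A cocone carries no additivity by definition; it is forced by biproducts. One section r over Y ⊞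
Y restricts to p, to q and, along inl + inr, to p + q, and F turns this sum of morphisms into a sum.
-/
theorem leg_add [HasFiniteBiproducts C] [Preadditive E] [F.Additive] {Y : C}
    (p q : P.obj.obj (Opposite.op Y)) :
    P.leg s (p + q) = P.leg s p + P.leg s q := by
  have := HasBinaryBiproducts.of_hasBinaryProducts (C := C)
  set r := P.obj.map (biprod.fst : Y ⊞ Y ⟶ Y).op p + P.obj.map (biprod.snd : Y ⊞ Y ⟶ Y).op q
    with hr
  have h1 : P.obj.map (biprod.inl : Y ⟶ Y ⊞ Y).op r = p := by
    rw [hr, _root_.map_add, map_comp, map_comp, biprod.inl_fst, biprod.inl_snd, map_id, map_zero,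
      add_zero]
  have h2 : P.obj.map (biprod.inr : Y ⟶ Y ⊞ Y).op r = q := by
    rw [hr, _root_.map_add, map_comp, map_comp, biprod.inr_fst, biprod.inr_snd, map_id, map_zero,
      zero_add]
  have h3 := P.map_leg s (biprod.inl + biprod.inr : Y ⟶ Y ⊞ Y) r
  rw [map_add, h1, h2, F.map_add, Preadditive.add_comp, map_leg, map_leg, h1, h2] at h3
  exact h3.symm

theorem leg_map_indExtension [HasColimits E] {P' : IndLin C} (α : P ⟶ P') {Y : C}
    (p : P.obj.obj (Opposite.op Y)) :
    P.leg (F := F) (colimit.cocone _) p ≫ (indExtension F).map ((IndLin.toInd C).map α) =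
      P'.leg (colimit.cocone _) (α.hom.app (Opposite.op Y) p) := by
  refine (colimit.ι_desc _ (P.arrow p)).trans ?_
  -- Equal morphisms index the same object of the diagram; stated separately, this avoids transport
  -- between equal objects.
  have key : ∀ m m' : Ind.yoneda.obj Y ⟶ (IndLin.toInd C).obj P', m = m' →
      (colimit.ι (CostructuredArrow.proj Ind.yoneda ((IndLin.toInd C).obj P') ⋙ F)
        (CostructuredArrow.mk m) : F.obj Y ⟶ _) =
      colimit.ι (CostructuredArrow.proj Ind.yoneda ((IndLin.toInd C).obj P') ⋙ F)
        (CostructuredArrow.mk m') := by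
    rintro m _ rfl
    rfl
  exact key _ _ (P.homOf_toInd_map α p)

end IndLin

/-! ### The sections e(b ⊗ h) -/

namespace SymmetricRep

open TensorPowers

variable {n : ℕ} {U : Type} [AddCommGroup U] [Module ℂ U]

theorem homMap_sectionOfHom {Y Z : Deligne (n : ℂ)} {k : ℕ} (b : ⨂[ℂ] _ : Fin k, U)
    (h : Y ⟶ Deligne.Delta n k) (f : Z ⟶ Y) :
    ((Deligne.deltaSystem (n : ℂ)).homMap f).map U (sectionOfHom U b h) =
      sectionOfHom U b (f ≫ h) := by
  rw [sectionOfHom, ResSystem.Hom.map_lof, mapInv_avg]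
  rfl

theorem sectionOfHom_add {Y : Deligne (n : ℂ)} {k : ℕ} (b b' : ⨂[ℂ] _ : Fin k, U)
    (h : Y ⟶ Deligne.Delta n k) :
    sectionOfHom U (b + b') h = sectionOfHom U b h + sectionOfHom U b' h := by
  unfold sectionOfHom
  rw [TensorProduct.add_tmul, map_add, map_add]

theorem sectionOfHom_smul {Y : Deligne (n : ℂ)} {k : ℕ} (c : ℂ) (b : ⨂[ℂ] _ : Fin k, U)
    (h : Y ⟶ Deligne.Delta n k) : sectionOfHom U (c • b) h = sectionOfHom U b (c • h) := by
  unfold sectionOfHom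
  rw [TensorProduct.smul_tmul]
  rfl

theorem sectionOfHom_perm {Y : Deligne (n : ℂ)} {k : ℕ} (b : ⨂[ℂ] _ : Fin k, U)
    (h : Y ⟶ Deligne.Delta n k) (σ : Equiv.Perm (Fin k)) :
    sectionOfHom U (TensorPow.perm σ b) (h ≫ Deligne.deltaMap (permDiag n σ)) =
      sectionOfHom U b h :=
  congrArg (DirectSum.lof ℂ ℕ (fun k => ((Deligne.deltaSystem (n : ℂ)).homSystem Y).inv U k) k)
    (ResSystem.avg_act (U := U) (S := (Deligne.deltaSystem (n : ℂ)).homSystem Y) σ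
      (b ⊗ₜ[ℂ] (Deligne.deltaSystem (n : ℂ)).toD h))

/-- The section e(b ⊗ id) over Δ_k is generic: all sections e(b ⊗ h) are its restrictions, and its
values are the generators e(b ⊗ z). -/
theorem evalSection_id {k : ℕ} (b : ⨂[ℂ] _ : Fin k, U) (z : InjSpace n k) :
    (evalSection U (sectionOfHom U b (𝟙 (Deligne.Delta n k)))).hom ((deltaEquiv n k).symm z) =
      injSection U b z := by
  rw [evalSection_lof, CategoryTheory.Functor.map_id]
  exact congrArg (injSection U b) ((deltaEquiv n k).apply_symm_apply z)

theorem map_permDiag_symm {k : ℕ} (σ : Equiv.Perm (Fin k)) (z : InjSpace n k) :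
    ((deligneFunctor n).map (Deligne.deltaMap (permDiag n σ))).hom ((deltaEquiv n k).symm z) =
      (deltaEquiv n k).symm (injPerm σ z) := by
  rw [LinearEquiv.eq_symm_apply, deltaEquiv_deltaMap, injEv_permDiag, LinearEquiv.apply_symm_apply]

theorem map_smul_id {k : ℕ} (c : ℂ) (y : (deligneFunctor n).obj (Deligne.Delta n k)) :
    ((deligneFunctor n).map (c • 𝟙 (Deligne.Delta n k))).hom y = c • y := by
  apply (deltaEquiv n k).injective
  rw [deltaEquiv_map_smul, CategoryTheory.Functor.map_id, map_smul]
  rfl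

end SymmetricRep

/-! ### The image of the complex tensor power as a colimit -/

namespace SymmetricRep

open TensorPowers

variable {n : ℕ} (U : Type) [AddCommGroup U] [Module ℂ U]

variable {U} in
-- The generic sections reach all generators, so the evaluation maps are jointly surjective.
theorem hom_ext_of_evalSection {M : Rep.{0} ℂ (Equiv.Perm (Fin n))}
    {f g : Rep.of (injSumRep U n) ⟶ M}
    (h : ∀ (Y : Deligne (n : ℂ)) (p : ((Deligne.deltaSystem (n : ℂ)).homSystem Y).Total U),
      evalSection U p ≫ f = evalSection U p ≫ g) : f = g := by
  apply Rep.hom_ext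
  apply Representation.IntertwiningMap.ext
  refine LinearMap.ext fun x => ?_
  induction x using ResSystem.total_induction with
  | tmul k b z =>
    have h := congrArg (fun φ => φ.hom ((deltaEquiv n k).symm z))
      (h _ (sectionOfHom U b (𝟙 (Deligne.Delta n k))))
    exact (congrArg f.hom (evalSection_id b z)).symm.trans
      (h.trans (congrArg g.hom (evalSection_id b z)))
  | add x y hx hy => rw [map_add, map_add, hx, hy]

variable [FiniteDimensional ℂ U]

/-- The diagram whose colimit is the image of the complex tensor power. -/
noncomputable abbrev imageDiagram (n : ℕ) : CostructuredArrow Ind.yoneda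
    ((IndLin.toInd (Deligne (n : ℂ))).obj (Deligne.tensorPower n U)) ⥤
      Rep.{0} ℂ (Equiv.Perm (Fin n)) :=
  CostructuredArrow.proj Ind.yoneda _ ⋙ deligneFunctor n

/-- The space `⨁ (U^{⊗ k} ⊗ ℂ Inj([k], [n]))^{S_k}` as a cocone. -/
noncomputable def evalCocone (n : ℕ) : Cocone (imageDiagram U n) where
  pt := Rep.of (injSumRep U n)
  ι :=
    { app := fun X => evalSection U ((Deligne.tensorPower n U).sectionOf X.hom)
      naturality := fun X X' f => by
        refine (map_evalSection U f.left _).trans ?_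
        refine Eq.trans ?_ (Category.comp_id _).symm
        exact congrArg (evalSection U) ((Deligne.tensorPower n U).map_sectionOf f) }

theorem leg_evalCocone {Y : Deligne (n : ℂ)}
    (p : ((Deligne.deltaSystem (n : ℂ)).homSystem Y).Total U) :
    (Deligne.tensorPower n U).leg (evalCocone U n) (Y := Y) p = evalSection U p :=
  congrArg (evalSection U) ((Deligne.tensorPower n U).sectionOf_homOf p)

variable {U} (s : Cocone (imageDiagram U n))

/-- The component of a cocone at a section of the complex tensor power. -/
noncomputable abbrev sectionLeg {Y : Deligne (n : ℂ)}
    (p : ((Deligne.deltaSystem (n : ℂ)).homSystem Y).Total U) :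
    (deligneFunctor n).obj Y ⟶ s.pt := (Deligne.tensorPower n U).leg s (Y := Y) p

theorem sectionLeg_add {Y : Deligne (n : ℂ)}
    (p q : ((Deligne.deltaSystem (n : ℂ)).homSystem Y).Total U) (y : (deligneFunctor n).obj Y) :
    (sectionLeg s (p + q)).hom y = (sectionLeg s p).hom y + (sectionLeg s q).hom y :=
  congrArg (fun φ => φ.hom y) ((Deligne.tensorPower n U).leg_add s (Y := Y) p q)

theorem sectionLeg_map {Y : Deligne (n : ℂ)} {k : ℕ} (b : ⨂[ℂ] _ : Fin k, U)
    (h : Y ⟶ Deligne.Delta n k) {Z : Deligne (n : ℂ)} (f : Z ⟶ Y) (y : (deligneFunctor n).obj Z) :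
    (sectionLeg s (sectionOfHom U b h)).hom (((deligneFunctor n).map f).hom y) =
      (sectionLeg s (sectionOfHom U b (f ≫ h))).hom y := by
  rw [← homMap_sectionOfHom b h f]
  exact congrArg (fun φ => φ.hom y) ((Deligne.tensorPower n U).map_leg s f (sectionOfHom U b h))

/-- The scalar moves across the tensor product to the endomorphism c • id of Δ_k, and from there by
the cocone condition to the argument y. -/
theorem sectionLeg_smul {k : ℕ} (c : ℂ) (b : ⨂[ℂ] _ : Fin k, U)
    (y : (deligneFunctor n).obj (Deligne.Delta n k)) :
    (sectionLeg s (sectionOfHom U (c • b) (𝟙 (Deligne.Delta n k)))).hom y =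
      c • (sectionLeg s (sectionOfHom U b (𝟙 (Deligne.Delta n k)))).hom y := by
  have h := sectionLeg_map s b (𝟙 (Deligne.Delta n k)) (c • 𝟙 (Deligne.Delta n k)) y
  rw [Category.comp_id, map_smul_id, map_smul] at h
  rw [sectionOfHom_smul]
  exact h.symm

/-- The map `b ⊗ z ↦ s_b(z)` from `U^{⊗ k} ⊗ ℂ Inj([k], [n])` to the vertex of a cocone. -/
noncomputable def descTens (k : ℕ) : (injSystem n).Tens U k →ₗ[ℂ] s.pt :=
  TensorProduct.lift (LinearMap.mk₂ ℂ (fun (b : ⨂[ℂ] _ : Fin k, U) (z : InjSpace n k) =>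
    (sectionLeg s (sectionOfHom U b (𝟙 (Deligne.Delta n k)))).hom ((deltaEquiv n k).symm z))
    (fun b b' z => by rw [sectionOfHom_add, sectionLeg_add])
    (fun c b z => sectionLeg_smul s c b _)
    (fun b z z' => (congrArg _ (map_add (deltaEquiv n k).symm z z')).trans (map_add _ _ _))
    (fun c b z => (congrArg _ (map_smul (deltaEquiv n k).symm c z)).trans (map_smul _ _ _)))

theorem descTens_tmul {k : ℕ} (b : ⨂[ℂ] _ : Fin k, U) (z : InjSpace n k) :
    descTens s k (b ⊗ₜ[ℂ] z) =
      (sectionLeg s (sectionOfHom U b (𝟙 (Deligne.Delta n k)))).hom ((deltaEquiv n k).symm z) :=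
  rfl

/-- A permutation of z is induced by an endomorphism of Δ_k, so the cocone condition transfers it to
the section. There the simultaneous permutation is absorbed by the average. -/
theorem descTens_act {k : ℕ} (σ : Equiv.Perm (Fin k)) (b : ⨂[ℂ] _ : Fin k, U)
    (z : InjSpace n k) :
    descTens s k ((injSystem n).act U σ (b ⊗ₜ[ℂ] z)) = descTens s k (b ⊗ₜ[ℂ] z) := by
  refine (descTens_tmul s (TensorPow.perm σ b) (injPerm σ z)).trans ?_
  rw [← map_permDiag_symm, sectionLeg_map, Category.comp_id, descTens_tmul]
  have h := sectionOfHom_perm b (𝟙 (Deligne.Delta n k)) σ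
  rw [Category.id_comp] at h
  rw [h]

/-- The linear map from `⨁ (U^{⊗ k} ⊗ ℂ Inj([k], [n]))^{S_k}` to the vertex of a cocone. -/
noncomputable def descLinear : InjSum U n →ₗ[ℂ] s.pt :=
  DirectSum.toModule ℂ ℕ _ fun k => descTens s k ∘ₗ ((injSystem n).inv U k).subtype

theorem descLinear_injSection {k : ℕ} (b : ⨂[ℂ] _ : Fin k, U) (z : InjSpace n k) :
    descLinear s (injSection U b z) =
      (sectionLeg s (sectionOfHom U b (𝟙 (Deligne.Delta n k)))).hom ((deltaEquiv n k).symm z) := by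
  refine (DirectSum.toModule_lof ℂ k _).trans ?_
  refine (congrArg (descTens s k) (ResSystem.coe_avg U (injSystem n) k (b ⊗ₜ[ℂ] z))).trans ?_
  rw [map_smul, map_sum, Finset.sum_congr rfl fun σ _ => descTens_act s σ b z, Finset.sum_const,
    Finset.card_univ, Fintype.card_perm, Fintype.card_fin, ← Nat.cast_smul_eq_nsmul ℂ, smul_smul,
    inv_mul_cancel₀ (by exact_mod_cast k.factorial_ne_zero), one_smul, descTens_tmul]

/-- Since e(b ⊗ h) is the restriction of e(b ⊗ id) along h, every leg is determined by those at the
generic sections, from which the map was built. -/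
theorem descLinear_evalSection {Y : Deligne (n : ℂ)}
    (p : ((Deligne.deltaSystem (n : ℂ)).homSystem Y).Total U) (y : (deligneFunctor n).obj Y) :
    descLinear s ((evalSection U p).hom y) = (sectionLeg s p).hom y := by
  induction p using ResSystem.total_induction with
  | tmul k b h =>
    refine (congrArg (descLinear s) (evalSection_lof U b h y)).trans ?_
    rw [descLinear_injSection, LinearEquiv.symm_apply_apply]
    refine (sectionLeg_map s b (𝟙 (Deligne.Delta n k)) (Y := Deligne.Delta n k)
      (Z := Y) h y).trans ?_
    exact congrArg (fun h => (sectionLeg s (sectionOfHom U b h)).hom y)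
      (Category.comp_id (X := Y) (Y := Deligne.Delta n k) h)
  | add p q hp hq =>
    rw [sectionLeg_add, ← hp, ← hq, ← map_add]
    exact congrArg (descLinear s) (map_add ((evalHom y).map U) p q)

/-- The morphism from `⨁ (U^{⊗ k} ⊗ ℂ Inj([k], [n]))^{S_k}` to the vertex of a cocone. -/
noncomputable def desc : Rep.of (injSumRep U n) ⟶ s.pt :=
  Rep.ofHom ⟨descLinear s, fun g => by
    -- Generators are values of sections, and both the evaluation maps and the legs of s are
    -- equivariant.
    refine LinearMap.ext fun x => ?_
    induction x using ResSystem.total_induction with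
    | tmul k b z =>
      have h := evalSection_id b z
      have h' := Rep.hom_comm_apply (evalSection U (sectionOfHom U b (𝟙 (Deligne.Delta n k)))) g
        ((deltaEquiv n k).symm z)
      rw [h] at h'
      refine (congrArg (descLinear s) h'.symm).trans ?_
      rw [descLinear_evalSection, Rep.hom_comm_apply]
      exact congrArg _ (descLinear_injSection s b z).symm
    | add x y hx hy => rw [map_add, map_add, hx, hy]⟩

theorem evalSection_desc {Y : Deligne (n : ℂ)}
    (p : ((Deligne.deltaSystem (n : ℂ)).homSystem Y).Total U) :
    evalSection U p ≫ desc s = sectionLeg s p := by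
  apply Rep.hom_ext
  apply Representation.IntertwiningMap.ext
  exact LinearMap.ext fun y => descLinear_evalSection s p y

variable (U) in
/-- The space `⨁ (U^{⊗ k} ⊗ ℂ Inj([k], [n]))^{S_k}` is the image of the complex tensor power. -/
noncomputable def isColimitEvalCocone (n : ℕ) : IsColimit (evalCocone U n) where
  desc := desc
  fac s X := by
    rw [(Deligne.tensorPower n U).eq_arrow X]
    exact (congrArg (fun φ => φ ≫ desc s) (leg_evalCocone U _)).trans (evalSection_desc s _)
  uniq s m hm := hom_ext_of_evalSection fun Y p =>
    ((congrArg (fun φ => φ ≫ m) (leg_evalCocone U p)).symm.trans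
      (hm ((Deligne.tensorPower n U).arrow p))).trans (evalSection_desc s p).symm

end SymmetricRep

/-! ### Endomorphisms acting on the image of the complex tensor power -/

namespace SymmetricRep

variable (n : ℕ) (U : Type) [AddCommGroup U] [Module ℂ U] [FiniteDimensional ℂ U]

/-- The image of the complex tensor power is `⨁ (U^{⊗ k} ⊗ ℂ Inj([k], [n]))^{S_k}`. -/
noncomputable def imageIso :
    (indFunctor n).obj (Deligne.tensorPower n U) ≅ Rep.of (injSumRep U n) :=
  (colimit.isColimit (imageDiagram U n)).coconePointUniqueUpToIso (isColimitEvalCocone U n)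

variable {n U}

/-- The map from the image of `Y` to the image of the complex tensor power given by a section. -/
noncomputable def imageLeg {Y : Deligne (n : ℂ)}
    (p : ((Deligne.deltaSystem (n : ℂ)).homSystem Y).Total U) :
    (deligneFunctor n).obj Y ⟶ (indFunctor n).obj (Deligne.tensorPower n U) :=
  (Deligne.tensorPower n U).leg (colimit.cocone (imageDiagram U n)) (Y := Y) p

theorem imageLeg_imageIso {Y : Deligne (n : ℂ)}
    (p : ((Deligne.deltaSystem (n : ℂ)).homSystem Y).Total U) :
    imageLeg p ≫ (imageIso n U).hom = evalSection U p :=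
  ((colimit.isColimit (imageDiagram U n)).comp_coconePointUniqueUpToIso_hom
    (isColimitEvalCocone U n) ((Deligne.tensorPower n U).arrow p)).trans (leg_evalCocone U p)

/-- The action by functoriality is thereby reduced to the action on sections, which is known from
the realizations Hom(Y, Δ_k). -/
theorem imageLeg_map {Y : Deligne (n : ℂ)} (α : End (Deligne.tensorPower (n : ℂ) U))
    (p : ((Deligne.deltaSystem (n : ℂ)).homSystem Y).Total U) :
    imageLeg p ≫ (indFunctor n).map α = imageLeg (Splitting.sectionAction n U Y α p) :=
  (Deligne.tensorPower n U).leg_map_indExtension (F := deligneFunctor n) α (Y := Y) p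

end SymmetricRep

/-! ### Equivariance of the second isomorphism -/

namespace Splitting

variable {V : Type} [AddCommGroup V] [Module ℂ V] {one : V} (h1 : one ≠ 0) {U : Submodule ℂ V}
  (hU : IsCompl (ℂ ∙ one) U) [FiniteDimensional ℂ U] {n : ℕ}

theorem evalHom_realizationAction {Y : Deligne (n : ℂ)}
    (y : (SymmetricRep.deligneFunctor n).obj Y) (a : UGL V)
    (p : ((Deligne.deltaSystem (n : ℂ)).homSystem Y).Total U) :
    (SymmetricRep.evalHom y).map U (realizationAction h1 hU (Realization.hom n Y) a p) =
      realizationAction h1 hU (Realization.inj n) a ((SymmetricRep.evalHom y).map U p) :=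
  UniversalEnvelopingAlgebra.intertwine (realizationAction h1 hU (Realization.hom n Y))
    (realizationAction h1 hU (Realization.inj n)) ((SymmetricRep.evalHom y).map U)
    (fun A x => by
      rw [realizationAction_ι, realizationAction_ι]
      exact map_glOp h1 hU (SymmetricRep.evalHom y) n A x) a p

theorem imageIso_inv_indAction (a : UGL V) (x : SymmetricRep.InjSum U n) :
    (SymmetricRep.imageIso n U).hom.hom (((SymmetricRep.indFunctor n).map
      (indAction h1 hU n a)).hom ((SymmetricRep.imageIso n U).inv.hom x)) =
    realizationAction h1 hU (Realization.inj n) a x := by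
  induction x using ResSystem.total_induction with
  | tmul k b z =>
    set p := SymmetricRep.sectionOfHom U b (𝟙 (Deligne.Delta n k))
    set y := (SymmetricRep.deltaEquiv n k).symm z
    have hz : (SymmetricRep.evalSection U p).hom y = SymmetricRep.injSection U b z :=
      SymmetricRep.evalSection_id b z
    -- On the leg at p the induced endomorphism replaces p by its image under the section action;
    -- evaluating at y then gives the assertion for the generator.
    have e1 : SymmetricRep.evalSection U p ≫ (SymmetricRep.imageIso n U).inv ≫
        (SymmetricRep.indFunctor n).map (indAction h1 hU n a) ≫ (SymmetricRep.imageIso n U).hom =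
        SymmetricRep.evalSection U (sectionAction n U _ (indAction h1 hU n a) p) := by
      rw [← SymmetricRep.imageLeg_imageIso p, Category.assoc, Iso.hom_inv_id_assoc,
        ← Category.assoc, SymmetricRep.imageLeg_map]
      exact SymmetricRep.imageLeg_imageIso _
    have e2 := congrArg (fun φ => φ.hom y) e1
    refine Eq.trans ?_ (e2.trans ?_)
    · exact congrArg (fun x => (SymmetricRep.imageIso n U).hom.hom
        (((SymmetricRep.indFunctor n).map (indAction h1 hU n a)).hom
          ((SymmetricRep.imageIso n U).inv.hom x))) hz.symm
    · refine Eq.trans ?_ (congrArg (realizationAction h1 hU (Realization.inj n) a) hz)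
      refine Eq.trans ?_ (evalHom_realizationAction h1 hU y a p)
      exact congrArg ((SymmetricRep.evalHom y).map U) (sectionAction_indAction h1 hU n _ a p)
  | add x y hx hy =>
    simp only [map_add, hx, hy]
    exact (map_add (realizationAction h1 hU (Realization.inj n) a) x y).symm

variable (n) in
/-- The isomorphism `⨁ (U^{⊗ k} ⊗ ℂ Inj([k], [n]))^{S_k} ≅ V^{⊗ n}` of representations. -/
noncomputable def collapseIso :
    Rep.of (SymmetricRep.injSumRep U n) ≅ Rep.of (SymmetricRep.tensorRep V n) :=
  Rep.mkIso
    { (SymmetricRep.expandEquiv h1 hU n).symm with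
      toLinearMap := SymmetricRep.collapse one U n
      isIntertwining' := fun g => LinearMap.ext fun x => SymmetricRep.collapse_rep g x
      left_inv := SymmetricRep.expandEquiv_collapse h1 hU
      right_inv := SymmetricRep.collapse_expandEquiv h1 hU }

theorem imageIso_collapseIso_indAction (a : UGL V)
    (x : (SymmetricRep.indFunctor n).obj (Deligne.tensorPower (n : ℂ) U)) :
    (SymmetricRep.imageIso n U ≪≫ collapseIso h1 hU n).hom.hom
      (((SymmetricRep.indFunctor n).map (indAction h1 hU n a)).hom x) =
    tensorAction V n a ((SymmetricRep.imageIso n U ≪≫ collapseIso h1 hU n).hom.hom x) := by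
  have hx : (SymmetricRep.imageIso n U).inv.hom ((SymmetricRep.imageIso n U).hom.hom x) = x :=
    congrArg (fun φ => φ.hom x) (SymmetricRep.imageIso n U).hom_inv_id
  have h := imageIso_inv_indAction h1 hU a ((SymmetricRep.imageIso n U).hom.hom x)
  rw [hx] at h
  exact (congrArg (SymmetricRep.collapse one U n) h).trans
    (collapse_realizationAction h1 hU n a _)

end Splitting

theorem mainTheorem5 (V : Type) [AddCommGroup V] [Module ℂ V] [FiniteDimensional ℂ V]
    (one : V) (h1 : one ≠ 0) (U : Submodule ℂ V) (hU : IsCompl (ℂ ∙ one) U) (n : ℕ) :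
    (∃ ρ : UGL V →ₐ[ℂ] Module.End ℂ (SymmetricRep.InjSum U n),
      Splitting.IsGivenBy h1 hU ρ (n : ℂ) ((SymmetricRep.injSystem n).create U)
        ((SymmetricRep.injSystem n).annih U) ((SymmetricRep.injSystem n).diagonal U) ∧
      ∃ Φ : (⨂[ℂ] _ : Fin n, V) ≃ₗ[ℂ] SymmetricRep.InjSum U n,
        Φ (PiTensorProduct.tprod ℂ fun _ => one) =
          SymmetricRep.injElement (k := 0) Fin.elim0 ⟨Fin.elim0, fun i => i.elim0⟩ ∧
        (∀ (k : ℕ) (j : Fin k ↪o Fin n) (w : Fin k → U) (v : Fin n → V),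
          (∀ s, v (j s) = w s) → (∀ i, i ∉ Set.range j → v i = one) →
            Φ (PiTensorProduct.tprod ℂ v) = SymmetricRep.injElement w j.toEmbedding) ∧
        (∀ (g : Equiv.Perm (Fin n)) (x : ⨂[ℂ] _ : Fin n, V),
          Φ (SymmetricRep.tensorRep V n g x) = SymmetricRep.injSumRep U n g (Φ x)) ∧
        ∀ (a : UGL V) (x : ⨂[ℂ] _ : Fin n, V), Φ (tensorAction V n a x) = ρ a (Φ x)) ∧
    (∃ ρ : UGL V →ₐ[ℂ] End (Deligne.tensorPower (n : ℂ) U),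
      Splitting.IsGivenBy h1 hU ρ (n : ℂ) ((Deligne.deltaSystem (n : ℂ)).create U)
        ((Deligne.deltaSystem (n : ℂ)).annih U) ((Deligne.deltaSystem (n : ℂ)).diagonal U) ∧
      ∃ Ψ : (SymmetricRep.indFunctor n).obj (Deligne.tensorPower (n : ℂ) U) ≅
          Rep.of (SymmetricRep.tensorRep V n),
        ∀ (a : UGL V) (x : (SymmetricRep.indFunctor n).obj (Deligne.tensorPower (n : ℂ) U)),
          Ψ.hom.hom (((SymmetricRep.indFunctor n).map (ρ a)).hom x) =
            tensorAction V n a (Ψ.hom.hom x)) := by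
  -- The explicit formula holds for every injection, not only increasing ones; k = 0 gives the
  -- normalisation on 𝟙 ⊗ ⋯ ⊗ 𝟙.
  have key : ∀ (k : ℕ) (f : Fin k ↪ Fin n) (w : Fin k → U) (v : Fin n → V),
      (∀ s, v (f s) = w s) → (∀ i, i ∉ Set.range f → v i = one) →
        SymmetricRep.expandEquiv h1 hU n (PiTensorProduct.tprod ℂ v) =
          SymmetricRep.injElement w f := by
    intro k f w v hv hv'
    rw [SymmetricRep.eq_place one f w v hv hv', ← SymmetricRep.collapse_injElement,
      SymmetricRep.expandEquiv_collapse]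
  refine ⟨⟨Splitting.realizationAction h1 hU (Realization.inj n),
    Splitting.realizationAction_isGivenBy h1 hU (Realization.inj n),
    SymmetricRep.expandEquiv h1 hU n, key 0 _ _ _ (fun s => s.elim0) (fun _ _ => rfl),
    fun k j w v hv hv' => key k j.toEmbedding w v hv hv', fun g x => ?_, fun a x => ?_⟩,
    Splitting.indAction h1 hU n, Splitting.indAction_isGivenBy h1 hU n,
    SymmetricRep.imageIso n U ≪≫ Splitting.collapseIso h1 hU n,
    Splitting.imageIso_collapseIso_indAction h1 hU⟩
  -- Equivariance was shown for `collapse` and is transferred to its inverse; likewise for the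
  -- action of U(gl(V)).
  · rw [← SymmetricRep.expandEquiv_collapse h1 hU (SymmetricRep.injSumRep U n g _),
      SymmetricRep.collapse_rep, SymmetricRep.collapse_expandEquiv]
  · refine (SymmetricRep.expandEquiv h1 hU n).symm.injective ?_
    rw [LinearEquiv.symm_apply_apply]
    refine Eq.trans ?_ (Splitting.collapse_realizationAction h1 hU n a _).symm
    rw [SymmetricRep.collapse_expandEquiv]
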